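/- Let $n\ge 1$, let $\Omega\subset\mathbb{R}^n$ be a domain (a nonempty connected open set), let $0\le\gamma<\infty$, and put $\varphi(t)=(1+t)^{\gamma}$ for $t\ge 0$. Write $B(x,r)$ for the open Euclidean ball with centre $x$ and radius $r$, $|E|$ for the Lebesgue measure of $E$, and $\Omega^c=\mathbb{R}^n\setminus\Omega$, with the convention $\mathrm{dist}(x,\emptyset)=\infty$. For a real function $f$ that is measurable on $\Omega$ and $x\in\Omega$, the local new maximal operator is $$M_{\varphi,\Omega}f(x)=\sup_{0<r<\mathrm{dist}(x,\Omega^c)}\frac{1}{\varphi(|B(x,r)|)\,|B(x,r)|}\int_{B(x,r)}|f(y)|\,dy\in[0,\infty].$$ For $1<p<\infty$ let $W^{1,p}(\Omega)$ be the Sobolev space of real functions $f\in L^p(\Omega)$ with a weak gradient $\nabla f\in L^p(\Omega)$, normed by $\|f\|_{W^{1,p}(\Omega)}=\|f\|_{L^p(\Omega)}+\|\nabla f\|_{L^p(\Omega)}$, and let $W^{1,p}_0(\Omega)$ be the closure in $W^{1,p}(\Omega)$ of the smooth functions with compact support in $\Omega$. Let $1<p<\infty$. Then: - (i) For every $f\in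 W^{1,p}(\Omega)$, the functions $M_{\varphi,\Omega}f$ and $M_{\varphi,\Omega}|\nabla f|$ are finite almost everywhere on $\Omega$, $M_{\varphi,\Omega}f\in W^{1,p}(\Omega)$, and for almost every $x\in\Omega$ $$|\nabla M_{\varphi,\Omega}f(x)|\le \gamma n\,M_{\varphi,\Omega}f(x)+2M_{\varphi,\Omega}|\nabla f|(x).$$ - (ii) The map $M_{\varphi,\Omega}:W^{1,p}(\Omega)\to W^{1,p}(\Omega)$ is bounded: there is a constant $C>0$ such that $\|M_{\varphi,\Omega}f\|_{W^{1,p}(\Omega)}\le C\|f\|_{W^{1,p}(\Omega)}$ for all $f\in W^{1,p}(\Omega)$. - (iii) If $f\in W^{1,p}_0(\Omega)$, then $M_{\varphi,\Omega}f\in W^{1,p}_0(\Omega)$. -/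

import Mathlib

open MeasureTheory Set
open scoped ENNReal ContDiff

noncomputable section

/-- The weight `φ(t) = (1 + t) ^ γ`. -/
def phiWeight (γ t : ℝ) : ℝ := (1 + t) ^ γ

/-- The local new maximal operator `M_{φ,Ω}`, applied to `f` at the point `x`, with values in
`[0, ∞]`: the supremum over `0 < r < dist(x, Ωᶜ)` of
`(φ(|B(x,r)|) |B(x,r)|)⁻¹ ∫_{B(x,r)} |f|`.  The distance to the empty set is `∞`, so for
`Ω = ℝⁿ` all radii `r > 0` are allowed.  Only the values of `f` on `Ω` enter when `x ∈ Ω`. -/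
def localNewMaximal {n : ℕ} (γ : ℝ) (Ω : Set (EuclideanSpace ℝ (Fin n)))
    (f : EuclideanSpace ℝ (Fin n) → ℝ) (x : EuclideanSpace ℝ (Fin n)) : ℝ≥0∞ :=
  ⨆ (r : ℝ) (_ : 0 < r) (_ : ENNReal.ofReal r < Metric.infEDist x Ωᶜ),
    (∫⁻ y in Metric.ball x r, ‖f y‖ₑ) /
      (ENNReal.ofReal (phiWeight γ (volume.real (Metric.ball x r))) *
        volume (Metric.ball x r))

/-- The same operator as a real-valued function, for use where `localNewMaximal` is finite
almost everywhere. -/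
def localNewMaximalReal {n : ℕ} (γ : ℝ) (Ω : Set (EuclideanSpace ℝ (Fin n)))
    (f : EuclideanSpace ℝ (Fin n) → ℝ) (x : EuclideanSpace ℝ (Fin n)) : ℝ :=
  (localNewMaximal γ Ω f x).toReal

/-- `ψ` is a test function on `Ω`, i.e. `ψ ∈ C_0^∞(Ω)`: smooth with compact support in `Ω`. -/
def IsTestFunction {n : ℕ} (Ω : Set (EuclideanSpace ℝ (Fin n)))
    (ψ : EuclideanSpace ℝ (Fin n) → ℝ) : Prop :=
  ContDiff ℝ ∞ ψ ∧ HasCompactSupport ψ ∧ tsupport ψ ⊆ Ω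

/-- `g` is a weak gradient of `f` on `Ω`: both are locally integrable on `Ω` and
`∫_Ω f D_i ψ = - ∫_Ω g_i ψ` for all test functions `ψ` and all `i`. -/
def HasWeakGradient {n : ℕ} (Ω : Set (EuclideanSpace ℝ (Fin n)))
    (f : EuclideanSpace ℝ (Fin n) → ℝ)
    (g : EuclideanSpace ℝ (Fin n) → EuclideanSpace ℝ (Fin n)) : Prop :=
  LocallyIntegrableOn f Ω ∧ LocallyIntegrableOn g Ω ∧
    ∀ ψ : EuclideanSpace ℝ (Fin n) → ℝ, IsTestFunction Ω ψ → ∀ i : Fin n,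
      ∫ x in Ω, f x * fderiv ℝ ψ x (EuclideanSpace.single i 1) = -∫ x in Ω, g x i * ψ x

open Classical in
/-- The weak gradient `∇f` on `Ω`; on an open set it is unique up to null sets, and a
representative is chosen.  (It is `0` if `f` has no weak gradient.) -/
def weakGradient {n : ℕ} (Ω : Set (EuclideanSpace ℝ (Fin n)))
    (f : EuclideanSpace ℝ (Fin n) → ℝ) : EuclideanSpace ℝ (Fin n) → EuclideanSpace ℝ (Fin n) :=
  if h : ∃ g, HasWeakGradient Ω f g then h.choose else 0

/-- The Sobolev norm `‖f‖_{W^{1,p}(Ω)} = ‖f‖_{L^p(Ω)} + ‖∇f‖_{L^p(Ω)}`, for weakly differentiable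
`f`. -/
def sobolevNorm {n : ℕ} (p : ℝ≥0∞) (Ω : Set (EuclideanSpace ℝ (Fin n)))
    (f : EuclideanSpace ℝ (Fin n) → ℝ) : ℝ≥0∞ :=
  eLpNorm f p (volume.restrict Ω) + eLpNorm (weakGradient Ω f) p (volume.restrict Ω)

/-- `f ∈ W^{1,p}(Ω)`: `f` is in `L^p(Ω)` and has a weak gradient, which is in `L^p(Ω)`. -/
def MemSobolev {n : ℕ} (p : ℝ≥0∞) (Ω : Set (EuclideanSpace ℝ (Fin n)))
    (f : EuclideanSpace ℝ (Fin n) → ℝ) : Prop :=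
  MemLp f p (volume.restrict Ω) ∧ (∃ g, HasWeakGradient Ω f g) ∧
    MemLp (weakGradient Ω f) p (volume.restrict Ω)

/-- `f ∈ W_0^{1,p}(Ω)`: `f` lies in the closure of `C_0^∞(Ω)` in `W^{1,p}(Ω)`. -/
def MemSobolevZero {n : ℕ} (p : ℝ≥0∞) (Ω : Set (EuclideanSpace ℝ (Fin n)))
    (f : EuclideanSpace ℝ (Fin n) → ℝ) : Prop :=
  MemSobolev p Ω f ∧ ∀ ε : ℝ≥0∞, 0 < ε →
    ∃ ψ : EuclideanSpace ℝ (Fin n) → ℝ, IsTestFunction Ω ψ ∧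
      sobolevNorm p Ω (fun x => f x - ψ x) < ε

end

open MeasureTheory Set
open scoped ENNReal ContDiff
open Filter Topology
open scoped Convolution

/-! The argument proves the gradient bound with `2 M|∇f|` alone, so the term `γ n M f` is pure
slack. The weight enters only through `φ ≥ 1` and the monotonicity of `φ`.

Pull every average back to the unit ball: the quotient for `B(x,r)` is `∫_{B(0,1)} |f(x + r z)| dz`
divided by a factor that increases with `r`. For `r > |a|` compare `B(x,r)` with the inner ball `B(x
+ a, r - |a|)`. Each `z` moves by at most `2|a|`, and the points on the way lie in balls `B(x + s a,
r - s|a|)`, which stay inside `B(x,r)`. Passing to a smaller radius only lowers the normalizing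
factor, so every loss has the favourable sign. This gives the segment inequality
`localNewMaximal_le_add_segment`: `M f(x) ≤ M f(x + a) + 2|a| ∫₀¹ M|∇f|(x + s a) ds`.

Used in both directions and tested against difference quotients of a test function, it yields `|∫ M
f · ∂_a ψ| ≤ |a| ∫ 2 M|∇f| |ψ|` (`abs_integral_mul_fderiv_le_of_segment`). A function with such a
bound has a weak gradient dominated by `2 M|∇f|`, by a Riesz representation argument
(`exists_hasWeakGradient_of_abs_integral_le`). Together with the Hardy–Littlewood theorem on `L^p`
this gives (i) and (ii).

For (iii), a function in `W^{1,p}` bounded by the boundary distance times an `L^p` function lies in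
`W_0^{1,p}` (`HasWeakGradient.memSobolevZero_of_le`). For a test function `ψ`, `M ψ` has such a
bound: near the boundary, each ball is compared with a concentric ball on which `ψ` vanishes. If `ψ`
approximates `f`, sublinearity gives `|M f - M(f - ψ)| ≤ M ψ`, so this difference is in `W_0^{1,p}`,
while `M(f - ψ)` is small by (ii). Continuity of `M` on `W^{1,p}` is not needed. -/

/-! ### The Hardy–Littlewood maximal theorem. -/

/-- The centred Hardy–Littlewood maximal function of a nonnegative function. -/
noncomputable def hlMaximal {n : ℕ} (F : EuclideanSpace ℝ (Fin n) → ℝ≥0∞)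
    (x : EuclideanSpace ℝ (Fin n)) :
    ℝ≥0∞ :=
  ⨆ (r : ℝ) (_ : 0 < r), (∫⁻ y in Metric.ball x r, F y) / volume (Metric.ball x r)

/-- The balls of radius `r - 1/(k+1)` exhaust the open ball, so one of them already carries more
than `c`; a centre within `1/(k+1)` of `x` has this smaller ball inside its own ball of radius `r`.
-/
theorem lowerSemicontinuous_lintegral_ball {n : ℕ} (F : EuclideanSpace ℝ (Fin n) → ℝ≥0∞)
    (r : ℝ) : LowerSemicontinuous fun x => ∫⁻ y in Metric.ball x r, F y := by
  intro x c hc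
  have hmono : Monotone fun k : ℕ => Metric.ball x (r - 1 / ((k : ℝ) + 1)) := by
    intro k l hkl
    apply Metric.ball_subset_ball
    have := one_div_le_one_div_of_le (by positivity : (0 : ℝ) < (k : ℝ) + 1)
      (by exact_mod_cast Nat.succ_le_succ hkl : (k : ℝ) + 1 ≤ (l : ℝ) + 1)
    linarith
  have hU : ⋃ k : ℕ, Metric.ball x (r - 1 / ((k : ℝ) + 1)) = Metric.ball x r := by
    ext y
    simp only [mem_iUnion, Metric.mem_ball]
    constructor
    · rintro ⟨k, hk⟩
      have : (0 : ℝ) < 1 / ((k : ℝ) + 1) := by positivity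
      linarith
    · intro h
      obtain ⟨k, hk⟩ := exists_nat_one_div_lt (sub_pos.2 h)
      exact ⟨k, by linarith⟩
  have hs := (hmono.directed_le).measure_iUnion (μ := volume.withDensity F)
  rw [hU, withDensity_apply' F] at hs
  change c < ∫⁻ y in Metric.ball x r, F y at hc
  rw [hs, lt_iSup_iff] at hc
  obtain ⟨k, hk⟩ := hc
  rw [withDensity_apply' F] at hk
  filter_upwards [Metric.ball_mem_nhds x (by positivity : (0 : ℝ) < 1 / ((k : ℝ) + 1))] with z hz
  refine hk.trans_le (lintegral_mono_set ?_)
  apply Metric.ball_subset_ball'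
  rw [dist_comm]
  rw [Metric.mem_ball] at hz
  linarith

theorem volume_ball_scale {n : ℕ} (x : EuclideanSpace ℝ (Fin n)) {r : ℝ} (hr : 0 < r) :
    volume (Metric.ball x r) =
      ENNReal.ofReal (r ^ n) * volume (Metric.ball (0 : EuclideanSpace ℝ (Fin n)) 1) := by
  have := Measure.addHaar_ball_of_pos (volume : Measure (EuclideanSpace ℝ (Fin n))) x hr
  simpa using this

theorem volume_unit_ball_ne_zero {n : ℕ} :
    volume (Metric.ball (0 : EuclideanSpace ℝ (Fin n)) 1) ≠ 0 :=
  (Metric.measure_ball_pos volume _ one_pos).ne'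

theorem volume_unit_ball_ne_top {n : ℕ} :
    volume (Metric.ball (0 : EuclideanSpace ℝ (Fin n)) 1) ≠ ⊤ :=
  measure_ball_lt_top.ne

theorem lowerSemicontinuous_hlMaximal {n : ℕ} (F : EuclideanSpace ℝ (Fin n) → ℝ≥0∞) :
    LowerSemicontinuous (hlMaximal F) := by
  unfold hlMaximal
  refine lowerSemicontinuous_iSup fun r => lowerSemicontinuous_iSup fun hr => ?_
  have : (fun x => (∫⁻ y in Metric.ball x r, F y) / volume (Metric.ball x r)) =
      (fun t : ℝ≥0∞ => t / volume (Metric.ball (0 : EuclideanSpace ℝ (Fin n)) r)) ∘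
        fun x => ∫⁻ y in Metric.ball x r, F y := by
    funext x
    simp only [Function.comp]
    rw [volume_ball_scale x hr, volume_ball_scale 0 hr]
  rw [this]
  refine Continuous.comp_lowerSemicontinuous ?_ (lowerSemicontinuous_lintegral_ball F r) ?_
  · exact ENNReal.continuous_div_const _ (Metric.measure_ball_pos volume _ hr).ne'
  · intro a b hab
    exact ENNReal.div_le_div_right hab _

theorem lt_hlMaximal_iff {n : ℕ} {F : EuclideanSpace ℝ (Fin n) → ℝ≥0∞}
    {x : EuclideanSpace ℝ (Fin n)} {t : ℝ≥0∞} :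
    t < hlMaximal F x ↔
      ∃ r : ℝ, 0 < r ∧ t * volume (Metric.ball x r) < ∫⁻ y in Metric.ball x r, F y := by
  simp only [hlMaximal, lt_iSup_iff, exists_prop]
  refine exists_congr fun r => and_congr_right fun hr => ?_
  rw [ENNReal.lt_div_iff_mul_lt (Or.inl (Metric.measure_ball_pos volume _ hr).ne')
    (Or.inl measure_ball_lt_top.ne)]

/-- Vitali covering: the balls whose average exceeds `t` have bounded radii because `F` is
integrable, and a disjoint subfamily, enlarged by the factor `4`, covers the superlevel set. -/
theorem hlMaximal_weak_type {n : ℕ} (hn : 1 ≤ n) {F : EuclideanSpace ℝ (Fin n) → ℝ≥0∞}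
    (hF : ∫⁻ y, F y ≠ ⊤) {t : ℝ≥0∞} (ht : t ≠ 0) (ht' : t ≠ ⊤) :
    t * volume {x | t < hlMaximal F x} ≤ 4 ^ n * ∫⁻ y, F y := by
  set w := volume (Metric.ball (0 : EuclideanSpace ℝ (Fin n)) 1) with hw
  have hw0 : w ≠ 0 := volume_unit_ball_ne_zero
  have hwt : w ≠ ⊤ := volume_unit_ball_ne_top
  set S : Set (EuclideanSpace ℝ (Fin n) × ℝ) := {a | 0 < a.2 ∧
    t * volume (Metric.ball a.1 a.2) < ∫⁻ y in Metric.ball a.1 a.2, F y} with hS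
  have hc0 : t * w ≠ 0 := mul_ne_zero ht hw0
  have hct : t * w ≠ ⊤ := ENNReal.mul_ne_top ht' hwt
  have hR : ∀ a ∈ S, a.2 ≤ (1 + (∫⁻ y, F y) / (t * w)).toReal := by
    rintro ⟨x, r⟩ ⟨hr, ha⟩
    simp only at hr ha ⊢
    rw [volume_ball_scale x hr] at ha
    have h1 : ENNReal.ofReal (r ^ n) ≤ (∫⁻ y, F y) / (t * w) := by
      rw [ENNReal.le_div_iff_mul_le (Or.inl hc0) (Or.inl hct)]
      calc ENNReal.ofReal (r ^ n) * (t * w) = t * (ENNReal.ofReal (r ^ n) * w) := by ring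
        _ ≤ ∫⁻ y in Metric.ball x r, F y := ha.le
        _ ≤ _ := setLIntegral_le_lintegral _ _
    have hfin : (1 + (∫⁻ y, F y) / (t * w)) ≠ ⊤ :=
      ENNReal.add_ne_top.2 ⟨ENNReal.one_ne_top, ENNReal.div_ne_top hF hc0⟩
    rw [← ENNReal.ofReal_le_iff_le_toReal hfin]
    -- Only `r ^ n` is controlled; `r ≤ 1 + r ^ n` holds because `n ≥ 1`.
    refine le_trans ?_ (add_le_add_right h1 1)
    rw [← ENNReal.ofReal_one, ← ENNReal.ofReal_add zero_le_one (by positivity)]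
    apply ENNReal.ofReal_le_ofReal
    rcases le_total r 1 with h | h
    · have : 0 ≤ r ^ n := by positivity
      linarith
    · have : r ≤ r ^ n := le_self_pow₀ h (by omega)
      linarith
  obtain ⟨u, huS, hdisj, hcov⟩ := Vitali.exists_disjoint_subfamily_covering_enlargement_ball
    S Prod.fst Prod.snd _ hR 4 (by norm_num)
  have hucount : u.Countable := hdisj.countable_of_isOpen (fun _ _ => Metric.isOpen_ball)
    (fun a ha => Metric.nonempty_ball.2 (huS ha).1)
  have hsub : {x | t < hlMaximal F x} ⊆ ⋃ b ∈ u, Metric.ball b.1 (4 * b.2) := by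
    intro x hx
    obtain ⟨r, hr, h⟩ := lt_hlMaximal_iff.1 hx
    obtain ⟨b, hb, hbs⟩ := hcov (x, r) ⟨hr, h⟩
    exact mem_iUnion₂.2 ⟨b, hb, hbs (Metric.mem_ball_self hr)⟩
  calc t * volume {x | t < hlMaximal F x}
      ≤ t * ∑' b : u, volume (Metric.ball b.1.1 (4 * b.1.2)) := by
        gcongr
        exact (measure_mono hsub).trans (measure_biUnion_le _ hucount _)
    _ = ∑' b : u, 4 ^ n * (t * volume (Metric.ball b.1.1 b.1.2)) := by
        rw [← ENNReal.tsum_mul_left]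
        congr 1
        funext b
        have hb := (huS b.2).1
        rw [volume_ball_scale _ hb, volume_ball_scale _ (by positivity), mul_pow,
          ENNReal.ofReal_mul (by positivity), ENNReal.ofReal_pow (by positivity)]
        simp only [ENNReal.ofReal_ofNat]
        ring
    _ ≤ ∑' b : u, 4 ^ n * ∫⁻ y in Metric.ball b.1.1 b.1.2, F y := by
        refine ENNReal.tsum_le_tsum fun b => ?_
        gcongr
        exact (huS b.2).2.le
    _ = 4 ^ n * ∫⁻ y in ⋃ b ∈ u, Metric.ball b.1 b.2, F y := by
        rw [ENNReal.tsum_mul_left, lintegral_biUnion hucount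
          (fun b _ => Metric.isOpen_ball.measurableSet) hdisj]
    _ ≤ _ := by gcongr; exact Measure.restrict_le_self

/-- The values of `g` up to `t / 2` contribute at most `t / 2` to any average, so the truncation to
larger values has maximal function above `t / 2`. The weak type bound at that level costs the factor
`2`. -/
theorem hlMaximal_truncated_weak_type {n : ℕ} (hn : 1 ≤ n)
    {g : EuclideanSpace ℝ (Fin n) → ℝ} (hg : Measurable g)
    {t : ℝ} (ht : 0 < t)
    (hfin : ∫⁻ y in {y | t < 2 * g y}, ENNReal.ofReal (g y) ≠ ⊤) :
    ENNReal.ofReal t * volume {x | ENNReal.ofReal t < hlMaximal (fun y => ENNReal.ofReal (g y)) x} ≤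
      2 * 4 ^ n * ∫⁻ y in {y | t < 2 * g y}, ENNReal.ofReal (g y) := by
  have hms : MeasurableSet {y | t < 2 * g y} := measurableSet_lt measurable_const (hg.const_mul 2)
  set F₁ : EuclideanSpace ℝ (Fin n) → ℝ≥0∞ :=
    {y | t < 2 * g y}.indicator fun y => ENNReal.ofReal (g y) with hF₁
  have hI : ∫⁻ y, F₁ y = ∫⁻ y in {y | t < 2 * g y}, ENNReal.ofReal (g y) :=
    lintegral_indicator hms _
  have ht2 : 0 < t / 2 := by positivity
  have hsub : {x | ENNReal.ofReal t < hlMaximal (fun y => ENNReal.ofReal (g y)) x} ⊆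
      {x | ENNReal.ofReal (t / 2) < hlMaximal F₁ x} := by
    intro x hx
    obtain ⟨r, hr, h⟩ := lt_hlMaximal_iff.1 hx
    refine lt_hlMaximal_iff.2 ⟨r, hr, ?_⟩
    have h1 : ∫⁻ y in Metric.ball x r, ENNReal.ofReal (g y) ≤
        (∫⁻ y in Metric.ball x r, F₁ y) + ENNReal.ofReal (t / 2) * volume (Metric.ball x r) := by
      rw [← setLIntegral_const, ← lintegral_add_right _ measurable_const]
      refine lintegral_mono fun y => ?_
      by_cases hy : t < 2 * g y
      · simp [hF₁, hy]
      · simp only [hF₁, indicator, mem_ofPred_eq, hy, if_false, zero_add]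
        exact ENNReal.ofReal_le_ofReal (by linarith)
    have h2 := h.trans_le h1
    have h3 : ENNReal.ofReal t = ENNReal.ofReal (t / 2) + ENNReal.ofReal (t / 2) := by
      rw [← ENNReal.ofReal_add ht2.le ht2.le, add_halves]
    rw [h3, add_mul] at h2
    exact lt_of_add_lt_add_right h2
  have hw := hlMaximal_weak_type hn (F := F₁) (hI ▸ hfin) (t := ENNReal.ofReal (t / 2))
    (ENNReal.ofReal_pos.2 ht2).ne' ENNReal.ofReal_ne_top
  rw [hI] at hw
  calc _ = 2 * (ENNReal.ofReal (t / 2) * volume {x | ENNReal.ofReal t <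
          hlMaximal (fun y => ENNReal.ofReal (g y)) x}) := by
        rw [← mul_assoc]
        congr 1
        rw [← ENNReal.ofReal_ofNat 2, ← ENNReal.ofReal_mul (by norm_num)]
        congr 1
        ring
    _ ≤ 2 * (ENNReal.ofReal (t / 2) * volume {x | ENNReal.ofReal (t / 2) < hlMaximal F₁ x}) := by
        gcongr
    _ ≤ 2 * (4 ^ n * _) := by gcongr
    _ = _ := by ring

theorem lintegral_superlevel_le {n : ℕ} {g : EuclideanSpace ℝ (Fin n) → ℝ} (hg : Measurable g)
    {q : ℝ} (hq : 1 < q) {t : ℝ} (ht : 0 < t) :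
    ENNReal.ofReal (t ^ (q - 1)) * ∫⁻ y in {y | t < 2 * g y}, ENNReal.ofReal (g y) ≤
      ENNReal.ofReal (2 ^ (q - 1)) * ∫⁻ y, ENNReal.ofReal (g y ^ q) := by
  have hms : MeasurableSet {y | t < 2 * g y} := measurableSet_lt measurable_const (hg.const_mul 2)
  refine le_trans ?_ (mul_le_mul_right (setLIntegral_le_lintegral {y | t < 2 * g y} _) _)
  rw [← lintegral_const_mul' _ _ ENNReal.ofReal_ne_top,
    ← lintegral_const_mul' _ _ ENNReal.ofReal_ne_top]
  refine setLIntegral_mono' hms fun y hy => ?_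
  have hy' : t < 2 * g y := hy
  have hgy : 0 < g y := by linarith
  rw [← ENNReal.ofReal_mul (by positivity), ← ENNReal.ofReal_mul (by positivity)]
  apply ENNReal.ofReal_le_ofReal
  have h1 : t ^ (q - 1) ≤ (2 * g y) ^ (q - 1) :=
    Real.rpow_le_rpow ht.le hy'.le (by linarith)
  rw [Real.mul_rpow (by norm_num) hgy.le] at h1
  have h2 : g y ^ q = g y ^ (q - 1) * g y := by
    rw [← Real.rpow_add_one hgy.ne', sub_add_cancel]
  rw [h2, ← mul_assoc]
  gcongr

theorem ENNReal.eq_zero_of_forall_ofReal_mul_le {a c : ℝ≥0∞} (hc : c ≠ ⊤) {q : ℝ} (hq : 0 < q)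
    (h : ∀ t : ℝ, 0 < t → ENNReal.ofReal (t ^ q) * a ≤ c) : a = 0 := by
  by_contra ha
  have h1 := h ((c / a + 1).toReal ^ q⁻¹)
  rcases eq_or_ne a ⊤ with rfl | hat
  · have := h 1 one_pos
    simp at this
    exact hc this
  have hfin : c / a + 1 ≠ ⊤ := ENNReal.add_ne_top.2 ⟨ENNReal.div_ne_top hc ha, ENNReal.one_ne_top⟩
  have hpos : 0 < (c / a + 1).toReal := ENNReal.toReal_pos (by simp) hfin
  have h2 := h1 (by positivity)
  rw [← Real.rpow_mul hpos.le, inv_mul_cancel₀ hq.ne', Real.rpow_one, ENNReal.ofReal_toReal hfin,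
    ← ENNReal.le_div_iff_mul_le (Or.inl ha) (Or.inl hat)] at h2
  exact absurd h2 (not_le.2 (ENNReal.lt_add_right (ENNReal.div_ne_top hc ha) one_ne_zero))

/-- The weak type bound and Chebyshev on the superlevel set bound `t ^ q * |{M = ∞}|` by a constant
independent of `t`. -/
theorem ae_hlMaximal_lt_top {n : ℕ} (hn : 1 ≤ n) {g : EuclideanSpace ℝ (Fin n) → ℝ}
    (hg : Measurable g) {q : ℝ} (hq : 1 < q)
    (hfin : ∫⁻ y, ENNReal.ofReal (g y ^ q) ≠ ⊤) :
    ∀ᵐ x, hlMaximal (fun y => ENNReal.ofReal (g y)) x < ⊤ := by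
  have hne : ∀ t : ℝ, 0 < t → ∫⁻ y in {y | t < 2 * g y}, ENNReal.ofReal (g y) ≠ ⊤ := by
    intro t ht htop
    have := lintegral_superlevel_le hg hq ht
    rw [htop, ENNReal.mul_top (ENNReal.ofReal_pos.2 (by positivity)).ne'] at this
    exact ENNReal.mul_ne_top ENNReal.ofReal_ne_top hfin (top_le_iff.1 this)
  have hz : volume {x | hlMaximal (fun y => ENNReal.ofReal (g y)) x = ⊤} = 0 := by
    refine ENNReal.eq_zero_of_forall_ofReal_mul_le
      (c := 2 * 4 ^ n * (ENNReal.ofReal (2 ^ (q - 1)) * ∫⁻ y, ENNReal.ofReal (g y ^ q)))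
      (ENNReal.mul_ne_top (by finiteness) (ENNReal.mul_ne_top ENNReal.ofReal_ne_top hfin))
      (q := q) (by linarith) fun t ht => ?_
    have e : t ^ q = t ^ (q - 1) * t := by rw [← Real.rpow_add_one ht.ne', sub_add_cancel]
    rw [e, ENNReal.ofReal_mul (by positivity), mul_assoc]
    calc _ ≤ ENNReal.ofReal (t ^ (q - 1)) * (ENNReal.ofReal t * volume {x | ENNReal.ofReal t <
            hlMaximal (fun y => ENNReal.ofReal (g y)) x}) := by
          gcongr with x
          intro hx
          rw [hx]
          exact ENNReal.ofReal_lt_top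
      _ ≤ ENNReal.ofReal (t ^ (q - 1)) *
            (2 * 4 ^ n * ∫⁻ y in {y | t < 2 * g y}, ENNReal.ofReal (g y)) := by
          refine mul_le_mul_right ?_ _
          exact hlMaximal_truncated_weak_type hn hg ht (hne t ht)
      _ = 2 * 4 ^ n * (ENNReal.ofReal (t ^ (q - 1)) *
            ∫⁻ y in {y | t < 2 * g y}, ENNReal.ofReal (g y)) := by ring
      _ ≤ _ := by
          refine mul_le_mul_right ?_ _
          exact lintegral_superlevel_le hg hq ht
  rw [ae_iff]
  simpa [not_lt, top_le_iff] using hz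

/-- Marcinkiewicz interpolation by two layer-cake formulas: one opens `∫ M ^ q`, the truncated weak
type bound is inserted, and the other, for the measure `g dx` and the exponent `q - 1`, closes the
integral again. -/
theorem lintegral_hlMaximal_rpow_le {n : ℕ} (hn : 1 ≤ n) {g : EuclideanSpace ℝ (Fin n) → ℝ}
    (hg : Measurable g) (hg0 : ∀ x, 0 ≤ g x) {q : ℝ} (hq : 1 < q)
    (hfin : ∫⁻ y, ENNReal.ofReal (g y ^ q) ≠ ⊤) :
    ∫⁻ x, hlMaximal (fun y => ENNReal.ofReal (g y)) x ^ q ≤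
      ENNReal.ofReal q * (2 * 4 ^ n * (ENNReal.ofReal (2 ^ (q - 1) / (q - 1)))) *
        ∫⁻ y, ENNReal.ofReal (g y ^ q) := by
  set M := hlMaximal (fun y => ENNReal.ofReal (g y)) with hM
  have hMm : Measurable M := (lowerSemicontinuous_hlMaximal _).measurable
  have hMfin := ae_hlMaximal_lt_top hn hg hq hfin
  have hne : ∀ t : ℝ, 0 < t → ∫⁻ y in {y | t < 2 * g y}, ENNReal.ofReal (g y) ≠ ⊤ := by
    intro t ht htop
    have := lintegral_superlevel_le hg hq ht
    rw [htop, ENNReal.mul_top (ENNReal.ofReal_pos.2 (by positivity)).ne'] at this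
    exact ENNReal.mul_ne_top ENNReal.ofReal_ne_top hfin (top_le_iff.1 this)
  have hq1 : 0 < q - 1 := by linarith
  set μ := (volume : Measure (EuclideanSpace ℝ (Fin n))).withDensity
    (fun y => ENNReal.ofReal (g y)) with hμ
  have e1 : ∫⁻ x, M x ^ q = ∫⁻ x, ENNReal.ofReal ((M x).toReal ^ q) := by
    refine lintegral_congr_ae ?_
    filter_upwards [hMfin] with x hx
    rw [← ENNReal.ofReal_rpow_of_nonneg ENNReal.toReal_nonneg (by linarith),
      ENNReal.ofReal_toReal hx.ne]
  have e2 := lintegral_rpow_eq_lintegral_meas_lt_mul volume (f := fun x => (M x).toReal)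
    (Filter.Eventually.of_forall fun _ => ENNReal.toReal_nonneg) hMm.ennreal_toReal.aemeasurable
    (p := q) (by linarith)
  have e3 := lintegral_rpow_eq_lintegral_meas_lt_mul μ (f := fun x => 2 * g x)
    (Filter.Eventually.of_forall fun x => mul_nonneg zero_le_two (hg0 x))
    (hg.const_mul 2).aemeasurable (p := q - 1) hq1
  have e4 : ∫⁻ x, ENNReal.ofReal ((2 * g x) ^ (q - 1)) ∂μ =
      ENNReal.ofReal (2 ^ (q - 1)) * ∫⁻ y, ENNReal.ofReal (g y ^ q) := by
    rw [hμ, lintegral_withDensity_eq_lintegral_mul _ hg.ennreal_ofReal (by fun_prop),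
      ← lintegral_const_mul' _ _ ENNReal.ofReal_ne_top]
    refine lintegral_congr fun x => ?_
    simp only [Pi.mul_apply]
    rw [← ENNReal.ofReal_mul (hg0 x), ← ENNReal.ofReal_mul (by positivity),
      Real.mul_rpow (by norm_num) (hg0 x)]
    congr 1
    rcases (hg0 x).eq_or_lt with h | h
    · rw [← h, Real.zero_rpow (by linarith), Real.zero_rpow (by linarith)]
      simp
    · have h2 : g x ^ q = g x ^ (q - 1) * g x := by
        rw [← Real.rpow_add_one h.ne', sub_add_cancel]
      rw [h2]
      ring
  have e5 : ∫⁻ t in Ioi (0 : ℝ), volume {x | t < (M x).toReal} * ENNReal.ofReal (t ^ (q - 1)) ≤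
      2 * 4 ^ n *
        ∫⁻ t in Ioi (0 : ℝ), μ {y | t < 2 * g y} * ENNReal.ofReal (t ^ (q - 1 - 1)) := by
    rw [← lintegral_const_mul' _ _ (by finiteness)]
    refine setLIntegral_mono' measurableSet_Ioi fun t ht => ?_
    have ht : 0 < t := ht
    have e : t ^ (q - 1) = t * t ^ (q - 1 - 1) := by
      rw [mul_comm, ← Real.rpow_add_one ht.ne', sub_add_cancel]
    have hw := hlMaximal_truncated_weak_type hn hg ht (hne t ht)
    rw [e, ENNReal.ofReal_mul ht.le, ← mul_assoc, ← mul_assoc]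
    gcongr ?_ * _
    rw [hμ, withDensity_apply' _ _, mul_comm]
    refine le_trans ?_ hw
    gcongr with x
    intro hx
    rcases eq_or_ne (M x) ⊤ with h | h
    · rw [hM] at h
      rw [h]; exact ENNReal.ofReal_lt_top
    · exact (ENNReal.ofReal_lt_iff_lt_toReal ht.le h).2 hx
  rw [e1, e2, mul_assoc]
  gcongr
  refine e5.trans ?_
  rw [mul_assoc (2 * 4 ^ n)]
  refine mul_le_mul_right ?_ _
  rw [e4] at e3
  rw [ENNReal.ofReal_div_of_pos hq1, ENNReal.div_eq_inv_mul, mul_assoc, e3, ← mul_assoc,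
    ENNReal.inv_mul_cancel (ENNReal.ofReal_pos.2 hq1).ne' ENNReal.ofReal_ne_top, one_mul]

/-! ### The local maximal operator on `L^p`. -/

theorem ball_subset_of_lt_infEDist {n : ℕ} {Ω : Set (EuclideanSpace ℝ (Fin n))}
    {x : EuclideanSpace ℝ (Fin n)} {r : ℝ} (h : ENNReal.ofReal r < Metric.infEDist x Ωᶜ) :
    Metric.closedBall x r ⊆ Ω := by
  intro y hy
  by_contra hyΩ
  have h1 : Metric.infEDist x Ωᶜ ≤ edist x y := Metric.infEDist_le_edist_of_mem hyΩ
  rw [edist_dist, dist_comm] at h1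
  exact absurd (h.trans_le h1) (not_lt.2 (ENNReal.ofReal_le_ofReal (Metric.mem_closedBall.1 hy)))

theorem one_le_phiWeight {γ t : ℝ} (hγ : 0 ≤ γ) (ht : 0 ≤ t) : 1 ≤ phiWeight γ t :=
  Real.one_le_rpow (by linarith) hγ

theorem phiWeight_mono {γ s t : ℝ} (hγ : 0 ≤ γ) (hs : 0 ≤ s) (hst : s ≤ t) :
    phiWeight γ s ≤ phiWeight γ t :=
  Real.rpow_le_rpow (by linarith) (by linarith) hγ

/-- For fixed `r` the normalization does not depend on the centre, and the constraint on `r` is an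
open condition on the centre. -/
theorem lowerSemicontinuous_localNewMaximal {n : ℕ} {γ : ℝ} (hγ : 0 ≤ γ)
    (Ω : Set (EuclideanSpace ℝ (Fin n))) (f : EuclideanSpace ℝ (Fin n) → ℝ) :
    LowerSemicontinuous (localNewMaximal γ Ω f) := by
  unfold localNewMaximal
  refine lowerSemicontinuous_iSup fun r => lowerSemicontinuous_iSup fun hr => ?_
  intro x c hc
  simp only [gt_iff_lt, lt_iSup_iff] at hc ⊢
  obtain ⟨hx, hc⟩ := hc
  set v := volume (Metric.ball (0 : EuclideanSpace ℝ (Fin n)) r) with hv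
  have hball : ∀ z : EuclideanSpace ℝ (Fin n), volume (Metric.ball z r) = v := fun z => by
    rw [hv, volume_ball_scale z hr, volume_ball_scale 0 hr]
  have hφ : 1 ≤ phiWeight γ v.toReal := one_le_phiWeight hγ ENNReal.toReal_nonneg
  have hl : LowerSemicontinuous fun z => (∫⁻ y in Metric.ball z r, ‖f y‖ₑ) /
      (ENNReal.ofReal (phiWeight γ v.toReal) * v) := by
    refine Continuous.comp_lowerSemicontinuous
      (g := fun t : ℝ≥0∞ => t / (ENNReal.ofReal (phiWeight γ v.toReal) * v))
      ?_ (lowerSemicontinuous_lintegral_ball (fun y => ‖f y‖ₑ) r) ?_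
    · refine ENNReal.continuous_div_const _ (mul_ne_zero ?_ ?_)
      · exact (ENNReal.ofReal_pos.2 (by linarith)).ne'
      · exact (Metric.measure_ball_pos volume _ hr).ne'
    · intro a b hab
      exact ENNReal.div_le_div_right hab _
  simp only [Measure.real, hball] at hc ⊢
  filter_upwards [hl x c hc, Metric.continuous_infEDist.continuousAt.eventually
    (lt_mem_nhds hx)] with z hz hz'
  exact ⟨hz', hz⟩

theorem localNewMaximal_le_hlMaximal {n : ℕ} {γ : ℝ} (hγ : 0 ≤ γ)
    {Ω : Set (EuclideanSpace ℝ (Fin n))} {f : EuclideanSpace ℝ (Fin n) → ℝ}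
    {F : EuclideanSpace ℝ (Fin n) → ℝ≥0∞} (hF : ∀ᵐ y ∂volume.restrict Ω, ‖f y‖ₑ ≤ F y)
    (x : EuclideanSpace ℝ (Fin n)) : localNewMaximal γ Ω f x ≤ hlMaximal F x := by
  refine iSup_mono fun r => iSup_mono fun hr => iSup_le fun hx => ?_
  refine ENNReal.div_le_div ?_ ?_
  · refine lintegral_mono_ae (ae_restrict_of_ae_restrict_of_subset ?_ hF)
    exact Metric.ball_subset_closedBall.trans (ball_subset_of_lt_infEDist hx)
  · refine le_mul_of_one_le_left (zero_le) ?_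
    rw [← ENNReal.ofReal_one]
    exact ENNReal.ofReal_le_ofReal (one_le_phiWeight hγ measureReal_nonneg)

theorem exists_localNewMaximal_bound {n : ℕ} (hn : 1 ≤ n) {γ : ℝ} (hγ : 0 ≤ γ)
    {Ω : Set (EuclideanSpace ℝ (Fin n))} (hΩ : MeasurableSet Ω)
    {p : ℝ≥0∞} (hp1 : 1 < p) (hp : p < ⊤) :
    ∃ C : ℝ, 0 < C ∧ ∀ f : EuclideanSpace ℝ (Fin n) → ℝ, MemLp f p (volume.restrict Ω) →
      (∀ᵐ x, localNewMaximal γ Ω f x < ⊤) ∧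
      MemLp (localNewMaximalReal γ Ω f) p (volume.restrict Ω) ∧
      eLpNorm (localNewMaximalReal γ Ω f) p (volume.restrict Ω) ≤
        ENNReal.ofReal C * eLpNorm f p (volume.restrict Ω) := by
  set q := p.toReal with hq
  have hq1 : 1 < q := by
    rw [hq, ← ENNReal.toReal_one]
    exact (ENNReal.toReal_lt_toReal ENNReal.one_ne_top hp.ne).2 hp1
  have hq0 : 0 < q := by linarith
  have hp0 : p ≠ 0 := (zero_lt_one.trans hp1).ne'
  set D : ℝ := q * (2 * 4 ^ n * (2 ^ (q - 1) / (q - 1))) with hD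
  have hq1' : 0 < q - 1 := by linarith
  have hD0 : 0 < D := by positivity
  refine ⟨D ^ (1 / q), by positivity, fun f hf => ?_⟩
  -- `f'` is a measurable representative of the extension of `f` by zero; admissible balls lie in
  -- `Ω`, so they see only `f`.
  obtain ⟨f', hf'm, hff'⟩ := (aestronglyMeasurable_indicator_iff hΩ).2 hf.1
  have hg : Measurable fun x => |f' x| := hf'm.measurable.abs
  have hae : ∀ᵐ y ∂volume.restrict Ω, ‖f y‖ₑ = ENNReal.ofReal |f' y| := by
    rw [ae_restrict_iff' hΩ]
    filter_upwards [hff'] with y hy hyΩ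
    rw [← hy, indicator_of_mem hyΩ, ← Real.enorm_eq_ofReal_abs]
  have hint : ∫⁻ y, ENNReal.ofReal (|f' y| ^ q) = ∫⁻ y in Ω, ‖f y‖ₑ ^ q := by
    rw [← lintegral_indicator hΩ]
    refine lintegral_congr_ae ?_
    filter_upwards [hff'] with y hy
    rw [← hy]
    by_cases hyΩ : y ∈ Ω
    · simp only [indicator_of_mem hyΩ]
      rw [Real.enorm_eq_ofReal_abs, ENNReal.ofReal_rpow_of_nonneg (abs_nonneg _) hq0.le]
    · simp [indicator_of_notMem hyΩ, Real.zero_rpow hq0.ne']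
  have hnorm := eLpNorm_eq_lintegral_rpow_enorm_toReal (μ := volume.restrict Ω) hp0 hp.ne (f := f)
  have hfin : ∫⁻ y, ENNReal.ofReal (|f' y| ^ q) ≠ ⊤ := by
    rw [hint]
    exact (lintegral_rpow_enorm_lt_top_of_eLpNorm_lt_top hp0 hp.ne hf.2).ne
  have hle := localNewMaximal_le_hlMaximal hγ (hae.mono fun y hy => hy.le)
  have hlt : ∀ᵐ x, localNewMaximal γ Ω f x < ⊤ := by
    filter_upwards [ae_hlMaximal_lt_top hn hg hq1 hfin] with x hx
    exact (hle x).trans_lt hx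
  have hbound : eLpNorm (localNewMaximalReal γ Ω f) p (volume.restrict Ω) ≤
        ENNReal.ofReal (D ^ (1 / q)) * eLpNorm f p (volume.restrict Ω) := by
    rw [hnorm, eLpNorm_eq_lintegral_rpow_enorm_toReal hp0 hp.ne, ← hq,
      ← ENNReal.ofReal_rpow_of_nonneg hD0.le (by positivity),
      ← ENNReal.mul_rpow_of_nonneg _ _ (by positivity)]
    gcongr
    calc ∫⁻ x in Ω, ‖localNewMaximalReal γ Ω f x‖ₑ ^ q
        ≤ ∫⁻ x, hlMaximal (fun y => ENNReal.ofReal |f' y|) x ^ q := by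
          refine (setLIntegral_le_lintegral _ _).trans (lintegral_mono fun x => ?_)
          gcongr
          refine le_trans ?_ (hle x)
          rw [localNewMaximalReal, Real.enorm_of_nonneg ENNReal.toReal_nonneg]
          exact ENNReal.ofReal_toReal_le
      _ ≤ _ := lintegral_hlMaximal_rpow_le hn hg (fun x => abs_nonneg _) hq1 hfin
      _ = _ := by
          rw [hint, hD, ENNReal.ofReal_mul hq0.le, ENNReal.ofReal_mul (by positivity),
            ENNReal.ofReal_mul (by positivity), ENNReal.ofReal_pow (by positivity)]
          simp only [ENNReal.ofReal_ofNat]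
  refine ⟨hlt, ⟨?_, hbound.trans_lt (ENNReal.mul_lt_top ENNReal.ofReal_lt_top hf.2)⟩, hbound⟩
  exact (lowerSemicontinuous_localNewMaximal hγ Ω f).measurable.ennreal_toReal.aestronglyMeasurable

/-! ### Mollification in `L^p`. -/

section Mollification

variable {E F : Type*} [NormedAddCommGroup E] [InnerProductSpace ℝ E] [FiniteDimensional ℝ E]
  [MeasurableSpace E] [BorelSpace E] [NormedAddCommGroup F]

theorem tendsto_eLpNorm_translate_sub {h : E → F} {p : ℝ≥0∞} (hp1 : 1 ≤ p) (hp : p ≠ ⊤)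
    (hh : MemLp h p volume) :
    Tendsto (fun t => eLpNorm (fun x => h (x - t) - h x) p volume) (𝓝 0) (𝓝 0) := by
  have : Fact (1 ≤ p) := ⟨hp1⟩
  let g : C(E, C(E, E)) := ContinuousMap.curry ⟨fun a : E × E => a.2 - a.1, by fun_prop⟩
  have hg : ∀ t, MeasurePreserving (g t) volume volume := fun t =>
    measurePreserving_sub_right volume t
  have hc : Continuous fun t => Lp.compMeasurePreserving (g t) (hg t) (hh.toLp h) :=
    Continuous.compMeasurePreservingLp continuous_const g.continuous hg hp
  have h0 := hc.tendsto 0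
  rw [tendsto_iff_edist_tendsto_0] at h0
  refine h0.congr fun t => ?_
  rw [Lp.toLp_compMeasurePreserving, Lp.toLp_compMeasurePreserving, Lp.edist_toLp_toLp]
  congr 1
  funext x
  simp [g]

theorem isProbabilityMeasure_withDensity_normed (φ : ContDiffBump (0 : E)) :
    IsProbabilityMeasure
      ((volume : Measure E).withDensity fun t => ENNReal.ofReal (φ.normed volume t)) := by
  constructor
  rw [withDensity_apply _ MeasurableSet.univ, Measure.restrict_univ,
    ← ofReal_integral_eq_lintegral_ofReal φ.integrable_normed
      (Eventually.of_forall φ.nonneg_normed), φ.integral_normed, ENNReal.ofReal_one]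

/-- Jensen's inequality for the probability measure with the bump as density, in the form of the
monotonicity of `L^q` norms in the exponent. -/
theorem enorm_convolution_sub_rpow_le [NormedSpace ℝ F] [CompleteSpace F] {h : E → F}
    (hh : LocallyIntegrable h volume)
    (φ : ContDiffBump (0 : E)) {q : ℝ} (hq : 1 ≤ q) (x : E) :
    ‖(φ.normed volume ⋆[ContinuousLinearMap.lsmul ℝ ℝ, volume] h) x - h x‖ₑ ^ q ≤
      ∫⁻ t, ‖h (x - t) - h x‖ₑ ^ q
        ∂(volume.withDensity fun t => ENNReal.ofReal (φ.normed volume t)) := by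
  set ν := (volume : Measure E).withDensity fun t => ENNReal.ofReal (φ.normed volume t) with hν
  have hρm : Measurable fun t => ENNReal.ofReal (φ.normed volume t) :=
    φ.continuous_normed.measurable.ennreal_ofReal
  have : IsProbabilityMeasure ν := isProbabilityMeasure_withDensity_normed φ
  have hex : Integrable (fun t => φ.normed volume t • h (x - t)) := by
    have := (φ.hasCompactSupport_normed (μ := volume)).convolutionExists_left
      (ContinuousLinearMap.lsmul ℝ ℝ) φ.continuous_normed hh x
    simpa [ConvolutionExistsAt] using this
  have e1 : (φ.normed volume ⋆[ContinuousLinearMap.lsmul ℝ ℝ, volume] h) x - h x =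
      ∫ t, φ.normed volume t • (h (x - t) - h x) := by
    simp only [smul_sub]
    rw [integral_sub hex ((φ.integrable_normed (μ := volume)).smul_const _), integral_smul_const,
      φ.integral_normed (μ := volume), one_smul]
    simp [convolution]
  have hmeas : AEStronglyMeasurable (fun t => h (x - t) - h x) ν := by
    refine AEStronglyMeasurable.mono_ac (withDensity_absolutelyContinuous _ _) ?_
    exact (hh.aestronglyMeasurable.comp_quasiMeasurePreserving
      (quasiMeasurePreserving_sub_left volume x)).sub aestronglyMeasurable_const
  have e2 : ‖(φ.normed volume ⋆[ContinuousLinearMap.lsmul ℝ ℝ, volume] h) x - h x‖ₑ ≤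
      ∫⁻ t, ‖h (x - t) - h x‖ₑ ∂ν := by
    rw [e1, hν, lintegral_withDensity_eq_lintegral_mul_non_measurable _ hρm
      (Eventually.of_forall fun _ => ENNReal.ofReal_lt_top)]
    refine (enorm_integral_le_lintegral_enorm _).trans (lintegral_mono fun t => ?_)
    simp only [Pi.mul_apply, enorm_smul]
    rw [Real.enorm_of_nonneg (φ.nonneg_normed t)]
  have hq0 : 0 < q := by linarith
  have e3 := eLpNorm_le_eLpNorm_of_exponent_le (p := 1) (q := ENNReal.ofReal q)
    (by rw [← ENNReal.ofReal_one]; exact ENNReal.ofReal_le_ofReal hq) hmeas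
  rw [eLpNorm_one_eq_lintegral_enorm, eLpNorm_eq_lintegral_rpow_enorm_toReal
    (ENNReal.ofReal_pos.2 hq0).ne' ENNReal.ofReal_ne_top, ENNReal.toReal_ofReal hq0.le] at e3
  calc _ ≤ ((∫⁻ t, ‖h (x - t) - h x‖ₑ ^ q ∂ν) ^ (1 / q)) ^ q := by
        gcongr
        exact e2.trans e3
    _ = _ := by rw [← ENNReal.rpow_mul, one_div, inv_mul_cancel₀ hq0.ne', ENNReal.rpow_one]

/-- After Jensen and Tonelli the error is an average of translation errors over small shifts, and
translation is continuous in `L^p`. -/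
theorem exists_eLpNorm_convolution_sub_le [NormedSpace ℝ F] [CompleteSpace F] {h : E → F}
    {p : ℝ≥0∞} (hp1 : 1 ≤ p)
    (hp : p ≠ ⊤) (hh : MemLp h p volume) {ε : ℝ≥0∞} (hε : 0 < ε) :
    ∃ δ > 0, ∀ φ : ContDiffBump (0 : E), φ.rOut < δ →
      eLpNorm (φ.normed volume ⋆[ContinuousLinearMap.lsmul ℝ ℝ, volume] h - h) p volume ≤ ε := by
  -- Tonelli needs joint measurability of `(x, t) ↦ h (x - t)`.
  wlog hsm : StronglyMeasurable h generalizing h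
  · obtain ⟨h', hh'm, hhh'⟩ := hh.1
    obtain ⟨δ, hδ, H⟩ := this ((memLp_congr_ae hhh').1 hh) hh'm
    refine ⟨δ, hδ, fun φ hφ => ?_⟩
    rw [convolution_congr _ (ae_eq_refl (φ.normed volume)) hhh', eLpNorm_congr_ae
      (EventuallyEq.rfl.sub hhh')]
    exact H φ hφ
  have hp0 : p ≠ 0 := (zero_lt_one.trans_le hp1).ne'
  have hq1 : 1 ≤ p.toReal := by
    rw [← ENNReal.toReal_one]
    exact (ENNReal.toReal_le_toReal ENNReal.one_ne_top hp).2 hp1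
  set q := p.toReal with hq
  have hq0 : 0 < q := by linarith
  obtain ⟨δ, hδ, H⟩ := Metric.eventually_nhds_iff.1
    ((tendsto_eLpNorm_translate_sub hp1 hp hh).eventually (gt_mem_nhds hε))
  refine ⟨δ, hδ, fun φ hφ => ?_⟩
  set ν := (volume : Measure E).withDensity fun t => ENNReal.ofReal (φ.normed volume t) with hν
  have hρm : Measurable fun t => ENNReal.ofReal (φ.normed volume t) :=
    φ.continuous_normed.measurable.ennreal_ofReal
  have : IsProbabilityMeasure ν := isProbabilityMeasure_withDensity_normed φ
  rw [eLpNorm_eq_lintegral_rpow_enorm_toReal hp0 hp, ← hq, one_div, ENNReal.rpow_inv_le_iff hq0]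
  have hm : Measurable fun z : E × E => ‖h (z.1 - z.2) - h z.1‖ₑ ^ q := by
    have h1 : StronglyMeasurable fun z : E × E => h (z.1 - z.2) - h z.1 :=
      (hsm.comp_measurable (measurable_fst.sub measurable_snd)).sub
        (hsm.comp_measurable measurable_fst)
    exact h1.enorm.pow_const q
  have hsupp : ∀ᵐ t ∂ν, ‖t‖ < δ := by
    rw [hν, ae_withDensity_iff hρm]
    refine Eventually.of_forall fun t ht => ?_
    have h1 : t ∈ Function.support (φ.normed volume) := fun h0 => ht (by simp [h0])
    rw [φ.support_normed_eq, mem_ball_zero_iff] at h1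
    exact h1.trans hφ
  calc ∫⁻ x, ‖(φ.normed volume ⋆[ContinuousLinearMap.lsmul ℝ ℝ, volume] h - h) x‖ₑ ^ q
      ≤ ∫⁻ x, ∫⁻ t, ‖h (x - t) - h x‖ₑ ^ q ∂ν :=
        lintegral_mono fun x => enorm_convolution_sub_rpow_le (hh.locallyIntegrable hp1) φ hq1 x
    _ = ∫⁻ t, ∫⁻ x, ‖h (x - t) - h x‖ₑ ^ q ∂volume ∂ν :=
        lintegral_lintegral_swap hm.aemeasurable
    _ ≤ ∫⁻ _, ε ^ q ∂ν := by
        refine lintegral_mono_ae (hsupp.mono fun t ht => ?_)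
        have h1 := (H (y := t) (by simpa using ht)).le
        rwa [eLpNorm_eq_lintegral_rpow_enorm_toReal hp0 hp, ← hq, one_div,
          ENNReal.rpow_inv_le_iff hq0] at h1
    _ = ε ^ q := by simp

end Mollification

/-! ### Cutoffs and smooth approximation inside `Ω`. -/

theorem gradient_apply {n : ℕ} (ψ : EuclideanSpace ℝ (Fin n) → ℝ) (x : EuclideanSpace ℝ (Fin n))
    (i : Fin n) : gradient ψ x i = fderiv ℝ ψ x (EuclideanSpace.single i 1) := by
  have h : inner ℝ (gradient ψ x) (EuclideanSpace.single i (1 : ℝ)) =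
      fderiv ℝ ψ x (EuclideanSpace.single i 1) := by
    rw [gradient, InnerProductSpace.toDual_symm_apply]
  rw [← h, EuclideanSpace.inner_single_right]
  simp

theorem continuous_gradient {n : ℕ} {ψ : EuclideanSpace ℝ (Fin n) → ℝ} (hψ : ContDiff ℝ ∞ ψ) :
    Continuous (gradient ψ) :=
  (InnerProductSpace.toDual ℝ _).symm.continuous.comp (hψ.continuous_fderiv (by simp))

theorem norm_gradient {n : ℕ} (ψ : EuclideanSpace ℝ (Fin n) → ℝ) (x : EuclideanSpace ℝ (Fin n)) :
    ‖gradient ψ x‖ = ‖fderiv ℝ ψ x‖ :=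
  LinearIsometryEquiv.norm_map _ _

theorem gradient_eq_zero_of_notMem_tsupport {n : ℕ} {ψ : EuclideanSpace ℝ (Fin n) → ℝ}
    {x : EuclideanSpace ℝ (Fin n)} (hx : x ∉ tsupport ψ) : gradient ψ x = 0 := by
  rw [← norm_eq_zero, norm_gradient, fderiv_of_notMem_tsupport ℝ hx, norm_zero]

section TestFunction

variable {n : ℕ} {Ω : Set (EuclideanSpace ℝ (Fin n))}

theorem integrable_smul_of_tsupport_subset {F : Type*} [NormedAddCommGroup F] [NormedSpace ℝ F]
    {f : EuclideanSpace ℝ (Fin n) → F} (hf : LocallyIntegrableOn f Ω)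
    {c : EuclideanSpace ℝ (Fin n) → ℝ} (hc : Continuous c) (hcs : HasCompactSupport c)
    (hsub : tsupport c ⊆ Ω) : Integrable fun x => c x • f x := by
  have hK : IntegrableOn f (tsupport c) := hf.integrableOn_compact_subset hsub hcs
  have h1 : IntegrableOn (fun x => c x • f x) (tsupport c) :=
    hK.continuousOn_smul hc.continuousOn hcs
  rwa [integrableOn_iff_integrable_of_support_subset] at h1
  intro x hx
  by_contra hx'
  exact hx (by simp [image_eq_zero_of_notMem_tsupport hx'])

theorem IsTestFunction.mul {χ ψ : EuclideanSpace ℝ (Fin n) → ℝ} (hχ : IsTestFunction Ω χ)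
    (hψ : ContDiff ℝ ∞ ψ) : IsTestFunction Ω fun x => χ x * ψ x :=
  ⟨hχ.1.mul hψ, hχ.2.1.mul_right, (tsupport_mul_subset_left).trans hχ.2.2⟩

theorem IsTestFunction.add {χ ψ : EuclideanSpace ℝ (Fin n) → ℝ} (hχ : IsTestFunction Ω χ)
    (hψ : IsTestFunction Ω ψ) : IsTestFunction Ω fun x => χ x + ψ x :=
  ⟨hχ.1.add hψ.1, hχ.2.1.add hψ.2.1,
    (tsupport_add χ ψ).trans (union_subset hχ.2.2 hψ.2.2)⟩

theorem IsTestFunction.const_mul {ψ : EuclideanSpace ℝ (Fin n) → ℝ}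
    (hψ : IsTestFunction Ω ψ) (c : ℝ) : IsTestFunction Ω fun x => c * ψ x :=
  ⟨contDiff_const.mul hψ.1, hψ.2.1.mul_left, (tsupport_mul_subset_right).trans hψ.2.2⟩

theorem IsTestFunction.fderiv_apply {ψ : EuclideanSpace ℝ (Fin n) → ℝ}
    (hψ : IsTestFunction Ω ψ) (a : EuclideanSpace ℝ (Fin n)) :
    IsTestFunction Ω fun x => fderiv ℝ ψ x a :=
  ⟨(hψ.1.fderiv_right (by simp)).clm_apply contDiff_const, hψ.2.1.fderiv_apply ℝ a,
    (tsupport_fderiv_apply_subset ℝ a).trans hψ.2.2⟩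

theorem IsTestFunction.integrable_smul {F : Type*} [NormedAddCommGroup F] [NormedSpace ℝ F]
    {f : EuclideanSpace ℝ (Fin n) → F} (hf : LocallyIntegrableOn f Ω)
    {ψ : EuclideanSpace ℝ (Fin n) → ℝ} (hψ : IsTestFunction Ω ψ) :
    Integrable fun x => ψ x • f x :=
  integrable_smul_of_tsupport_subset hf hψ.1.continuous hψ.2.1 hψ.2.2

theorem locallyIntegrableOn_apply {g : EuclideanSpace ℝ (Fin n) → EuclideanSpace ℝ (Fin n)}
    (hg : LocallyIntegrableOn g Ω) (i : Fin n) : LocallyIntegrableOn (fun x => g x i) Ω := by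
  intro x hx
  obtain ⟨s, hs, h⟩ := hg x hx
  exact ⟨s, hs, (EuclideanSpace.proj (𝕜 := ℝ) i).integrable_comp h⟩

theorem setIntegral_eq_integral_of_test {F : EuclideanSpace ℝ (Fin n) → ℝ}
    {ψ : EuclideanSpace ℝ (Fin n) → ℝ} (hψ : IsTestFunction Ω ψ) :
    ∫ x in Ω, F x * ψ x = ∫ x, F x * ψ x := by
  refine setIntegral_eq_integral_of_forall_compl_eq_zero fun x hx => ?_
  rw [image_eq_zero_of_notMem_tsupport fun h => hx (hψ.2.2 h), mul_zero]

/-- The weak product rule, from the test function `χ ψ`. Since `χ` provides the support condition,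
`ψ` may be any smooth function, in particular a translated mollifier. -/
theorem HasWeakGradient.integral_cutoff_mul_fderiv
    {f : EuclideanSpace ℝ (Fin n) → ℝ}
    {g : EuclideanSpace ℝ (Fin n) → EuclideanSpace ℝ (Fin n)} (h : HasWeakGradient Ω f g)
    {χ ψ : EuclideanSpace ℝ (Fin n) → ℝ} (hχ : IsTestFunction Ω χ) (hψ : ContDiff ℝ ∞ ψ)
    (i : Fin n) :
    ∫ x, (χ x * f x) * fderiv ℝ ψ x (EuclideanSpace.single i 1) =
      -∫ x, (χ x • g x + f x • gradient χ x) i * ψ x := by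
  have hχψ := hχ.mul hψ
  have key := h.2.2 _ hχψ i
  rw [setIntegral_eq_integral_of_test hχψ,
    setIntegral_eq_integral_of_test (hχψ.fderiv_apply _)] at key
  have hd : ∀ x, fderiv ℝ (fun x => χ x * ψ x) x (EuclideanSpace.single i 1) =
      χ x * fderiv ℝ ψ x (EuclideanSpace.single i 1) + gradient χ x i * ψ x := by
    intro x
    rw [fderiv_fun_mul (hχ.1.differentiable (by simp) x) (hψ.differentiable (by simp) x),
      gradient_apply]
    simp [mul_comm]
  have hψ' : ContDiff ℝ ∞ fun x => fderiv ℝ ψ x (EuclideanSpace.single i 1) :=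
    (hψ.fderiv_right (by simp)).clm_apply contDiff_const
  have i1 : Integrable fun x => (χ x * f x) * fderiv ℝ ψ x (EuclideanSpace.single i 1) := by
    refine ((hχ.mul hψ').integrable_smul h.1).congr (Eventually.of_forall fun x => ?_)
    simp only [smul_eq_mul]; ring
  have i2 : Integrable fun x => f x * gradient χ x i * ψ x := by
    refine (((hχ.fderiv_apply (EuclideanSpace.single i 1)).mul hψ).integrable_smul h.1).congr
      (Eventually.of_forall fun x => ?_)
    simp only [smul_eq_mul, gradient_apply]; ring
  have i3 : Integrable fun x => χ x * g x i * ψ x := by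
    refine (hχψ.integrable_smul (locallyIntegrableOn_apply h.2.1 i)).congr
      (Eventually.of_forall fun x => ?_)
    simp only [smul_eq_mul]; ring
  have e1 : ∫ x, f x * fderiv ℝ (fun x => χ x * ψ x) x (EuclideanSpace.single i 1) =
      (∫ x, (χ x * f x) * fderiv ℝ ψ x (EuclideanSpace.single i 1)) +
        ∫ x, f x * gradient χ x i * ψ x := by
    rw [← integral_add i1 i2]
    refine integral_congr_ae (Eventually.of_forall fun x => ?_)
    simp only [hd]; ring
  have e2 : ∫ x, (χ x • g x + f x • gradient χ x) i * ψ x =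
      (∫ x, χ x * g x i * ψ x) + ∫ x, f x * gradient χ x i * ψ x := by
    rw [← integral_add i3 i2]
    refine integral_congr_ae (Eventually.of_forall fun x => ?_)
    simp; ring
  have e3 : ∫ x, g x i * (χ x * ψ x) = ∫ x, χ x * g x i * ψ x :=
    integral_congr_ae (Eventually.of_forall fun x => by simp only; ring)
  rw [e2, ← e3]
  rw [e1] at key
  linarith

/-- The derivative falls on the kernel; the weak product rule with `ψ y = ρ (x - y)` moves it onto
the cut-off function, the two sign changes cancelling. -/
theorem HasWeakGradient.gradient_convolution_cutoff
    {f : EuclideanSpace ℝ (Fin n) → ℝ}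
    {g : EuclideanSpace ℝ (Fin n) → EuclideanSpace ℝ (Fin n)} (h : HasWeakGradient Ω f g)
    {χ : EuclideanSpace ℝ (Fin n) → ℝ} (hχ : IsTestFunction Ω χ)
    (φ : ContDiffBump (0 : EuclideanSpace ℝ (Fin n)))
    (hi1 : LocallyIntegrable fun x => χ x * f x)
    (hi2 : LocallyIntegrable fun x => χ x • g x + f x • gradient χ x)
    (x : EuclideanSpace ℝ (Fin n)) :
    gradient (φ.normed volume ⋆[ContinuousLinearMap.lsmul ℝ ℝ, volume] fun x => χ x * f x) x =
      (φ.normed volume ⋆[ContinuousLinearMap.lsmul ℝ ℝ, volume]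
        fun x => χ x • g x + f x • gradient χ x) x := by
  have hρ : ContDiff ℝ ∞ (φ.normed volume) := φ.contDiff_normed
  ext i
  rw [gradient_apply]
  have hd := (φ.hasCompactSupport_normed (μ := volume)).hasFDerivAt_convolution_left (μ := volume)
    (ContinuousLinearMap.lsmul ℝ ℝ) (hρ.of_le (by simp)) hi1 x
  rw [hd.fderiv]
  set ψ : EuclideanSpace ℝ (Fin n) → ℝ := fun y => φ.normed volume (x - y) with hψ
  have hψs : ContDiff ℝ ∞ ψ := hρ.comp (contDiff_const.sub contDiff_id)
  have key := h.integral_cutoff_mul_fderiv hχ hψs i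
  have hψd : ∀ y, fderiv ℝ ψ y (EuclideanSpace.single i 1) =
      -fderiv ℝ (φ.normed volume) (x - y) (EuclideanSpace.single i 1) := by
    intro y
    have h1 := ((hρ.differentiable (by simp) (x - y)).hasFDerivAt.comp y
      ((hasFDerivAt_const x y).sub (hasFDerivAt_id y))).fderiv
    have h2 : ψ = φ.normed volume ∘ fun y => x - y := rfl
    rw [h2]
    erw [h1]
    simp
  have ex1 : Integrable fun t => (ContinuousLinearMap.lsmul ℝ ℝ).precompL
      (EuclideanSpace ℝ (Fin n)) (fderiv ℝ (φ.normed volume) (x - t)) (χ t * f t) := by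
    have := ((φ.hasCompactSupport_normed (μ := volume)).fderiv ℝ).convolutionExists_left
      ((ContinuousLinearMap.lsmul ℝ ℝ).precompL (EuclideanSpace ℝ (Fin n)))
      (hρ.continuous_fderiv (by simp)) hi1 x
    exact this.integrable_swap
  have ex2 : Integrable fun t => ContinuousLinearMap.lsmul ℝ ℝ (φ.normed volume (x - t))
      (χ t • g t + f t • gradient χ t) := by
    have := (φ.hasCompactSupport_normed (μ := volume)).convolutionExists_left
      (ContinuousLinearMap.lsmul ℝ ℝ) hρ.continuous hi2 x
    exact this.integrable_swap
  rw [convolution_eq_swap, convolution_eq_swap, ContinuousLinearMap.integral_apply ex1]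
  have e1 := (EuclideanSpace.proj (𝕜 := ℝ) i).integral_comp_comm ex2
  refine Eq.trans ?_ e1
  have e2 : ∫ t, ((ContinuousLinearMap.lsmul ℝ ℝ).precompL
      (EuclideanSpace ℝ (Fin n)) (fderiv ℝ (φ.normed volume) (x - t)) (χ t * f t))
        (EuclideanSpace.single i 1) =
      -∫ y, (χ y * f y) * fderiv ℝ ψ y (EuclideanSpace.single i 1) := by
    rw [← integral_neg]
    refine integral_congr_ae (Eventually.of_forall fun y => ?_)
    simp only [hψd]
    simp [mul_comm]
  rw [e2, key, neg_neg]
  refine integral_congr_ae (Eventually.of_forall fun y => ?_)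
  simp only [hψ, PiLp.proj_apply, ContinuousLinearMap.lsmul_apply, PiLp.smul_apply, smul_eq_mul]
  ring

theorem memLp_cutoff {p : ℝ≥0∞} {f : EuclideanSpace ℝ (Fin n) → ℝ} (hΩ : MeasurableSet Ω)
    (hf : MemLp f p (volume.restrict Ω)) {F : Type*} [NormedAddCommGroup F] [NormedSpace ℝ F]
    {c : EuclideanSpace ℝ (Fin n) → F} (hc : Continuous c) (hcs : HasCompactSupport c)
    (hsub : tsupport c ⊆ Ω) : MemLp (fun x => f x • c x) p volume := by
  obtain ⟨B, hB⟩ := hc.bounded_above_of_compact_support hcs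
  have h1 : MemLp (fun x => f x • c x) p (volume.restrict Ω) := by
    refine hf.of_le_mul (c := B) (hf.1.smul hc.aestronglyMeasurable)
      (Eventually.of_forall fun x => ?_)
    rw [norm_smul, mul_comm]
    gcongr
    exact hB x
  rw [← memLp_indicator_iff_restrict hΩ] at h1
  refine h1.ae_eq (Eventually.of_forall fun x => ?_)
  by_cases hx : x ∈ Ω
  · simp [indicator_of_mem hx]
  · simp [indicator_of_notMem hx, image_eq_zero_of_notMem_tsupport fun h => hx (hsub h)]

theorem memLp_smul_cutoff {p : ℝ≥0∞} {F : Type*} [NormedAddCommGroup F] [NormedSpace ℝ F]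
    {g : EuclideanSpace ℝ (Fin n) → F} (hΩ : MeasurableSet Ω)
    (hg : MemLp g p (volume.restrict Ω)) {c : EuclideanSpace ℝ (Fin n) → ℝ} (hc : Continuous c)
    (hcs : HasCompactSupport c) (hsub : tsupport c ⊆ Ω) :
    MemLp (fun x => c x • g x) p volume := by
  obtain ⟨B, hB⟩ := hc.bounded_above_of_compact_support hcs
  have h1 : MemLp (fun x => c x • g x) p (volume.restrict Ω) := by
    refine hg.of_le_mul (c := B) (hc.aestronglyMeasurable.smul hg.1)
      (Eventually.of_forall fun x => ?_)
    rw [norm_smul]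
    gcongr
    exact hB x
  rw [← memLp_indicator_iff_restrict hΩ] at h1
  refine h1.ae_eq (Eventually.of_forall fun x => ?_)
  by_cases hx : x ∈ Ω
  · simp [indicator_of_mem hx]
  · simp [indicator_of_notMem hx, image_eq_zero_of_notMem_tsupport fun h => hx (hsub h)]

theorem tsupport_gradient_subset (χ : EuclideanSpace ℝ (Fin n) → ℝ) :
    tsupport (gradient χ) ⊆ tsupport χ :=
  closure_minimal (fun x hx => by
    by_contra h
    exact hx (gradient_eq_zero_of_notMem_tsupport h)) (isClosed_tsupport _)

/-- Smooth approximation, in `W^{1,p}`, of a weakly differentiable function that has been cut off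
inside `Ω`. -/
theorem HasWeakGradient.exists_test_approx {p : ℝ≥0∞} (hΩ : IsOpen Ω) (hp1 : 1 ≤ p) (hp : p ≠ ⊤)
    {f : EuclideanSpace ℝ (Fin n) → ℝ}
    {g : EuclideanSpace ℝ (Fin n) → EuclideanSpace ℝ (Fin n)} (h : HasWeakGradient Ω f g)
    (hf : MemLp f p (volume.restrict Ω)) (hg : MemLp g p (volume.restrict Ω))
    {χ : EuclideanSpace ℝ (Fin n) → ℝ} (hχ : IsTestFunction Ω χ) {ε : ℝ≥0∞} (hε : 0 < ε) :
    ∃ ψ, IsTestFunction Ω ψ ∧ eLpNorm (fun x => ψ x - χ x * f x) p volume ≤ ε ∧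
      eLpNorm (fun x => gradient ψ x - (χ x • g x + f x • gradient χ x)) p volume ≤ ε := by
  have hχg : HasCompactSupport (gradient χ) :=
    hχ.2.1.of_isClosed_subset (isClosed_tsupport _) (tsupport_gradient_subset χ)
  have m1 : MemLp (fun x => χ x * f x) p volume :=
    memLp_smul_cutoff hΩ.measurableSet hf hχ.1.continuous hχ.2.1 hχ.2.2
  have m2 : MemLp (fun x => χ x • g x + f x • gradient χ x) p volume :=
    (memLp_smul_cutoff hΩ.measurableSet hg hχ.1.continuous hχ.2.1 hχ.2.2).add
      (memLp_cutoff hΩ.measurableSet hf (continuous_gradient hχ.1) hχg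
        ((tsupport_gradient_subset χ).trans hχ.2.2))
  obtain ⟨δ₁, hδ₁, H₁⟩ := exists_eLpNorm_convolution_sub_le hp1 hp m1 hε
  obtain ⟨δ₂, hδ₂, H₂⟩ := exists_eLpNorm_convolution_sub_le hp1 hp m2 hε
  obtain ⟨δ₃, hδ₃, H₃⟩ := hχ.2.1.isCompact.exists_cthickening_subset_open hΩ hχ.2.2
  -- `δ₁` and `δ₂` control the errors of the function and of its gradient; `δ₃` keeps the support of
  -- the mollification in `Ω`.
  set δ := min δ₁ (min δ₂ δ₃) with hδ
  have hδ0 : 0 < δ := by positivity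
  let φ : ContDiffBump (0 : EuclideanSpace ℝ (Fin n)) :=
    ⟨δ / 4, δ / 2, by positivity, by linarith⟩
  have hφ : φ.rOut < δ := by
    change δ / 2 < δ
    linarith
  have hφ3 : φ.rOut < δ₃ := hφ.trans_le ((min_le_right _ _).trans (min_le_right _ _))
  have hsupp : Function.support
      (φ.normed volume ⋆[ContinuousLinearMap.lsmul ℝ ℝ, volume] fun x => χ x * f x) ⊆
      Metric.cthickening δ₃ (tsupport χ) := by
    refine (support_convolution_subset _).trans ?_
    rintro _ ⟨a, ha, b, hb, rfl⟩
    rw [φ.support_normed_eq, mem_ball_zero_iff] at ha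
    have hb' : b ∈ tsupport χ := subset_tsupport _ (left_ne_zero_of_mul hb)
    refine Metric.mem_cthickening_of_dist_le _ b _ _ hb' ?_
    simp only [dist_add_self_left]
    exact (ha.trans hφ3).le
  have hts := closure_minimal hsupp Metric.isClosed_cthickening
  refine ⟨_, ⟨?_, ?_, hts.trans H₃⟩, H₁ φ (hφ.trans_le (min_le_left _ _)), ?_⟩
  · exact (φ.hasCompactSupport_normed (μ := volume)).contDiff_convolution_left _
      φ.contDiff_normed (m1.locallyIntegrable hp1)
  · exact hχ.2.1.isCompact.cthickening.of_isClosed_subset isClosed_closure hts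
  · simp only [h.gradient_convolution_cutoff hχ φ (m1.locallyIntegrable hp1)
      (m2.locallyIntegrable hp1)]
    exact H₂ φ (hφ.trans_le ((min_le_right _ _).trans (min_le_left _ _)))

/-- The neighbourhood `U` is needed so that the gradient of the cutoff vanishes on `K` as well. -/
theorem exists_test_eq_one {K : Set (EuclideanSpace ℝ (Fin n))} (hΩ : IsOpen Ω)
    (hK : IsCompact K) (hKΩ : K ⊆ Ω) :
    ∃ χ, IsTestFunction Ω χ ∧ (∀ x, 0 ≤ χ x) ∧ ∃ U, IsOpen U ∧ K ⊆ U ∧ ∀ x ∈ U, χ x = 1 := by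
  obtain ⟨δ, hδ, hδΩ⟩ := hK.exists_cthickening_subset_open hΩ hKΩ
  obtain ⟨χ, hχ, h01, hs, h1⟩ := exists_contMDiff_support_eq_eq_one_iff
    (modelWithCornersSelf ℝ (EuclideanSpace ℝ (Fin n))) (n := (⊤ : ℕ∞))
    (s := Metric.thickening δ K) (t := Metric.cthickening (δ / 2) K) Metric.isOpen_thickening
    Metric.isClosed_cthickening (Metric.cthickening_subset_thickening' hδ (by linarith) _)
  have hts : tsupport χ ⊆ Metric.cthickening δ K := by
    rw [tsupport, hs]
    exact Metric.closure_thickening_subset_cthickening _ _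
  refine ⟨χ, ⟨hχ.contDiff, hK.cthickening.of_isClosed_subset (isClosed_tsupport _) hts,
    hts.trans hδΩ⟩, fun x => (h01 (mem_range_self x)).1,
    Metric.thickening (δ / 2) K, Metric.isOpen_thickening,
    Metric.self_subset_thickening (by linarith) K,
    fun x hx => (h1 x).1 (Metric.thickening_subset_cthickening _ _ hx)⟩

/-- Smooth approximation, in `W^{1,1}` of a compact set. -/
theorem HasWeakGradient.exists_test_approx_lintegral {p : ℝ≥0∞} (hΩ : IsOpen Ω) (hp1 : 1 ≤ p)
    (hp : p ≠ ⊤) {f : EuclideanSpace ℝ (Fin n) → ℝ}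
    {g : EuclideanSpace ℝ (Fin n) → EuclideanSpace ℝ (Fin n)} (h : HasWeakGradient Ω f g)
    (hf : MemLp f p (volume.restrict Ω)) (hg : MemLp g p (volume.restrict Ω))
    {K : Set (EuclideanSpace ℝ (Fin n))} (hK : IsCompact K) (hKΩ : K ⊆ Ω)
    {ε : ℝ≥0∞} (hε : 0 < ε) :
    ∃ ψ, IsTestFunction Ω ψ ∧ ∫⁻ x in K, ‖ψ x - f x‖ₑ ≤ ε ∧
      ∫⁻ x in K, ‖gradient ψ x - g x‖ₑ ≤ ε := by
  obtain ⟨χ, hχ, -, U, hU, hKU, hχ1⟩ := exists_test_eq_one hΩ hK hKΩ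
  -- The Hölder constant of `L^p(K) ⊆ L^1(K)`. It may vanish, hence the division by `c + 1` below.
  set c : ℝ≥0∞ := volume K ^ (1 / (1 : ℝ≥0∞).toReal - 1 / p.toReal) with hc
  have hct : c ≠ ⊤ := by
    refine ENNReal.rpow_ne_top_of_nonneg ?_ hK.measure_lt_top.ne
    have : 1 ≤ p.toReal := by
      rw [← ENNReal.toReal_one]
      exact (ENNReal.toReal_le_toReal ENNReal.one_ne_top hp).2 hp1
    simp only [ENNReal.toReal_one, div_one, one_div, sub_nonneg]
    exact inv_le_one_of_one_le₀ this
  obtain ⟨ψ, hψ, h1, h2⟩ := h.exists_test_approx hΩ hp1 hp hf hg hχ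
    (ε := ε / (c + 1)) (ENNReal.div_pos hε.ne' (by finiteness))
  have hKm : MeasurableSet K := hK.measurableSet
  have hfin : ε / (c + 1) * c ≤ ε := by
    calc ε / (c + 1) * c ≤ ε / (c + 1) * (c + 1) := by gcongr; exact le_self_add
      _ ≤ ε := by rw [mul_comm]; exact ENNReal.mul_div_le
  have hrK : volume.restrict K ≤ volume.restrict Ω := Measure.restrict_mono hKΩ le_rfl
  have bound : ∀ {G : Type} [NormedAddCommGroup G] {u v : EuclideanSpace ℝ (Fin n) → G},
      AEStronglyMeasurable u (volume.restrict K) → (∀ x ∈ K, u x = v x) →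
      eLpNorm v p volume ≤ ε / (c + 1) → ∫⁻ x in K, ‖u x‖ₑ ≤ ε := by
    intro G _ u v hu huv hv
    rw [← eLpNorm_one_eq_lintegral_enorm]
    refine (eLpNorm_le_eLpNorm_mul_rpow_measure_univ hp1 hu).trans ?_
    rw [Measure.restrict_apply_univ, ← hc]
    refine le_trans ?_ hfin
    gcongr
    have e : eLpNorm u p (volume.restrict K) = eLpNorm v p (volume.restrict K) :=
      eLpNorm_congr_ae ((ae_restrict_iff' hKm).2 (Eventually.of_forall huv))
    rw [e]
    exact (eLpNorm_mono_measure _ Measure.restrict_le_self).trans hv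
  refine ⟨ψ, hψ, bound ?_ ?_ h1, bound ?_ ?_ h2⟩
  · exact hψ.1.continuous.aestronglyMeasurable.sub (hf.1.mono_measure hrK)
  · intro x hx
    simp [hχ1 x (hKU hx)]
  · exact (continuous_gradient hψ.1).aestronglyMeasurable.sub (hg.1.mono_measure hrK)
  · intro x hx
    have hgr : gradient χ x = 0 := by
      have : χ =ᶠ[𝓝 x] fun _ => 1 :=
        eventually_of_mem (hU.mem_nhds (hKU hx)) hχ1
      rw [this.gradient_eq]
      exact gradient_const _ _
    simp [hχ1 x (hKU hx), hgr]

end TestFunction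

/-! ### Comparison of averages through interpolating balls. -/

/-- The integral of `F` over the ball `B(c, ρ)`, pulled back to the unit ball. -/
noncomputable def unitBallIntegral {n : ℕ} (F : EuclideanSpace ℝ (Fin n) → ℝ≥0∞)
    (c : EuclideanSpace ℝ (Fin n)) (ρ : ℝ) : ℝ≥0∞ :=
  ∫⁻ z in Metric.ball 0 1, F (c + ρ • z)

theorem ofReal_pow_mul_unitBallIntegral {n : ℕ} (F : EuclideanSpace ℝ (Fin n) → ℝ≥0∞)
    (c : EuclideanSpace ℝ (Fin n)) {ρ : ℝ} (hρ : 0 < ρ) :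
    ENNReal.ofReal (ρ ^ n) * unitBallIntegral F c ρ = ∫⁻ y in Metric.ball c ρ, F y := by
  let e : EuclideanSpace ℝ (Fin n) ≃ₜ EuclideanSpace ℝ (Fin n) :=
    (Homeomorph.smulOfNeZero ρ hρ.ne').trans (Homeomorph.addLeft c)
  have he : ∀ z, e z = c + ρ • z := fun z => rfl
  have hmap : Measure.map e volume =
      ENNReal.ofReal (ρ ^ n)⁻¹ • (volume : Measure (EuclideanSpace ℝ (Fin n))) := by
    have h1 : (e : EuclideanSpace ℝ (Fin n) → _) = (fun y => c + y) ∘ fun z => ρ • z := rfl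
    rw [h1, ← Measure.map_map (measurable_const_add c) (measurable_const_smul ρ),
      Measure.map_addHaar_smul volume hρ.ne', Measure.map_smul, map_add_left_eq_self]
    simp [abs_of_pos (pow_pos hρ n)]
  have hpre : e ⁻¹' Metric.ball c ρ = Metric.ball 0 1 := by
    ext z
    simp only [mem_preimage, he, Metric.mem_ball, dist_self_add_left, norm_smul, dist_zero_right,
      Real.norm_of_nonneg hρ.le]
    exact mul_lt_iff_lt_one_right hρ
  have h2 : ∫⁻ y in Metric.ball c ρ, F y ∂(Measure.map e volume) = unitBallIntegral F c ρ := by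
    rw [e.measurableEmbedding.restrict_map, e.measurableEmbedding.lintegral_map]
    rw [hpre]
    rfl
  rw [← h2, hmap, Measure.restrict_smul, lintegral_smul_measure, smul_eq_mul, ← mul_assoc,
    ← ENNReal.ofReal_mul (by positivity), mul_inv_cancel₀ (by positivity), ENNReal.ofReal_one,
    one_mul]

theorem enorm_le_enorm_add_lintegral_gradient {n : ℕ} {ψ : EuclideanSpace ℝ (Fin n) → ℝ}
    (hψ : ContDiff ℝ ∞ ψ) (y v : EuclideanSpace ℝ (Fin n)) :
    ‖ψ y‖ₑ ≤ ‖ψ (y + v)‖ₑ + ‖v‖ₑ * ∫⁻ s in Icc (0 : ℝ) 1, ‖gradient ψ (y + s • v)‖ₑ := by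
  have hd : ∀ s ∈ uIcc (0 : ℝ) 1,
      HasDerivAt (fun s : ℝ => ψ (y + s • v)) (fderiv ℝ ψ (y + s • v) v) s := by
    intro s _
    have h1 : HasDerivAt (fun s : ℝ => y + s • v) v s := by
      simpa using ((hasDerivAt_id s).smul_const v).const_add y
    exact ((hψ.differentiable (by simp) _).hasFDerivAt).comp_hasDerivAt s h1
  have hc : Continuous fun s : ℝ => fderiv ℝ ψ (y + s • v) v :=
    ((hψ.continuous_fderiv (by simp)).comp (by fun_prop)).clm_apply continuous_const
  have hi := intervalIntegral.integral_eq_sub_of_hasDerivAt hd (hc.intervalIntegrable 0 1)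
  simp only [one_smul, zero_smul, add_zero] at hi
  have e1 : ψ y = ψ (y + v) - ∫ s in (0 : ℝ)..1, fderiv ℝ ψ (y + s • v) v := by
    rw [hi]; ring
  rw [e1]
  refine (enorm_sub_le).trans (add_le_add_right ?_ _)
  rw [intervalIntegral.integral_of_le zero_le_one, ← integral_Icc_eq_integral_Ioc]
  refine (enorm_integral_le_lintegral_enorm _).trans ?_
  rw [← lintegral_const_mul' _ _ enorm_ne_top]
  refine lintegral_mono fun s => ?_
  rw [mul_comm, ← ofReal_norm, ← ofReal_norm, ← ofReal_norm, norm_gradient,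
    ← ENNReal.ofReal_mul (norm_nonneg _)]
  exact ENNReal.ofReal_le_ofReal (ContinuousLinearMap.le_opNorm _ _)

/-- For each `z` in the unit ball, integrate the gradient along the segment from `x + r z` to `x + a
+ r' z`. Its length is at most `‖a‖ + |r' - r|`, and at time `s` its point is the image of `z` in
the interpolating ball; Tonelli then exchanges `z` and `s`. -/
theorem unitBallIntegral_le_of_contDiff {n : ℕ} {ψ : EuclideanSpace ℝ (Fin n) → ℝ}
    (hψ : ContDiff ℝ ∞ ψ) (x a : EuclideanSpace ℝ (Fin n)) (r r' : ℝ) :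
    unitBallIntegral (fun y => ‖ψ y‖ₑ) x r ≤ unitBallIntegral (fun y => ‖ψ y‖ₑ) (x + a) r' +
      ENNReal.ofReal (‖a‖ + |r' - r|) * ∫⁻ s in Icc (0 : ℝ) 1,
        unitBallIntegral (fun y => ‖gradient ψ y‖ₑ) (x + s • a) (r + s * (r' - r)) := by
  have hcψ := hψ.continuous
  have hcg := continuous_gradient hψ
  unfold unitBallIntegral
  have hm : Measurable fun q : EuclideanSpace ℝ (Fin n) × ℝ =>
      ‖gradient ψ ((x + q.2 • a) + (r + q.2 * (r' - r)) • q.1)‖ₑ := by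
    refine Continuous.measurable ?_
    exact (hcg.comp (by fun_prop)).enorm
  rw [lintegral_lintegral_swap (μ := volume.restrict (Icc (0 : ℝ) 1))
    (f := fun s z => ‖gradient ψ ((x + s • a) + (r + s * (r' - r)) • z)‖ₑ)
    (hm.comp measurable_swap).aemeasurable,
    ← lintegral_const_mul' _ _ ENNReal.ofReal_ne_top, ← lintegral_add_left]
  · refine setLIntegral_mono' Metric.isOpen_ball.measurableSet fun z hz => ?_
    rw [mem_ball_zero_iff] at hz
    have h := enorm_le_enorm_add_lintegral_gradient hψ (x + r • z) (a + (r' - r) • z)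
    have e1 : x + r • z + (a + (r' - r) • z) = x + a + r' • z := by module
    have e2 : ∀ s : ℝ, x + r • z + s • (a + (r' - r) • z) =
        x + s • a + (r + s * (r' - r)) • z := fun s => by module
    simp only [e1, e2] at h
    refine h.trans (add_le_add_right (mul_le_mul_left ?_ _) _)
    rw [← ofReal_norm]
    refine ENNReal.ofReal_le_ofReal ((norm_add_le _ _).trans (add_le_add_right ?_ _))
    rw [norm_smul, Real.norm_eq_abs]
    exact mul_le_of_le_one_right (abs_nonneg _) hz.le
  · exact (hcψ.comp (by fun_prop)).enorm.measurable

/-- The lower bound `m` on the radius makes the constant uniform over a family of balls in `K`, so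
that an `L^1(K)` error is controlled on all interpolating balls at once. -/
theorem unitBallIntegral_le_of_ball_subset {n : ℕ} (F : EuclideanSpace ℝ (Fin n) → ℝ≥0∞)
    {c : EuclideanSpace ℝ (Fin n)} {ρ m : ℝ} (hm : 0 < m) (hρ : m ≤ ρ)
    {K : Set (EuclideanSpace ℝ (Fin n))} (hK : Metric.ball c ρ ⊆ K) :
    unitBallIntegral F c ρ ≤ (ENNReal.ofReal (m ^ n))⁻¹ * ∫⁻ y in K, F y := by
  have hmn : ENNReal.ofReal (m ^ n) ≠ 0 := (ENNReal.ofReal_pos.2 (by positivity)).ne'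
  calc unitBallIntegral F c ρ
      = (ENNReal.ofReal (m ^ n))⁻¹ * (ENNReal.ofReal (m ^ n) * unitBallIntegral F c ρ) := by
        rw [← mul_assoc, ENNReal.inv_mul_cancel hmn ENNReal.ofReal_ne_top, one_mul]
    _ ≤ (ENNReal.ofReal (m ^ n))⁻¹ * (ENNReal.ofReal (ρ ^ n) * unitBallIntegral F c ρ) := by
        gcongr
    _ ≤ _ := by
        rw [ofReal_pow_mul_unitBallIntegral F c (hm.trans_le hρ)]
        gcongr

theorem unitBallIntegral_le_add {n : ℕ} {F : Type*} [NormedAddCommGroup F]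
    {u v : EuclideanSpace ℝ (Fin n) → F} {c : EuclideanSpace ℝ (Fin n)} {ρ : ℝ} (hρ : 0 < ρ)
    (hv : AEStronglyMeasurable v (volume.restrict (Metric.ball c ρ))) :
    unitBallIntegral (fun y => ‖u y‖ₑ) c ρ ≤ unitBallIntegral (fun y => ‖v y‖ₑ) c ρ +
      unitBallIntegral (fun y => ‖u y - v y‖ₑ) c ρ := by
  have hρn : ENNReal.ofReal (ρ ^ n) ≠ 0 := (ENNReal.ofReal_pos.2 (by positivity)).ne'
  rw [← ENNReal.mul_le_mul_iff_right hρn ENNReal.ofReal_ne_top, mul_add,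
    ofReal_pow_mul_unitBallIntegral _ c hρ, ofReal_pow_mul_unitBallIntegral _ c hρ,
    ofReal_pow_mul_unitBallIntegral _ c hρ, ← lintegral_add_left' hv.enorm]
  refine lintegral_mono fun z => ?_
  simpa using enorm_add_le (v z) (u z - v z)

/-- Comparison of the means of a weakly differentiable function over two balls, through the balls
that interpolate between them. -/
theorem HasWeakGradient.unitBallIntegral_le {n : ℕ} {Ω : Set (EuclideanSpace ℝ (Fin n))}
    {p : ℝ≥0∞} (hΩ : IsOpen Ω) (hp1 : 1 ≤ p) (hp : p ≠ ⊤) {f : EuclideanSpace ℝ (Fin n) → ℝ}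
    {g : EuclideanSpace ℝ (Fin n) → EuclideanSpace ℝ (Fin n)} (h : HasWeakGradient Ω f g)
    (hf : MemLp f p (volume.restrict Ω)) (hg : MemLp g p (volume.restrict Ω))
    {x a : EuclideanSpace ℝ (Fin n)} {r r' R : ℝ} (hr : 0 < r) (hr' : 0 < r') (hrR : r ≤ R)
    (hr'R : ‖a‖ + r' ≤ R) (hR : Metric.closedBall x R ⊆ Ω) :
    unitBallIntegral (fun y => ‖f y‖ₑ) x r ≤ unitBallIntegral (fun y => ‖f y‖ₑ) (x + a) r' +
      ENNReal.ofReal (‖a‖ + |r' - r|) * ∫⁻ s in Icc (0 : ℝ) 1,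
        unitBallIntegral (fun y => ‖g y‖ₑ) (x + s • a) (r + s * (r' - r)) := by
  set m := min r r' with hm
  have hm0 : 0 < m := lt_min hr hr'
  set κ := (ENNReal.ofReal (m ^ n))⁻¹ with hκ
  have hκt : κ ≠ ⊤ := ENNReal.inv_ne_top.2 (ENNReal.ofReal_pos.2 (by positivity)).ne'
  set c := ENNReal.ofReal (‖a‖ + |r' - r|) with hc
  have hct : c ≠ ⊤ := ENNReal.ofReal_ne_top
  -- The approximation error is paid three times: on the first ball, under the gradient integral
  -- with its factor `c`, and on the second ball.
  set D := κ + c * κ + κ with hD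
  have hDt : D ≠ ⊤ := by finiteness
  have hρ : ∀ s ∈ Icc (0 : ℝ) 1, m ≤ r + s * (r' - r) := by
    rintro s ⟨h0, h1⟩
    have := min_le_left r r'
    have := min_le_right r r'
    nlinarith
  have hball : ∀ s ∈ Icc (0 : ℝ) 1,
      Metric.ball (x + s • a) (r + s * (r' - r)) ⊆ Metric.closedBall x R := by
    rintro s ⟨h0, h1⟩
    refine Metric.ball_subset_closedBall.trans (Metric.closedBall_subset_closedBall' ?_)
    rw [dist_self_add_left, norm_smul, Real.norm_of_nonneg h0]
    nlinarith
  have hball0 : Metric.ball x r ⊆ Metric.closedBall x R := by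
    simpa using hball 0 (by simp)
  have hball1 : Metric.ball (x + a) r' ⊆ Metric.closedBall x R := by
    simpa using hball 1 (by simp)
  have hfm : ∀ {S}, S ⊆ Metric.closedBall x R → AEStronglyMeasurable f (volume.restrict S) :=
    fun hS => hf.1.mono_measure (Measure.restrict_mono (hS.trans hR) le_rfl)
  have hgm : ∀ {S}, S ⊆ Metric.closedBall x R → AEStronglyMeasurable g (volume.restrict S) :=
    fun hS => hg.1.mono_measure (Measure.restrict_mono (hS.trans hR) le_rfl)
  refine ENNReal.le_of_forall_pos_le_add fun ε hε _ => ?_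
  have hε' : (0 : ℝ≥0∞) < ε / (D + 1) :=
    ENNReal.div_pos (by exact_mod_cast hε.ne') (by finiteness)
  obtain ⟨ψ, hψ, h1, h2⟩ := h.exists_test_approx_lintegral hΩ hp1 hp hf hg
    (isCompact_closedBall x R) hR hε'
  set η := (ε : ℝ≥0∞) / (D + 1) with hη
  have hηD : D * η ≤ ε := by
    calc D * η ≤ (D + 1) * η := by gcongr; exact le_self_add
      _ ≤ ε := ENNReal.mul_div_le
  have s1 : unitBallIntegral (fun y => ‖f y‖ₑ) x r ≤
      unitBallIntegral (fun y => ‖ψ y‖ₑ) x r + κ * η := by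
    refine (unitBallIntegral_le_add hr (v := ψ) hψ.1.continuous.aestronglyMeasurable).trans ?_
    gcongr
    refine (unitBallIntegral_le_of_ball_subset _ hm0 (min_le_left _ _) hball0).trans ?_
    gcongr
    simpa only [enorm_sub_rev] using h1
  have s2 : unitBallIntegral (fun y => ‖ψ y‖ₑ) (x + a) r' ≤
      unitBallIntegral (fun y => ‖f y‖ₑ) (x + a) r' + κ * η := by
    refine (unitBallIntegral_le_add hr' (v := f) (hfm hball1)).trans ?_
    gcongr
    refine (unitBallIntegral_le_of_ball_subset _ hm0 (min_le_right _ _) hball1).trans ?_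
    gcongr
  have s3 : ∫⁻ s in Icc (0 : ℝ) 1,
        unitBallIntegral (fun y => ‖gradient ψ y‖ₑ) (x + s • a) (r + s * (r' - r)) ≤
      (∫⁻ s in Icc (0 : ℝ) 1,
        unitBallIntegral (fun y => ‖g y‖ₑ) (x + s • a) (r + s * (r' - r))) + κ * η := by
    have e : κ * η = ∫⁻ _ in Icc (0 : ℝ) 1, κ * η := by simp
    rw [e, ← lintegral_add_right _ measurable_const]
    refine setLIntegral_mono' measurableSet_Icc fun s hs => ?_
    refine (unitBallIntegral_le_add (hm0.trans_le (hρ s hs)) (v := g) (hgm (hball s hs))).trans ?_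
    gcongr
    refine (unitBallIntegral_le_of_ball_subset _ hm0 (hρ s hs) (hball s hs)).trans ?_
    gcongr
  calc _ ≤ unitBallIntegral (fun y => ‖ψ y‖ₑ) x r + κ * η := s1
    _ ≤ (unitBallIntegral (fun y => ‖ψ y‖ₑ) (x + a) r' + c * ∫⁻ s in Icc (0 : ℝ) 1,
        unitBallIntegral (fun y => ‖gradient ψ y‖ₑ) (x + s • a) (r + s * (r' - r))) + κ * η := by
        gcongr
        exact unitBallIntegral_le_of_contDiff hψ.1 x a r r'
    _ ≤ ((unitBallIntegral (fun y => ‖f y‖ₑ) (x + a) r' + κ * η) + c * ((∫⁻ s in Icc (0 : ℝ) 1,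
        unitBallIntegral (fun y => ‖g y‖ₑ) (x + s • a) (r + s * (r' - r))) + κ * η)) + κ * η := by
        gcongr
    _ = (unitBallIntegral (fun y => ‖f y‖ₑ) (x + a) r' + c * (∫⁻ s in Icc (0 : ℝ) 1,
        unitBallIntegral (fun y => ‖g y‖ₑ) (x + s • a) (r + s * (r' - r)))) + D * η := by
        rw [hD]; ring
    _ ≤ _ := by gcongr

/-- The factor `φ(|B(x,r)|) |B(0,1)|` that normalizes `unitBallIntegral` in the maximal
operator. -/
noncomputable def maximalWeight (n : ℕ) (γ r : ℝ) : ℝ≥0∞ :=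
  ENNReal.ofReal (phiWeight γ
    (r ^ n * volume.real (Metric.ball (0 : EuclideanSpace ℝ (Fin n)) 1))) *
    volume (Metric.ball (0 : EuclideanSpace ℝ (Fin n)) 1)

/-! ### The segment inequality for the maximal function. -/

section LineInequality

variable {n : ℕ} {γ : ℝ} {Ω : Set (EuclideanSpace ℝ (Fin n))}

theorem maximalWeight_ne_zero (hγ : 0 ≤ γ) {r : ℝ} (hr : 0 < r) : maximalWeight n γ r ≠ 0 := by
  refine mul_ne_zero ?_ volume_unit_ball_ne_zero
  have := one_le_phiWeight (t := r ^ n * volume.real (Metric.ball (0 : EuclideanSpace ℝ (Fin n)) 1))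
    hγ (by positivity)
  exact (ENNReal.ofReal_pos.2 (by linarith)).ne'

theorem maximalWeight_ne_top {r : ℝ} : maximalWeight n γ r ≠ ⊤ :=
  ENNReal.mul_ne_top ENNReal.ofReal_ne_top volume_unit_ball_ne_top

theorem maximalWeight_mono (hγ : 0 ≤ γ) {r s : ℝ} (hr : 0 ≤ r) (hrs : r ≤ s) :
    maximalWeight n γ r ≤ maximalWeight n γ s := by
  unfold maximalWeight
  gcongr
  exact phiWeight_mono hγ (by positivity) (by gcongr)

theorem localNewMaximal_term_eq {F : EuclideanSpace ℝ (Fin n) → ℝ≥0∞}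
    {x : EuclideanSpace ℝ (Fin n)} {r : ℝ} (hr : 0 < r) :
    (∫⁻ y in Metric.ball x r, F y) /
      (ENNReal.ofReal (phiWeight γ (volume.real (Metric.ball x r))) *
        volume (Metric.ball x r)) = unitBallIntegral F x r / maximalWeight n γ r := by
  have h1 : volume.real (Metric.ball x r) =
      r ^ n * volume.real (Metric.ball (0 : EuclideanSpace ℝ (Fin n)) 1) := by
    rw [Measure.real, volume_ball_scale x hr, ENNReal.toReal_mul,
      ENNReal.toReal_ofReal (by positivity), Measure.real]
  rw [h1, volume_ball_scale x hr, ← ofReal_pow_mul_unitBallIntegral F x hr, maximalWeight,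
    mul_left_comm]
  exact ENNReal.mul_div_mul_left _ _ (ENNReal.ofReal_pos.2 (by positivity)).ne'
    ENNReal.ofReal_ne_top

theorem unitBallIntegral_le_maximalWeight_mul (hγ : 0 ≤ γ) (f : EuclideanSpace ℝ (Fin n) → ℝ)
    {x : EuclideanSpace ℝ (Fin n)} {r : ℝ} (hr : 0 < r)
    (hx : ENNReal.ofReal r < Metric.infEDist x Ωᶜ) :
    unitBallIntegral (fun y => ‖f y‖ₑ) x r ≤ maximalWeight n γ r * localNewMaximal γ Ω f x := by
  rw [mul_comm, ← ENNReal.div_le_iff (maximalWeight_ne_zero hγ hr) maximalWeight_ne_top,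
    ← localNewMaximal_term_eq hr]
  exact le_iSup_of_le r (le_iSup_of_le hr (le_iSup_of_le hx le_rfl))

theorem localNewMaximal_le (hγ : 0 ≤ γ) {f : EuclideanSpace ℝ (Fin n) → ℝ}
    {x : EuclideanSpace ℝ (Fin n)} {B : ℝ≥0∞}
    (h : ∀ r : ℝ, 0 < r → ENNReal.ofReal r < Metric.infEDist x Ωᶜ →
      unitBallIntegral (fun y => ‖f y‖ₑ) x r ≤ maximalWeight n γ r * B) :
    localNewMaximal γ Ω f x ≤ B := by
  refine iSup_le fun r => iSup_le fun hr => iSup_le fun hx => ?_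
  rw [localNewMaximal_term_eq hr, ENNReal.div_le_iff (maximalWeight_ne_zero hγ hr)
    maximalWeight_ne_top, mul_comm]
  exact h r hr hx

theorem lt_infEDist_add {S : Set (EuclideanSpace ℝ (Fin n))} {x b : EuclideanSpace ℝ (Fin n)}
    {ρ : ℝ} (hρ : 0 ≤ ρ) (h : ENNReal.ofReal (ρ + ‖b‖) < Metric.infEDist x S) :
    ENNReal.ofReal ρ < Metric.infEDist (x + b) S := by
  have h1 : Metric.infEDist x S ≤ Metric.infEDist (x + b) S + edist x (x + b) :=
    Metric.infEDist_le_infEDist_add_edist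
  have h2 : edist x (x + b) = ENNReal.ofReal ‖b‖ := by rw [edist_dist, dist_self_add_right]
  rw [h2] at h1
  rw [ENNReal.ofReal_add hρ (norm_nonneg _)] at h
  exact lt_of_add_lt_add_right (h.trans_le h1)

/-- Each average at `x` is compared with one at `x + a` whose radius is not larger. All
interpolating balls are admissible at their own centres, and their normalizing factors do not exceed
that of the original ball, so one division by the latter gives the bound. -/
theorem localNewMaximal_le_add_segment {p : ℝ≥0∞} (hγ : 0 ≤ γ) (hΩ : IsOpen Ω) (hp1 : 1 ≤ p)
    (hp : p ≠ ⊤) {f : EuclideanSpace ℝ (Fin n) → ℝ}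
    {g : EuclideanSpace ℝ (Fin n) → EuclideanSpace ℝ (Fin n)} (h : HasWeakGradient Ω f g)
    (hf : MemLp f p (volume.restrict Ω)) (hg : MemLp g p (volume.restrict Ω))
    {x a : EuclideanSpace ℝ (Fin n)} (hxa : ENNReal.ofReal (3 * ‖a‖) < Metric.infEDist x Ωᶜ) :
    localNewMaximal γ Ω f x ≤ localNewMaximal γ Ω f (x + a) +
      2 * ‖a‖ₑ * ∫⁻ s in Icc (0 : ℝ) 1, localNewMaximal γ Ω (fun y => ‖g y‖) (x + s • a) := by
  refine localNewMaximal_le hγ fun r hr hx => ?_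
  -- If `‖a‖ < r`, take the inner ball of radius `r - ‖a‖`: centre and radius both change by `‖a‖`,
  -- whence the factor `2`. Otherwise translate the ball unchanged; it stays within `2 ‖a‖` of `x`,
  -- which the hypothesis on `3 ‖a‖` allows.
  obtain ⟨r', R, hr', hrR, hr'R, hr'r, hδ, hR, hc⟩ : ∃ r' R : ℝ, 0 < r' ∧ r ≤ R ∧
      ‖a‖ + r' ≤ R ∧ r' ≤ r ∧ (∀ s ∈ Icc (0 : ℝ) 1,
        ENNReal.ofReal (r + s * (r' - r) + s * ‖a‖) < Metric.infEDist x Ωᶜ) ∧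
      ENNReal.ofReal R < Metric.infEDist x Ωᶜ ∧ ‖a‖ + |r' - r| ≤ 2 * ‖a‖ := by
    have ha := norm_nonneg a
    rcases lt_or_ge ‖a‖ r with har | har
    · refine ⟨r - ‖a‖, r, by linarith, le_rfl, by linarith, by linarith, ?_, hx, ?_⟩
      · intro s hs
        refine lt_of_le_of_lt (le_of_eq ?_) hx
        congr 1
        ring
      · rw [show r - ‖a‖ - r = -‖a‖ by ring, abs_neg, abs_norm]
        linarith
    · refine ⟨r, r + ‖a‖, hr, by linarith, by linarith, le_rfl, ?_, ?_, ?_⟩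
      · rintro s ⟨h0, h1⟩
        refine lt_of_le_of_lt (ENNReal.ofReal_le_ofReal ?_) hxa
        nlinarith
      · refine lt_of_le_of_lt (ENNReal.ofReal_le_ofReal ?_) hxa
        linarith
      · simp
        linarith
  have hpos : ∀ s ∈ Icc (0 : ℝ) 1, 0 < r + s * (r' - r) := by
    rintro s ⟨h0, h1⟩
    nlinarith
  refine (h.unitBallIntegral_le hΩ hp1 hp hf hg hr hr' hrR hr'R
    (ball_subset_of_lt_infEDist hR)).trans ?_
  rw [mul_add]
  refine add_le_add ?_ ?_
  · refine (unitBallIntegral_le_maximalWeight_mul hγ f (Ω := Ω) hr' ?_).trans ?_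
    · refine lt_infEDist_add hr'.le ?_
      have := hδ 1 (by simp)
      rwa [show r + 1 * (r' - r) + 1 * ‖a‖ = r' + ‖a‖ by ring] at this
    · gcongr
      exact maximalWeight_mono hγ hr'.le hr'r
  · rw [mul_left_comm]
    refine mul_le_mul' ?_ ?_
    · refine (ENNReal.ofReal_le_ofReal hc).trans (le_of_eq ?_)
      rw [ENNReal.ofReal_mul (by norm_num), ofReal_norm, ENNReal.ofReal_ofNat]
    · rw [← lintegral_const_mul' _ _ maximalWeight_ne_top]
      refine setLIntegral_mono' measurableSet_Icc fun s hs => ?_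
      have h1 := unitBallIntegral_le_maximalWeight_mul hγ (fun y => ‖g y‖) (Ω := Ω)
        (x := x + s • a) (hpos s hs) (lt_infEDist_add (hpos s hs).le (by
          rw [norm_smul, Real.norm_of_nonneg hs.1]; exact hδ s hs))
      simp only [enorm_norm] at h1
      refine h1.trans ?_
      gcongr
      refine maximalWeight_mono hγ (hpos s hs).le ?_
      nlinarith [hs.1]

/-- The pointwise bound near the boundary for a function that vanishes near the point. -/
theorem localNewMaximal_le_infEDist_mul {p : ℝ≥0∞} (hγ : 0 ≤ γ) (hΩ : IsOpen Ω) (hp1 : 1 ≤ p)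
    (hp : p ≠ ⊤) {f : EuclideanSpace ℝ (Fin n) → ℝ}
    {g : EuclideanSpace ℝ (Fin n) → EuclideanSpace ℝ (Fin n)} (h : HasWeakGradient Ω f g)
    (hf : MemLp f p (volume.restrict Ω)) (hg : MemLp g p (volume.restrict Ω))
    {x : EuclideanSpace ℝ (Fin n)} (hx : f =ᶠ[𝓝 x] 0) :
    localNewMaximal γ Ω f x ≤
      Metric.infEDist x Ωᶜ * localNewMaximal γ Ω (fun y => ‖g y‖) x := by
  obtain ⟨δ, hδ, hfδ⟩ := Metric.eventually_nhds_iff_ball.1 hx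
  refine localNewMaximal_le hγ fun r hr hxr => ?_
  set r' := min r δ with hr'
  have hr'0 : 0 < r' := lt_min hr hδ
  have hr'r : r' ≤ r := min_le_left _ _
  -- With `a = 0` the ball shrinks concentrically to one on which `f` vanishes; the displacement is
  -- `r - r'`, less than the distance to the complement.
  have key := h.unitBallIntegral_le hΩ hp1 hp hf hg (x := x) (a := 0) hr hr'0 le_rfl
    (by simpa using hr'r) (ball_subset_of_lt_infEDist hxr)
  have hz : unitBallIntegral (fun y => ‖f y‖ₑ) (x + 0) r' = 0 := by
    refine (setLIntegral_eq_zero Metric.isOpen_ball.measurableSet fun z hz => ?_)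
    rw [mem_ball_zero_iff] at hz
    have : f (x + r' • z) = 0 := by
      refine hfδ _ ?_
      rw [Metric.mem_ball, dist_self_add_left, norm_smul, Real.norm_of_nonneg hr'0.le]
      calc r' * ‖z‖ < r' * 1 := by gcongr
        _ ≤ δ := by rw [mul_one]; exact min_le_right _ _
    simp [this]
  rw [hz, zero_add] at key
  refine key.trans ?_
  rw [mul_left_comm]
  refine mul_le_mul' ?_ ?_
  · refine le_trans (ENNReal.ofReal_le_ofReal ?_) hxr.le
    rw [norm_zero, zero_add, abs_sub_comm, abs_of_nonneg (by linarith)]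
    linarith
  · have hc : maximalWeight n γ r * localNewMaximal γ Ω (fun y => ‖g y‖) x =
      ∫⁻ _ in Icc (0 : ℝ) 1, maximalWeight n γ r * localNewMaximal γ Ω (fun y => ‖g y‖) x := by
      simp
    rw [hc]
    refine setLIntegral_mono' measurableSet_Icc fun s hs => ?_
    have hle : r + s * (r' - r) ≤ r := by nlinarith [hs.1]
    have hpos : 0 < r + s * (r' - r) := by nlinarith [hs.1, hs.2]
    have h1 := unitBallIntegral_le_maximalWeight_mul hγ (fun y => ‖g y‖) (Ω := Ω)
      (x := x) hpos ((ENNReal.ofReal_le_ofReal hle).trans_lt hxr)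
    simp only [enorm_norm] at h1
    rw [smul_zero, add_zero]
    refine h1.trans ?_
    gcongr
    exact maximalWeight_mono hγ hpos.le hle

end LineInequality

/-! ### Weak gradients from bounds on distributional derivatives. -/

/-- The bound forces `T` to vanish on `ker J`, so `T` descends to the range of `J`; Hahn–Banach
extends it to `H` and Riesz represents the extension. The range need not be closed. -/
theorem exists_inner_eq_of_abs_le {V H : Type*} [AddCommGroup V] [Module ℝ V]
    [NormedAddCommGroup H] [InnerProductSpace ℝ H] [CompleteSpace H] (T : V →ₗ[ℝ] ℝ)
    (J : V →ₗ[ℝ] H) {C : ℝ} (h : ∀ v, |T v| ≤ C * ‖J v‖) :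
    ∃ w : H, ∀ v, T v = inner ℝ w (J v) := by
  have hker : LinearMap.ker J ≤ LinearMap.ker T := by
    intro v hv
    have := h v
    rw [LinearMap.mem_ker.1 hv, norm_zero, mul_zero] at this
    exact abs_nonpos_iff.1 this
  let T' : LinearMap.range J →ₗ[ℝ] ℝ :=
    ((LinearMap.ker J).liftQ T hker).comp J.quotKerEquivRange.symm.toLinearMap
  have hT' : ∀ v (hv : J v ∈ LinearMap.range J), T' ⟨J v, hv⟩ = T v := by
    intro v hv
    simp only [T', LinearMap.comp_apply, LinearEquiv.coe_coe]
    rw [LinearMap.quotKerEquivRange_symm_apply_image]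
    simp
  obtain ⟨ℓ, hℓ, -⟩ := exists_extension_norm_eq (𝕜 := ℝ) (LinearMap.range J)
    (T'.mkContinuous C (by
      rintro ⟨_, v, rfl⟩
      change |T' ⟨J v, LinearMap.mem_range_self J v⟩| ≤ C * ‖J v‖
      rw [hT' v (LinearMap.mem_range_self J v)]
      exact h v))
  refine ⟨(InnerProductSpace.toDual ℝ H).symm ℓ, fun v => ?_⟩
  rw [InnerProductSpace.toDual_symm_apply]
  have := hℓ ⟨J v, LinearMap.mem_range_self J v⟩
  rw [this]
  exact (hT' v _).symm

section WeakGradient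

variable {n : ℕ} {Ω : Set (EuclideanSpace ℝ (Fin n))}

theorem HasWeakGradient.ae_eq (hΩ : IsOpen Ω) {f : EuclideanSpace ℝ (Fin n) → ℝ}
    {g g' : EuclideanSpace ℝ (Fin n) → EuclideanSpace ℝ (Fin n)} (h : HasWeakGradient Ω f g)
    (h' : HasWeakGradient Ω f g') : g =ᵐ[volume.restrict Ω] g' := by
  have key : ∀ i : Fin n, ∀ᵐ x, x ∈ Ω → g x i - g' x i = 0 := by
    intro i
    have hgi := locallyIntegrableOn_apply h.2.1 i
    have hgi' := locallyIntegrableOn_apply h'.2.1 i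
    refine hΩ.ae_eq_zero_of_integral_contDiff_smul_eq_zero (f := fun x => g x i - g' x i)
      (hgi.sub hgi') fun ψ h1 h2 h3 => ?_
    have hψ : IsTestFunction Ω ψ := ⟨h1, h2, h3⟩
    have e1 := h.2.2 ψ hψ i
    rw [h'.2.2 ψ hψ i, setIntegral_eq_integral_of_test hψ,
      setIntegral_eq_integral_of_test hψ] at e1
    simp only [smul_sub]
    rw [integral_sub (hψ.integrable_smul hgi) (hψ.integrable_smul hgi')]
    simp only [smul_eq_mul, mul_comm (ψ _)]
    linarith
  rw [Filter.EventuallyEq, ae_restrict_iff' hΩ.measurableSet]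
  filter_upwards [ae_all_iff.2 key] with x hx hxΩ
  ext i
  exact sub_eq_zero.1 (hx i hxΩ)

theorem hasWeakGradient_weakGradient {f : EuclideanSpace ℝ (Fin n) → ℝ}
    (h : ∃ g, HasWeakGradient Ω f g) : HasWeakGradient Ω f (weakGradient Ω f) := by
  rw [weakGradient, dif_pos h]
  exact h.choose_spec

theorem HasWeakGradient.weakGradient_ae_eq (hΩ : IsOpen Ω) {f : EuclideanSpace ℝ (Fin n) → ℝ}
    {g : EuclideanSpace ℝ (Fin n) → EuclideanSpace ℝ (Fin n)} (h : HasWeakGradient Ω f g) :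
    weakGradient Ω f =ᵐ[volume.restrict Ω] g :=
  (hasWeakGradient_weakGradient ⟨g, h⟩).ae_eq hΩ h

theorem HasWeakGradient.memSobolev (hΩ : IsOpen Ω) {p : ℝ≥0∞}
    {f : EuclideanSpace ℝ (Fin n) → ℝ}
    {g : EuclideanSpace ℝ (Fin n) → EuclideanSpace ℝ (Fin n)} (h : HasWeakGradient Ω f g)
    (hf : MemLp f p (volume.restrict Ω)) (hg : MemLp g p (volume.restrict Ω)) :
    MemSobolev p Ω f :=
  ⟨hf, ⟨g, h⟩, hg.ae_eq (h.weakGradient_ae_eq hΩ).symm⟩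

theorem HasWeakGradient.sobolevNorm_eq (hΩ : IsOpen Ω) {p : ℝ≥0∞}
    {f : EuclideanSpace ℝ (Fin n) → ℝ}
    {g : EuclideanSpace ℝ (Fin n) → EuclideanSpace ℝ (Fin n)} (h : HasWeakGradient Ω f g) :
    sobolevNorm p Ω f = eLpNorm f p (volume.restrict Ω) + eLpNorm g p (volume.restrict Ω) := by
  rw [sobolevNorm, eLpNorm_congr_ae (h.weakGradient_ae_eq hΩ)]

theorem HasWeakGradient.sub {f₁ f₂ : EuclideanSpace ℝ (Fin n) → ℝ}
    {g₁ g₂ : EuclideanSpace ℝ (Fin n) → EuclideanSpace ℝ (Fin n)}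
    (h₁ : HasWeakGradient Ω f₁ g₁) (h₂ : HasWeakGradient Ω f₂ g₂) :
    HasWeakGradient Ω (fun x => f₁ x - f₂ x) (fun x => g₁ x - g₂ x) := by
  refine ⟨h₁.1.sub h₂.1, h₁.2.1.sub h₂.2.1, fun ψ hψ i => ?_⟩
  have e₁ := h₁.2.2 ψ hψ i
  have e₂ := h₂.2.2 ψ hψ i
  have hψi := hψ.fderiv_apply (EuclideanSpace.single i 1)
  have i1 := ((hψi.integrable_smul h₁.1).integrableOn (s := Ω))
  have i2 := ((hψi.integrable_smul h₂.1).integrableOn (s := Ω))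
  have i3 := ((hψ.integrable_smul (locallyIntegrableOn_apply h₁.2.1 i)).integrableOn (s := Ω))
  have i4 := ((hψ.integrable_smul (locallyIntegrableOn_apply h₂.2.1 i)).integrableOn (s := Ω))
  simp only [smul_eq_mul, mul_comm (ψ _), mul_comm (fderiv ℝ ψ _ _)] at i1 i2 i3 i4
  simp only [sub_mul, PiLp.sub_apply]
  rw [integral_sub i1 i2, integral_sub i3 i4, e₁, e₂]
  ring

theorem hasWeakGradient_gradient {ψ : EuclideanSpace ℝ (Fin n) → ℝ} (hψ : ContDiff ℝ ∞ ψ) :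
    HasWeakGradient Ω ψ (gradient ψ) := by
  refine ⟨hψ.continuous.locallyIntegrable.locallyIntegrableOn _,
    (continuous_gradient hψ).locallyIntegrable.locallyIntegrableOn _, fun η hη i => ?_⟩
  have hηi := hη.fderiv_apply (EuclideanSpace.single i 1)
  rw [setIntegral_eq_integral_of_test hη, setIntegral_eq_integral_of_test hηi]
  simp only [gradient_apply]
  have hψi : Continuous fun x => fderiv ℝ ψ x (EuclideanSpace.single i 1) :=
    (hψ.continuous_fderiv (by simp)).clm_apply continuous_const
  refine integral_mul_fderiv_eq_neg_fderiv_mul_of_integrable ?_ ?_ ?_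
    (fun x _ => hψ.differentiable (by simp) x) (fun x _ => hη.1.differentiable (by simp) x)
  · exact (hψi.mul hη.1.continuous).integrable_of_hasCompactSupport hη.2.1.mul_left
  · exact (hψ.continuous.mul hηi.1.continuous).integrable_of_hasCompactSupport hηi.2.1.mul_left
  · exact (hψ.continuous.mul hη.1.continuous).integrable_of_hasCompactSupport hη.2.1.mul_left

/-- Locally, cut `H` off by `χ` and mollify: the value at `y` is `H` tested against the nonnegative
test function `χ ρ_k(y - ·)`, and it converges to `χ H` almost everywhere. -/
theorem ae_nonneg_of_forall_test (hΩ : IsOpen Ω) {H : EuclideanSpace ℝ (Fin n) → ℝ}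
    (hH : LocallyIntegrableOn H Ω)
    (h : ∀ ψ, IsTestFunction Ω ψ → (∀ x, 0 ≤ ψ x) → 0 ≤ ∫ x in Ω, H x * ψ x) :
    ∀ᵐ x ∂volume.restrict Ω, 0 ≤ H x := by
  rw [ae_restrict_iff' hΩ.measurableSet, ae_iff]
  refine measure_null_of_locally_null _ fun x hx => ?_
  have hxΩ : x ∈ Ω := by
    by_contra hc
    exact hx fun h => absurd h hc
  obtain ⟨χ, hχ, hχ0, U, hU, hxU, hχ1⟩ := exists_test_eq_one hΩ (isCompact_singleton (x := x))
    (singleton_subset_iff.2 hxΩ)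
  refine ⟨U ∩ {a | ¬(a ∈ Ω → 0 ≤ H a)}, inter_mem (mem_nhdsWithin_of_mem_nhds
    (hU.mem_nhds (hxU rfl))) self_mem_nhdsWithin, ?_⟩
  have hint : Integrable fun y => χ y * H y := hχ.integrable_smul hH
  let φ : ℕ → ContDiffBump (0 : EuclideanSpace ℝ (Fin n)) := fun k =>
    ⟨1 / ((k : ℝ) + 1) / 2, 1 / ((k : ℝ) + 1), by positivity, half_lt_self (by positivity)⟩
  have hlim := ContDiffBump.ae_convolution_tendsto_right_of_locallyIntegrable (φ := φ)
    (l := atTop) (K := 2) (μ := volume) tendsto_one_div_add_atTop_nhds_zero_nat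
    (Eventually.of_forall fun k => by
      change 1 / ((k : ℝ) + 1) ≤ 2 * (1 / ((k : ℝ) + 1) / 2)
      linarith) hint.locallyIntegrable
  have hae : ∀ᵐ y, 0 ≤ χ y * H y := by
    filter_upwards [hlim] with y hy
    refine ge_of_tendsto' hy fun k => ?_
    have hs : ContDiff ℝ ∞ fun z => (φ k).normed volume (y - z) :=
      (φ k).contDiff_normed.comp (contDiff_const.sub contDiff_id)
    have h1 := h _ (hχ.mul hs) fun z => mul_nonneg (hχ0 z) ((φ k).nonneg_normed _)
    rw [setIntegral_eq_integral_of_test (hχ.mul hs)] at h1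
    rw [convolution_eq_swap]
    refine h1.trans (le_of_eq (integral_congr_ae (Eventually.of_forall fun z => ?_)))
    simp only [ContinuousLinearMap.lsmul_apply, smul_eq_mul]
    ring
  refine measure_mono_null ?_ hae
  rintro y ⟨hyU, hy⟩
  intro hc
  refine hy fun _ => ?_
  have : 0 ≤ χ y * H y := hc
  rwa [hχ1 y hyU, one_mul] at this

/-- With weight `w ≤ 1`, `G w ≤ G ^ p + w`: compare with `w` where `G ≤ 1` and with `G ^ p`
elsewhere. The exponent `n + 1` makes `w` integrable. -/
theorem integrable_mul_decay {p : ℝ≥0∞} (hp1 : 1 ≤ p) (hp : p ≠ ⊤)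
    {G : EuclideanSpace ℝ (Fin n) → ℝ} (hG0 : ∀ x, 0 ≤ G x)
    (hG : MemLp G p (volume.restrict Ω)) :
    Integrable (fun x => G x * (1 + ‖x‖) ^ (-((n : ℝ) + 1))) (volume.restrict Ω) := by
  have h1 : Integrable (fun x : EuclideanSpace ℝ (Fin n) => (1 + ‖x‖) ^ (-((n : ℝ) + 1))) :=
    integrable_one_add_norm (by simp)
  have h2 := hG.integrable_norm_rpow (zero_lt_one.trans_le hp1).ne' hp
  have hq1 : 1 ≤ p.toReal := by
    rw [← ENNReal.toReal_one]
    exact (ENNReal.toReal_le_toReal ENNReal.one_ne_top hp).2 hp1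
  refine (h2.add (h1.integrableOn (s := Ω))).mono'
    (hG.1.mul h1.aestronglyMeasurable.restrict) (Eventually.of_forall fun x => ?_)
  have hx1 : (1 : ℝ) ≤ 1 + ‖x‖ := by linarith [norm_nonneg x]
  have hw0 : 0 ≤ (1 + ‖x‖) ^ (-((n : ℝ) + 1)) := Real.rpow_nonneg (by linarith) _
  have hw1 : (1 + ‖x‖) ^ (-((n : ℝ) + 1)) ≤ 1 :=
    Real.rpow_le_one_of_one_le_of_nonpos hx1 (by linarith [Nat.cast_nonneg (α := ℝ) n])
  rw [Real.norm_of_nonneg (mul_nonneg (hG0 x) hw0), Pi.add_apply, Real.norm_of_nonneg (hG0 x)]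
  rcases le_total (G x) 1 with h | h
  · have := Real.rpow_nonneg (hG0 x) p.toReal
    nlinarith
  · have : G x ≤ G x ^ p.toReal := Real.self_le_rpow_of_one_le h hq1
    nlinarith [hG0 x]

/-- The test functions on `Ω`, as a space of functions. -/
def testFunctions (Ω : Set (EuclideanSpace ℝ (Fin n))) :
    Submodule ℝ (EuclideanSpace ℝ (Fin n) → ℝ) where
  carrier := {ψ | IsTestFunction Ω ψ}
  add_mem' h₁ h₂ := h₁.add h₂
  zero_mem' := ⟨contDiff_const, HasCompactSupport.zero, by
    simp [tsupport, Function.support]⟩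
  smul_mem' c _ h := h.const_mul c

/-- Hilbert space duality replaces the dual of `L^1`. The weight `w` makes `μ = G w dx` finite, and
the hypothesis bounds `T ψ` by the `L^1(μ)` norm of `c ψ` with `c = 1 / w`. On a finite measure the
`L^2(μ)` norm dominates it up to a constant, so some `v` in `L^2(μ)` represents `T`; unwinding the
density gives `F = c G w v`. -/
theorem exists_density_of_abs_le {p : ℝ≥0∞} (hp1 : 1 ≤ p) (hp : p ≠ ⊤) (hΩ : IsOpen Ω)
    {G : EuclideanSpace ℝ (Fin n) → ℝ} (hGm : Measurable G) (hG0 : ∀ x, 0 ≤ G x)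
    (hG : MemLp G p (volume.restrict Ω)) (T : testFunctions Ω →ₗ[ℝ] ℝ)
    (hT : ∀ ψ : testFunctions Ω, |T ψ| ≤ ∫ x in Ω, G x * |(ψ : _ → ℝ) x|) :
    ∃ F : EuclideanSpace ℝ (Fin n) → ℝ, LocallyIntegrableOn F Ω ∧
      ∀ ψ : testFunctions Ω, T ψ = ∫ x in Ω, F x * (ψ : _ → ℝ) x := by
  set w : EuclideanSpace ℝ (Fin n) → ℝ := fun x => (1 + ‖x‖) ^ (-((n : ℝ) + 1)) with hw
  set c : EuclideanSpace ℝ (Fin n) → ℝ := fun x => (1 + ‖x‖) ^ ((n : ℝ) + 1) with hc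
  have hpos : ∀ x : EuclideanSpace ℝ (Fin n), 0 < 1 + ‖x‖ := fun x => by
    linarith [norm_nonneg x]
  have hcc : Continuous c :=
    (continuous_const.add continuous_norm).rpow_const fun x => Or.inl (hpos x).ne'
  have hwc : Continuous w :=
    (continuous_const.add continuous_norm).rpow_const fun x => Or.inl (hpos x).ne'
  have hw0 : ∀ x, 0 ≤ w x := fun x => Real.rpow_nonneg (hpos x).le _
  have hc0 : ∀ x, 0 ≤ c x := fun x => Real.rpow_nonneg (hpos x).le _
  have hwc1 : ∀ x, w x * c x = 1 := fun x => by
    rw [hw, hc, ← Real.rpow_add (hpos x)]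
    simp
  have hGw := integrable_mul_decay hp1 hp hG0 hG
  set d : EuclideanSpace ℝ (Fin n) → ℝ≥0∞ := fun x => ENNReal.ofReal (G x * w x) with hd
  have hdm : Measurable d := (hGm.mul hwc.measurable).ennreal_ofReal
  have hdr : ∀ x, (d x).toReal = G x * w x := fun x =>
    ENNReal.toReal_ofReal (mul_nonneg (hG0 x) (hw0 x))
  have hdt : ∀ᵐ x ∂volume.restrict Ω, d x < ⊤ :=
    Eventually.of_forall fun x => ENNReal.ofReal_lt_top
  set μ := (volume.restrict Ω).withDensity d with hμ
  have : IsFiniteMeasure μ := isFiniteMeasure_withDensity_ofReal hGw.2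
  have hmem : ∀ ψ : testFunctions Ω, MemLp (fun x => c x * (ψ : _ → ℝ) x) 2 μ := by
    intro ψ
    have hct : Continuous fun x => c x * (ψ : _ → ℝ) x := hcc.mul ψ.2.1.continuous
    obtain ⟨B, hB⟩ := hct.bounded_above_of_compact_support ψ.2.2.1.mul_left
    exact MemLp.of_bound hct.aestronglyMeasurable B (Eventually.of_forall hB)
  let J : testFunctions Ω →ₗ[ℝ] Lp ℝ 2 μ :=
    { toFun := fun ψ => (hmem ψ).toLp _
      map_add' := fun ψ η => by
        rw [← MemLp.toLp_add]
        refine MemLp.toLp_congr _ _ (Eventually.of_forall fun x => ?_)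
        simp [mul_add]
      map_smul' := fun a ψ => by
        rw [RingHom.id_apply, ← MemLp.toLp_const_smul]
        refine MemLp.toLp_congr _ _ (Eventually.of_forall fun x => ?_)
        simp [mul_left_comm] }
  have hJ : ∀ ψ : testFunctions Ω, ∫ x in Ω, G x * |(ψ : _ → ℝ) x| =
      (eLpNorm (fun x => c x * (ψ : _ → ℝ) x) 1 μ).toReal := by
    intro ψ
    rw [eLpNorm_one_eq_lintegral_enorm, ← integral_norm_eq_lintegral_enorm (hmem ψ).1]
    refine ((integral_withDensity_eq_integral_toReal_smul hdm hdt _).trans ?_).symm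
    refine integral_congr_ae (Eventually.of_forall fun x => ?_)
    simp only [hdr, smul_eq_mul, Real.norm_eq_abs, abs_mul, abs_of_nonneg (hc0 x)]
    rw [mul_assoc, ← mul_assoc (w x), hwc1, one_mul]
  obtain ⟨v, hv⟩ := exists_inner_eq_of_abs_le T J
    (C := (μ univ ^ (1 / (1 : ℝ≥0∞).toReal - 1 / (2 : ℝ≥0∞).toReal)).toReal) (by
      intro ψ
      refine (hT ψ).trans ?_
      rw [hJ]
      simp only [J, LinearMap.coe_mk, AddHom.coe_mk, Lp.norm_toLp]
      rw [← ENNReal.toReal_mul]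
      refine ENNReal.toReal_mono (ENNReal.mul_ne_top ?_ (hmem ψ).2.ne) ?_
      · exact ENNReal.rpow_ne_top_of_nonneg (by norm_num) (measure_ne_top _ _)
      · rw [mul_comm]
        exact eLpNorm_le_eLpNorm_mul_rpow_measure_univ (by norm_num) (hmem ψ).1)
  have hvint : Integrable v μ := (Lp.memLp v).integrable (by norm_num)
  replace hvint := (integrable_withDensity_iff_integrable_smul' hdm hdt).1 hvint
  simp only [hdr, smul_eq_mul] at hvint
  refine ⟨fun x => c x * (G x * w x * v x), ?_, fun ψ => ?_⟩
  · have h1 : LocallyIntegrableOn (fun x => G x * w x * v x) Ω :=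
      IntegrableOn.locallyIntegrableOn hvint
    exact h1.continuousOn_mul hcc.continuousOn hΩ.isLocallyClosed
  · rw [hv ψ, L2.inner_def]
    have e1 : ∫ x, inner ℝ (v x) (J ψ x) ∂μ = ∫ x, v x * (c x * (ψ : _ → ℝ) x) ∂μ := by
      refine integral_congr_ae ?_
      filter_upwards [(hmem ψ).coeFn_toLp] with x hx
      have : J ψ x = c x * (ψ : _ → ℝ) x := hx
      rw [this]
      simp [mul_comm]
    refine e1.trans ((integral_withDensity_eq_integral_toReal_smul hdm hdt _).trans ?_)
    refine integral_congr_ae (Eventually.of_forall fun x => ?_)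
    simp only [hdr, smul_eq_mul]
    ring

theorem fderiv_apply_eq_sum (ψ : EuclideanSpace ℝ (Fin n) → ℝ) (x a : EuclideanSpace ℝ (Fin n)) :
    fderiv ℝ ψ x a = ∑ i, a i * fderiv ℝ ψ x (EuclideanSpace.single i 1) := by
  have h : a = ∑ i, a i • EuclideanSpace.single i (1 : ℝ) := by
    ext j
    simp [Finset.sum_apply, Pi.single_apply]
  conv_lhs => rw [h]
  rw [map_sum]
  simp

/-- A function whose distributional derivatives are bounded by `G ∈ L^p` has a weak gradient
bounded by `G`. -/
theorem exists_hasWeakGradient_of_abs_integral_le {p : ℝ≥0∞} (hp1 : 1 ≤ p) (hp : p ≠ ⊤)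
    (hΩ : IsOpen Ω) {u : EuclideanSpace ℝ (Fin n) → ℝ} (hu : LocallyIntegrableOn u Ω)
    {G : EuclideanSpace ℝ (Fin n) → ℝ} (hGm : Measurable G) (hG0 : ∀ x, 0 ≤ G x)
    (hG : MemLp G p (volume.restrict Ω))
    (h : ∀ ψ, IsTestFunction Ω ψ → ∀ a,
      |∫ x in Ω, u x * fderiv ℝ ψ x a| ≤ ‖a‖ * ∫ x in Ω, G x * |ψ x|) :
    ∃ g, HasWeakGradient Ω u g ∧ ∀ᵐ x ∂volume.restrict Ω, ‖g x‖ ≤ G x := by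
  have hint : ∀ ψ, IsTestFunction Ω ψ → ∀ a,
      Integrable (fun x => u x * fderiv ℝ ψ x a) (volume.restrict Ω) := fun ψ hψ a => by
    have := ((hψ.fderiv_apply a).integrable_smul hu).integrableOn (s := Ω)
    simpa only [smul_eq_mul, mul_comm, IntegrableOn] using this
  let T : Fin n → testFunctions Ω →ₗ[ℝ] ℝ := fun i =>
    { toFun := fun ψ => -∫ x in Ω, u x * fderiv ℝ (ψ : _ → ℝ) x (EuclideanSpace.single i 1)
      map_add' := fun ψ η => by
        rw [← neg_add, ← integral_add (hint _ ψ.2 _) (hint _ η.2 _)]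
        congr 1
        refine integral_congr_ae (Eventually.of_forall fun x => ?_)
        simp only [Submodule.coe_add]
        rw [fderiv_add (ψ.2.1.differentiable (by simp) x) (η.2.1.differentiable (by simp) x)]
        simp [mul_add]
      map_smul' := fun c ψ => by
        rw [RingHom.id_apply, smul_neg, smul_eq_mul, ← integral_const_mul]
        congr 1
        refine integral_congr_ae (Eventually.of_forall fun x => ?_)
        simp only [Submodule.coe_smul]
        rw [fderiv_const_smul (ψ.2.1.differentiable (by simp) x)]
        simp [mul_left_comm] }
  have hF : ∀ i, ∃ F : EuclideanSpace ℝ (Fin n) → ℝ, LocallyIntegrableOn F Ω ∧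
      ∀ ψ : testFunctions Ω, T i ψ = ∫ x in Ω, F x * (ψ : _ → ℝ) x := fun i => by
    refine exists_density_of_abs_le hp1 hp hΩ hGm hG0 hG (T i) fun ψ => ?_
    have := h ψ ψ.2 (EuclideanSpace.single i 1)
    rw [PiLp.norm_single, norm_one, one_mul] at this
    simpa [T] using this
  choose F hFi hFT using hF
  set g : EuclideanSpace ℝ (Fin n) → EuclideanSpace ℝ (Fin n) :=
    fun x => ∑ i, F i x • EuclideanSpace.single i (1 : ℝ) with hg
  have hgi : ∀ x i, g x i = F i x := fun x i => by
    simp [hg, Finset.sum_apply, Pi.single_apply]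
  have hgl : LocallyIntegrableOn g Ω := by
    rw [locallyIntegrableOn_iff hΩ.isLocallyClosed]
    intro K hK hKc
    exact integrable_finsetSum _ fun i _ =>
      ((hFi i).integrableOn_compact_subset hK hKc).smul_const _
  have hwg : HasWeakGradient Ω u g := by
    refine ⟨hu, hgl, fun ψ hψ i => ?_⟩
    simp only [hgi]
    have := hFT i ⟨ψ, hψ⟩
    simp only [T, LinearMap.coe_mk, AddHom.coe_mk] at this
    rw [← this, neg_neg]
  refine ⟨g, hwg, ?_⟩
  have hGl : LocallyIntegrableOn G Ω :=
    locallyIntegrableOn_of_locallyIntegrable_restrict (hG.locallyIntegrable hp1)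
  have hmulψ : ∀ {K : EuclideanSpace ℝ (Fin n) → ℝ}, LocallyIntegrableOn K Ω →
      ∀ ψ, IsTestFunction Ω ψ → Integrable (fun x => K x * ψ x) (volume.restrict Ω) := by
    intro K hK ψ hψ
    have := (hψ.integrable_smul hK).integrableOn (s := Ω)
    simpa only [smul_eq_mul, mul_comm, IntegrableOn] using this
  -- Testing with `ψ ≥ 0` turns the integral bound into a pointwise one for each fixed direction
  -- `a`, off a null set depending on `a`.
  have hdir : ∀ a : EuclideanSpace ℝ (Fin n),
      ∀ᵐ x ∂volume.restrict Ω, 0 ≤ ‖a‖ * G x - inner ℝ (g x) a := by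
    intro a
    have hin : ∀ x, inner ℝ (g x) a = ∑ i, a i * F i x := fun x => by
      simp [PiLp.inner_apply, hgi]
    have hSl : LocallyIntegrableOn (fun x => ∑ i, a i * F i x) Ω := by
      rw [locallyIntegrableOn_iff hΩ.isLocallyClosed]
      intro K hK hKc
      exact integrable_finsetSum _ fun i _ =>
        ((hFi i).integrableOn_compact_subset hK hKc).const_mul _
    have hGal : LocallyIntegrableOn (fun x => ‖a‖ * G x) Ω := by
      rw [locallyIntegrableOn_iff hΩ.isLocallyClosed]
      intro K hK hKc
      exact (hGl.integrableOn_compact_subset hK hKc).const_mul _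
    simp only [hin]
    refine ae_nonneg_of_forall_test hΩ (hGal.sub hSl) fun ψ hψ hψ0 => ?_
    simp only [sub_mul]
    rw [integral_sub (hmulψ hGal ψ hψ) (hmulψ hSl ψ hψ)]
    have e1 : ∫ x in Ω, (∑ i, a i * F i x) * ψ x = -∫ x in Ω, u x * fderiv ℝ ψ x a := by
      simp only [Finset.sum_mul, fderiv_apply_eq_sum ψ _ a, Finset.mul_sum]
      rw [integral_finsetSum _ fun i _ => ?_, integral_finsetSum _ fun i _ => ?_,
        ← Finset.sum_neg_distrib]
      · refine Finset.sum_congr rfl fun i _ => ?_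
        have := hFT i ⟨ψ, hψ⟩
        simp only [T, LinearMap.coe_mk, AddHom.coe_mk] at this
        simp only [mul_assoc, mul_left_comm (u _)]
        rw [integral_const_mul, integral_const_mul, ← this]
        ring
      · simp only [mul_left_comm (u _)]
        exact (hint ψ hψ _).const_mul _
      · simp only [mul_assoc]
        exact (hmulψ (hFi i) ψ hψ).const_mul _
    have e2 : ∫ x in Ω, ‖a‖ * G x * ψ x = ‖a‖ * ∫ x in Ω, G x * |ψ x| := by
      rw [← integral_const_mul]
      refine integral_congr_ae (Eventually.of_forall fun x => ?_)
      simp only [abs_of_nonneg (hψ0 x), mul_assoc]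
    rw [e1, e2]
    have := neg_le_of_abs_le (h ψ hψ a)
    linarith
  -- Countably many dense directions share one null set; by continuity every direction is allowed
  -- there, in particular `a = g x`.
  have hall := ae_all_iff.2 fun k => hdir (TopologicalSpace.denseSeq (EuclideanSpace ℝ (Fin n)) k)
  filter_upwards [hall] with x hx
  have hx' : ∀ a, 0 ≤ ‖a‖ * G x - inner ℝ (g x) a := by
    intro a
    refine (TopologicalSpace.denseRange_denseSeq (EuclideanSpace ℝ (Fin n))).induction_on
      (p := fun a => 0 ≤ ‖a‖ * G x - inner ℝ (g x) a) a ?_ hx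
    exact isClosed_le continuous_const (by fun_prop)
  have h1 := hx' (g x)
  rw [real_inner_self_eq_norm_sq] at h1
  by_contra hc
  have h2 : 0 < ‖g x‖ := (hG0 x).trans_lt (not_le.1 hc)
  nlinarith

end WeakGradient

/-! ### From the segment inequality to distributional derivatives. -/

theorem enorm_toReal_sub_le {a b c : ℝ≥0∞} (ha : a ≠ ⊤) (hb : b ≠ ⊤) (h1 : a ≤ b + c)
    (h2 : b ≤ a + c) : ‖a.toReal - b.toReal‖ₑ ≤ c := by
  rcases eq_or_ne c ⊤ with rfl | hc
  · exact le_top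
  rw [Real.enorm_eq_ofReal_abs]
  refine ENNReal.ofReal_le_of_le_toReal ?_
  have h1' := ENNReal.toReal_mono (by finiteness) h1
  have h2' := ENNReal.toReal_mono (by finiteness) h2
  rw [ENNReal.toReal_add hb hc] at h1'
  rw [ENNReal.toReal_add ha hc] at h2'
  rw [abs_le]
  constructor <;> linarith

/-- Makes the error term of the segment inequality symmetric in the two endpoints. -/
theorem lintegral_Icc_reverse {n : ℕ} (N : EuclideanSpace ℝ (Fin n) → ℝ≥0∞)
    (x b : EuclideanSpace ℝ (Fin n)) :
    ∫⁻ s in Icc (0 : ℝ) 1, N (x + b + s • (-b)) = ∫⁻ s in Icc (0 : ℝ) 1, N (x + s • b) := by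
  rw [← lintegral_indicator measurableSet_Icc, ← lintegral_indicator measurableSet_Icc,
    ← lintegral_sub_left_eq_self _ (1 : ℝ)]
  refine lintegral_congr fun s => ?_
  by_cases hs : s ∈ Icc (0 : ℝ) 1
  · have hs' : 1 - s ∈ Icc (0 : ℝ) 1 := ⟨by linarith [hs.2], by linarith [hs.1]⟩
    rw [indicator_of_mem hs, indicator_of_mem hs']
    congr 1
    module
  · have hs' : 1 - s ∉ Icc (0 : ℝ) 1 := fun h => hs ⟨by linarith [h.2], by linarith [h.1]⟩
    rw [indicator_of_notMem hs, indicator_of_notMem hs']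

section SegmentInequality

variable {n : ℕ} {Ω : Set (EuclideanSpace ℝ (Fin n))}

theorem exists_le_infEDist_of_isCompact (hΩ : IsOpen Ω) {K : Set (EuclideanSpace ℝ (Fin n))}
    (hK : IsCompact K) (hKΩ : K ⊆ Ω) :
    ∃ δ : ℝ, 0 < δ ∧ ∀ x ∈ K, ENNReal.ofReal δ ≤ Metric.infEDist x Ωᶜ := by
  obtain ⟨δ, hδ, h⟩ := hK.exists_thickening_subset_open hΩ hKΩ
  refine ⟨δ, hδ, fun x hx => Metric.le_infEDist.2 fun y hy => ?_⟩
  by_contra hc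
  refine hy (h (Metric.mem_thickening_iff.2 ⟨x, hx, ?_⟩))
  rw [not_le, edist_dist] at hc
  rw [dist_comm]
  exact (ENNReal.ofReal_lt_ofReal_iff hδ).1 hc

/-- Dominated convergence: the quotients are bounded by the Lipschitz constant of `ψ` times `‖a‖`,
and for small `t` they live on the fixed compact set `K`. -/
theorem tendsto_integral_difference_quotient {u ψ : EuclideanSpace ℝ (Fin n) → ℝ}
    (hu : LocallyIntegrable u) (hψ : ContDiff ℝ ∞ ψ) (hψc : HasCompactSupport ψ)
    (a : EuclideanSpace ℝ (Fin n)) :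
    Tendsto (fun t : ℝ => ∫ x, u x * (t⁻¹ * (ψ x - ψ (x - t • a)))) (𝓝[>] 0)
      (𝓝 (∫ x, u x * fderiv ℝ ψ x a)) := by
  obtain ⟨L, hL⟩ := hψ.lipschitzWith_of_hasCompactSupport hψc (by simp)
  set K := Metric.cthickening 1 (tsupport ψ) with hK
  have hKc : IsCompact K := hψc.isCompact.cthickening
  have hsmall : ∀ᶠ t in 𝓝[>] (0 : ℝ), 0 < t ∧ t * ‖a‖ ≤ 1 := by
    have h1 : ∀ᶠ t in 𝓝 (0 : ℝ), t * ‖a‖ < 1 := by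
      have : Tendsto (fun t : ℝ => t * ‖a‖) (𝓝 0) (𝓝 (0 * ‖a‖)) := tendsto_id.mul_const _
      rw [zero_mul] at this
      exact this.eventually (gt_mem_nhds one_pos)
    filter_upwards [self_mem_nhdsWithin, nhdsWithin_le_nhds h1] with t h2 h3
    exact ⟨h2, h3.le⟩
  refine tendsto_integral_filter_of_dominated_convergence
    (K.indicator fun x => |u x| * (L * ‖a‖)) ?_ ?_ ?_ ?_
  · refine Eventually.of_forall fun t => hu.aestronglyMeasurable.mul ?_
    have := hψ.continuous
    exact Continuous.aestronglyMeasurable (by fun_prop)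
  · filter_upwards [hsmall] with t ht
    refine Eventually.of_forall fun x => ?_
    by_cases hx : x ∈ K
    · rw [indicator_of_mem hx, norm_mul, Real.norm_eq_abs]
      gcongr
      rw [norm_mul, norm_inv, Real.norm_of_nonneg ht.1.le]
      have h1 := hL.dist_le_mul x (x - t • a)
      rw [dist_self_sub_right, norm_smul, Real.norm_of_nonneg ht.1.le, dist_eq_norm] at h1
      rw [inv_mul_le_iff₀ ht.1]
      linarith
    · have h1 : ψ x = 0 := image_eq_zero_of_notMem_tsupport fun h =>
        hx (Metric.self_subset_cthickening _ h)
      have h2 : ψ (x - t • a) = 0 := image_eq_zero_of_notMem_tsupport fun h => by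
        refine hx (Metric.mem_cthickening_of_dist_le _ _ _ _ h ?_)
        rw [dist_self_sub_right, norm_smul, Real.norm_of_nonneg ht.1.le]
        exact ht.2
      simp [h1, h2, indicator_of_notMem hx]
  · rw [integrable_indicator_iff hKc.measurableSet]
    exact ((hu.integrableOn_isCompact hKc).abs).mul_const _
  · refine Eventually.of_forall fun x => Tendsto.const_mul _ ?_
    have h1 : HasDerivAt (fun t : ℝ => -ψ (x - t • a)) (fderiv ℝ ψ x a) 0 := by
      have h2 : HasDerivAt (fun t : ℝ => x - t • a) (-a) 0 := by
        simpa using ((hasDerivAt_id (0 : ℝ)).smul_const a).const_sub x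
      have h3 : HasFDerivAt ψ (fderiv ℝ ψ x) (x - (0 : ℝ) • a) := by
        simpa using (hψ.differentiable (by simp) x).hasFDerivAt
      have h4 := (h3.comp_hasDerivAt (0 : ℝ) h2).neg
      rw [map_neg, neg_neg] at h4
      exact h4
    have h4 := h1.tendsto_slope_zero_right
    refine h4.congr fun t => ?_
    simp only [zero_add, zero_smul, sub_zero, smul_eq_mul]
    ring

/-- A translation moves the difference quotient from `ψ` to `U`, where the segment inequality
applies in both directions. A second translation moves the shift of `N` back to `ψ`, at a cost of
order `t` on a compact set, which disappears as `t → 0`. -/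
theorem abs_integral_mul_fderiv_le_of_segment (hΩ : IsOpen Ω)
    {U N : EuclideanSpace ℝ (Fin n) → ℝ≥0∞}
    (hNm : Measurable N) (hUt : ∀ᵐ x, U x < ⊤) (hNt : ∀ᵐ x, N x < ⊤)
    (hu : LocallyIntegrable fun x => (U x).toReal) (hN : LocallyIntegrable fun x => (N x).toReal)
    (h : ∀ x a : EuclideanSpace ℝ (Fin n), ENNReal.ofReal (3 * ‖a‖) < Metric.infEDist x Ωᶜ →
      U x ≤ U (x + a) + 2 * ‖a‖ₑ * ∫⁻ s in Icc (0 : ℝ) 1, N (x + s • a))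
    {ψ : EuclideanSpace ℝ (Fin n) → ℝ} (hψ : IsTestFunction Ω ψ) (a : EuclideanSpace ℝ (Fin n)) :
    |∫ x, (U x).toReal * fderiv ℝ ψ x a| ≤ ‖a‖ * ∫ x, 2 * (N x).toReal * |ψ x| := by
  obtain ⟨hψs, hψc, hψΩ⟩ := hψ
  obtain ⟨L, hL⟩ := hψs.lipschitzWith_of_hasCompactSupport hψc (by simp)
  obtain ⟨δ, hδ, hδK⟩ := exists_le_infEDist_of_isCompact hΩ hψc.isCompact hψΩ
  set K := Metric.cthickening 1 (tsupport ψ) with hK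
  have hKc : IsCompact K := hψc.isCompact.cthickening
  set A : ℝ≥0∞ := ∫⁻ x, N x * ‖ψ x‖ₑ with hA
  set B : ℝ≥0∞ := ∫⁻ x in K, N x with hB
  have hNe : ∀ᵐ x, N x = ‖(N x).toReal‖ₑ := hNt.mono fun x hx => by
    rw [Real.enorm_of_nonneg ENNReal.toReal_nonneg, ENNReal.ofReal_toReal hx.ne]
  have hBt : B ≠ ⊤ := by
    have := (hN.integrableOn_isCompact hKc).2
    rw [HasFiniteIntegral] at this
    rw [hB, lintegral_congr_ae (ae_restrict_of_ae hNe)]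
    exact this.ne
  have hNψ : Integrable fun x => (N x).toReal * |ψ x| := by
    have := hN.integrable_smul_right_of_hasCompactSupport hψs.continuous.abs
      (hψc.comp_left (g := fun t : ℝ => |t|) abs_zero)
    simpa only [smul_eq_mul, mul_comm] using this
  have hAe : A = ENNReal.ofReal (∫ x, (N x).toReal * |ψ x|) := by
    rw [ofReal_integral_eq_lintegral_ofReal hNψ
      (Eventually.of_forall fun x => by positivity), hA]
    refine lintegral_congr_ae ?_
    filter_upwards [hNt] with x hx
    rw [ENNReal.ofReal_mul ENNReal.toReal_nonneg, ENNReal.ofReal_toReal hx.ne,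
      Real.enorm_eq_ofReal_abs]
  -- The segment inequality requires `3 ‖b‖` below the boundary distance, at `x` and also at `x +
  -- b`; the latter point may be closer to the boundary by `‖b‖`, hence the `4`.
  have hsmall : ∀ᶠ t in 𝓝[>] (0 : ℝ), 0 < t ∧ t * ‖a‖ ≤ 1 ∧ 4 * (t * ‖a‖) < δ := by
    have h1 : ∀ᶠ t in 𝓝 (0 : ℝ), t * ‖a‖ < min 1 (δ / 4) := by
      have : Tendsto (fun t : ℝ => t * ‖a‖) (𝓝 0) (𝓝 (0 * ‖a‖)) := tendsto_id.mul_const _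
      rw [zero_mul] at this
      exact this.eventually (gt_mem_nhds (by positivity))
    filter_upwards [self_mem_nhdsWithin, nhdsWithin_le_nhds h1] with t h2 h3
    have h4 := h3.trans_le (min_le_left _ _)
    have h5 := h3.trans_le (min_le_right _ _)
    exact ⟨h2, h4.le, by linarith⟩
  have huψ : ∀ {η : EuclideanSpace ℝ (Fin n) → ℝ}, Continuous η → HasCompactSupport η →
      Integrable fun x => (U x).toReal * η x := fun hη hηc => by
    simpa only [smul_eq_mul, mul_comm] using hu.integrable_smul_right_of_hasCompactSupport hη hηc
  have hbound : ∀ t : ℝ, 0 < t → t * ‖a‖ ≤ 1 → 4 * (t * ‖a‖) < δ →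
      ‖∫ x, (U x).toReal * (t⁻¹ * (ψ x - ψ (x - t • a)))‖ₑ ≤
        2 * ‖a‖ₑ * (A + ENNReal.ofReal (L * (t * ‖a‖)) * B) := by
    intro t ht ht1 htδ
    set b := t • a with hb
    have hbn : ‖b‖ = t * ‖a‖ := by rw [hb, norm_smul, Real.norm_of_nonneg ht.le]
    have hbe : ‖b‖ₑ = ENNReal.ofReal t * ‖a‖ₑ := by
      rw [hb, enorm_smul, Real.enorm_of_nonneg ht.le]
    have hψb : Continuous fun x => ψ (x - b) :=
      hψs.continuous.comp (continuous_id.sub continuous_const)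
    have hψbc : HasCompactSupport fun x => ψ (x - b) :=
      hψc.comp_homeomorph (Homeomorph.subRight b)
    have hub : Integrable fun x => (U (x + b)).toReal * ψ x := by
      have := (huψ hψb hψbc).comp_add_right b
      simpa using this
    have e1 : ∫ x, (U x).toReal * (t⁻¹ * (ψ x - ψ (x - b))) =
        t⁻¹ * ∫ x, ((U x).toReal - (U (x + b)).toReal) * ψ x := by
      have e2 : ∫ x, (U x).toReal * ψ (x - b) = ∫ x, (U (x + b)).toReal * ψ x := by
        rw [← integral_add_right_eq_self _ b]
        simp
      simp only [mul_left_comm _ t⁻¹, sub_mul, mul_sub]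
      rw [integral_sub ((huψ hψs.continuous hψc).const_mul _) ((huψ hψb hψbc).const_mul _),
        integral_const_mul, integral_const_mul, integral_sub (huψ hψs.continuous hψc) hub, e2]
      ring
    have hUb : ∀ᵐ x, U (x + b) < ⊤ :=
      (measurePreserving_add_right volume b).quasiMeasurePreserving.ae hUt
    have hpt : ∀ᵐ x, ‖((U x).toReal - (U (x + b)).toReal) * ψ x‖ₑ ≤
        2 * ‖b‖ₑ * ∫⁻ s in Icc (0 : ℝ) 1, N (x + s • b) * ‖ψ x‖ₑ := by
      filter_upwards [hUt, hUb] with x hx hxb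
      by_cases hxK : x ∈ tsupport ψ
      · rw [enorm_mul, lintegral_mul_const' _ _ enorm_ne_top, ← mul_assoc]
        gcongr
        have h4 : ENNReal.ofReal (3 * ‖b‖ + ‖b‖) < Metric.infEDist x Ωᶜ := by
          refine lt_of_lt_of_le ?_ (hδK x hxK)
          rw [ENNReal.ofReal_lt_ofReal_iff hδ, hbn]
          linarith
        refine enorm_toReal_sub_le hx.ne hxb.ne (h x b ?_) ?_
        · refine lt_of_le_of_lt (ENNReal.ofReal_le_ofReal ?_) h4
          linarith [norm_nonneg b]
        · have := h (x + b) (-b) (by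
            rw [norm_neg]
            exact lt_infEDist_add (by positivity) h4)
          rwa [lintegral_Icc_reverse, add_neg_cancel_right, enorm_neg] at this
      · simp [image_eq_zero_of_notMem_tsupport hxK]
    have hψm : Measurable fun x => ‖ψ x‖ₑ := hψs.continuous.enorm.measurable
    have hs : ∀ s ∈ Icc (0 : ℝ) 1, ∫⁻ x, N (x + s • b) * ‖ψ x‖ₑ ≤
        A + ENNReal.ofReal (L * (t * ‖a‖)) * B := by
      rintro s ⟨hs0, hs1⟩
      have hsb : ‖s • b‖ ≤ t * ‖a‖ := by
        rw [norm_smul, Real.norm_of_nonneg hs0, hbn]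
        exact mul_le_of_le_one_left (by positivity) hs1
      have e3 : ∫⁻ x, N (x + s • b) * ‖ψ x‖ₑ = ∫⁻ x, N x * ‖ψ (x - s • b)‖ₑ := by
        rw [← lintegral_add_right_eq_self (fun x => N x * ‖ψ (x - s • b)‖ₑ) (s • b)]
        simp
      rw [e3, hB, ← lintegral_const_mul' _ _ ENNReal.ofReal_ne_top,
        ← lintegral_indicator hKc.measurableSet, hA,
        ← lintegral_add_left (f := fun x => N x * ‖ψ x‖ₑ) (hNm.mul hψm)]
      refine lintegral_mono fun x => ?_
      by_cases hx : x ∈ K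
      · rw [indicator_of_mem hx, mul_comm (ENNReal.ofReal _), ← mul_add]
        gcongr
        have h1 : ‖ψ (x - s • b) - ψ x‖ₑ ≤ ENNReal.ofReal (L * (t * ‖a‖)) := by
          rw [← ofReal_norm]
          refine ENNReal.ofReal_le_ofReal ?_
          have := hL.dist_le_mul (x - s • b) x
          rw [dist_comm (x - s • b), dist_self_sub_right, dist_eq_norm] at this
          exact this.trans (by gcongr)
        calc ‖ψ (x - s • b)‖ₑ = ‖ψ x + (ψ (x - s • b) - ψ x)‖ₑ := by rw [add_sub_cancel]
          _ ≤ ‖ψ x‖ₑ + ‖ψ (x - s • b) - ψ x‖ₑ := enorm_add_le _ _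
          _ ≤ _ := by gcongr
      · have h2 : ψ (x - s • b) = 0 := image_eq_zero_of_notMem_tsupport fun h => by
          refine hx (Metric.mem_cthickening_of_dist_le _ _ _ _ h ?_)
          rw [dist_self_sub_right]
          exact hsb.trans ht1
        simp [h2]
    have hm : Measurable fun q : EuclideanSpace ℝ (Fin n) × ℝ => N (q.1 + q.2 • b) * ‖ψ q.1‖ₑ :=
      (hNm.comp (by fun_prop)).mul (hψm.comp measurable_fst)
    rw [e1, enorm_mul]
    calc ‖t⁻¹‖ₑ * ‖∫ x, ((U x).toReal - (U (x + b)).toReal) * ψ x‖ₑ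
        ≤ ‖t⁻¹‖ₑ * ∫⁻ x, 2 * ‖b‖ₑ * ∫⁻ s in Icc (0 : ℝ) 1, N (x + s • b) * ‖ψ x‖ₑ := by
          gcongr
          exact (enorm_integral_le_lintegral_enorm _).trans (lintegral_mono_ae hpt)
      _ = ‖t⁻¹‖ₑ * (2 * ‖b‖ₑ * ∫⁻ s in Icc (0 : ℝ) 1, ∫⁻ x, N (x + s • b) * ‖ψ x‖ₑ) := by
          rw [lintegral_const_mul' _ _ (by finiteness), lintegral_lintegral_swap hm.aemeasurable]
      _ ≤ ‖t⁻¹‖ₑ * (2 * ‖b‖ₑ * ∫⁻ _ in Icc (0 : ℝ) 1,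
            (A + ENNReal.ofReal (L * (t * ‖a‖)) * B)) := by
          gcongr ‖t⁻¹‖ₑ * (2 * ‖b‖ₑ * ?_)
          exact setLIntegral_mono' measurableSet_Icc hs
      _ = 2 * ‖a‖ₑ * (A + ENNReal.ofReal (L * (t * ‖a‖)) * B) := by
          have e4 : ‖t⁻¹‖ₑ * ENNReal.ofReal t = 1 := by
            rw [Real.enorm_of_nonneg (by positivity), ← ENNReal.ofReal_mul (by positivity),
              inv_mul_cancel₀ ht.ne', ENNReal.ofReal_one]
          rw [hbe, setLIntegral_const, Real.volume_Icc, sub_zero, ENNReal.ofReal_one, mul_one]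
          calc _ = (‖t⁻¹‖ₑ * ENNReal.ofReal t) *
                (2 * ‖a‖ₑ * (A + ENNReal.ofReal (L * (t * ‖a‖)) * B)) := by ring
            _ = _ := by rw [e4, one_mul]
  have hlim1 := (tendsto_integral_difference_quotient hu hψs hψc a).enorm
  have hlim2 : Tendsto (fun t : ℝ => 2 * ‖a‖ₑ * (A + ENNReal.ofReal (L * (t * ‖a‖)) * B))
      (𝓝[>] 0) (𝓝 (2 * ‖a‖ₑ * A)) := by
    have h1 : Tendsto (fun t : ℝ => L * (t * ‖a‖)) (𝓝[>] 0) (𝓝 0) := by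
      have : Tendsto (fun t : ℝ => L * (t * ‖a‖)) (𝓝 0) (𝓝 (L * (0 * ‖a‖))) :=
        (tendsto_id.mul_const _).const_mul _
      simp only [zero_mul, mul_zero] at this
      exact this.mono_left nhdsWithin_le_nhds
    have h2 := ENNReal.Tendsto.mul_const (b := B) (ENNReal.tendsto_ofReal h1) (Or.inr hBt)
    have h3 := ENNReal.Tendsto.const_mul (a := 2 * ‖a‖ₑ) (h2.const_add A)
      (Or.inr (by finiteness))
    simpa using h3
  have hfin := le_of_tendsto_of_tendsto hlim1 hlim2
    (hsmall.mono fun t ht => hbound t ht.1 ht.2.1 ht.2.2)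
  have e5 : ‖a‖ * ∫ x, 2 * (N x).toReal * |ψ x| = 2 * ‖a‖ * ∫ x, (N x).toReal * |ψ x| := by
    simp only [mul_assoc]
    rw [integral_const_mul]
    ring
  have hI0 : 0 ≤ ∫ x, (N x).toReal * |ψ x| := integral_nonneg fun x => by positivity
  rw [e5, ← ENNReal.ofReal_le_ofReal_iff (by positivity), ← Real.enorm_eq_ofReal_abs]
  refine hfin.trans (le_of_eq ?_)
  rw [hAe, ENNReal.ofReal_mul (by positivity), ENNReal.ofReal_mul (by norm_num), ofReal_norm,
    ENNReal.ofReal_ofNat]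

end SegmentInequality

/-! ### Boundedness on `W^{1,p}`. -/

section MaximalSobolev

variable {n : ℕ} {γ : ℝ} {Ω : Set (EuclideanSpace ℝ (Fin n))}

theorem localNewMaximal_eq_zero_of_notMem {f : EuclideanSpace ℝ (Fin n) → ℝ}
    {x : EuclideanSpace ℝ (Fin n)} (hx : x ∉ Ω) : localNewMaximal γ Ω f x = 0 := by
  have h : Metric.infEDist x Ωᶜ = 0 := Metric.infEDist_zero_of_mem hx
  simp [localNewMaximal, h]

/-- Off `Ω` no radius is admissible and the supremum is `0`, so the maximal function is its own
extension by zero. -/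
theorem locallyIntegrable_localNewMaximalReal {p : ℝ≥0∞} (hp1 : 1 ≤ p) (hΩ : MeasurableSet Ω)
    {f : EuclideanSpace ℝ (Fin n) → ℝ}
    (h : MemLp (localNewMaximalReal γ Ω f) p (volume.restrict Ω)) :
    LocallyIntegrable (localNewMaximalReal γ Ω f) := by
  rw [← memLp_indicator_iff_restrict hΩ] at h
  have e : Ω.indicator (localNewMaximalReal γ Ω f) = localNewMaximalReal γ Ω f := by
    refine indicator_eq_self.2 fun x hx => ?_
    by_contra hxΩ
    exact hx (by simp [localNewMaximalReal, localNewMaximal_eq_zero_of_notMem hxΩ])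
  rw [e] at h
  exact h.locallyIntegrable hp1

theorem exists_hasWeakGradient_localNewMaximalReal (hn : 1 ≤ n) (hγ : 0 ≤ γ) (hΩ : IsOpen Ω)
    {p : ℝ≥0∞} (hp1 : 1 < p) (hp : p < ⊤) {f : EuclideanSpace ℝ (Fin n) → ℝ}
    {g : EuclideanSpace ℝ (Fin n) → EuclideanSpace ℝ (Fin n)} (h : HasWeakGradient Ω f g)
    (hf : MemLp f p (volume.restrict Ω)) (hg : MemLp g p (volume.restrict Ω)) :
    ∃ G, HasWeakGradient Ω (localNewMaximalReal γ Ω f) G ∧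
      ∀ᵐ x ∂volume.restrict Ω, ‖G x‖ ≤ 2 * localNewMaximalReal γ Ω (fun y => ‖g y‖) x := by
  obtain ⟨C, -, hC⟩ := exists_localNewMaximal_bound hn hγ hΩ.measurableSet hp1 hp
  obtain ⟨hUt, hU, -⟩ := hC f hf
  obtain ⟨hNt, hN, -⟩ := hC _ hg.norm
  have hNm := (lowerSemicontinuous_localNewMaximal hγ Ω (fun y => ‖g y‖)).measurable
  have hu := locallyIntegrable_localNewMaximalReal hp1.le hΩ.measurableSet hU
  have hN' := locallyIntegrable_localNewMaximalReal hp1.le hΩ.measurableSet hN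
  refine exists_hasWeakGradient_of_abs_integral_le hp1.le hp.ne hΩ (hu.locallyIntegrableOn Ω)
    (hNm.ennreal_toReal.const_mul 2) (fun x => mul_nonneg zero_le_two ENNReal.toReal_nonneg)
    (hN.const_mul 2) fun ψ hψ a => ?_
  have key := abs_integral_mul_fderiv_le_of_segment hΩ hNm hUt hNt hu hN'
    (fun x a hxa => localNewMaximal_le_add_segment hγ hΩ hp1.le hp.ne h hf hg hxa) hψ a
  have e1 : ∫ x in Ω, localNewMaximalReal γ Ω f x * fderiv ℝ ψ x a =
      ∫ x, (localNewMaximal γ Ω f x).toReal * fderiv ℝ ψ x a :=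
    setIntegral_eq_integral_of_test (hψ.fderiv_apply a)
  have e2 : ∫ x in Ω, 2 * localNewMaximalReal γ Ω (fun y => ‖g y‖) x * |ψ x| =
      ∫ x, 2 * (localNewMaximal γ Ω (fun y => ‖g y‖) x).toReal * |ψ x| := by
    refine setIntegral_eq_integral_of_forall_compl_eq_zero fun x hx => ?_
    simp [localNewMaximalReal, localNewMaximal_eq_zero_of_notMem hx]
  rw [e1, e2]
  exact key

theorem exists_sobolev_bound (hn : 1 ≤ n) (hγ : 0 ≤ γ) (hΩ : IsOpen Ω)
    {p : ℝ≥0∞} (hp1 : 1 < p) (hp : p < ⊤) :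
    ∃ C : ℝ, 0 < C ∧ ∀ f : EuclideanSpace ℝ (Fin n) → ℝ, MemSobolev p Ω f →
      MemSobolev p Ω (localNewMaximalReal γ Ω f) ∧
      sobolevNorm p Ω (localNewMaximalReal γ Ω f) ≤ ENNReal.ofReal C * sobolevNorm p Ω f := by
  obtain ⟨C, hC0, hC⟩ := exists_localNewMaximal_bound hn hγ hΩ.measurableSet hp1 hp
  refine ⟨2 * C, by positivity, fun f hf => ?_⟩
  have hg := hasWeakGradient_weakGradient hf.2.1
  obtain ⟨-, hU, hUle⟩ := hC f hf.1
  obtain ⟨-, hN, hNle⟩ := hC _ hf.2.2.norm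
  rw [eLpNorm_norm] at hNle
  obtain ⟨G, hG, hGle⟩ := exists_hasWeakGradient_localNewMaximalReal hn hγ hΩ hp1 hp hg hf.1 hf.2.2
  have hGle' : ∀ᵐ x ∂volume.restrict Ω, ‖G x‖ ≤
      2 * ‖localNewMaximalReal γ Ω (fun y => ‖weakGradient Ω f y‖) x‖ := by
    filter_upwards [hGle] with x hx
    exact hx.trans (by gcongr; exact Real.le_norm_self _)
  have hGp : MemLp G p (volume.restrict Ω) := hN.of_le_mul hG.2.1.aestronglyMeasurable hGle'
  refine ⟨hG.memSobolev hΩ hU hGp, ?_⟩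
  rw [hG.sobolevNorm_eq hΩ, sobolevNorm, mul_add]
  refine add_le_add (hUle.trans ?_) ((eLpNorm_le_mul_eLpNorm_of_ae_le_mul hGle' p).trans ?_)
  · gcongr
    linarith
  · rw [ENNReal.ofReal_mul zero_le_two, mul_assoc]
    gcongr

end MaximalSobolev

/-! ### Cutoffs adapted to the boundary distance. -/

section Cutoffs

variable {n : ℕ} {Ω : Set (EuclideanSpace ℝ (Fin n))}

/-- A Lipschitz function with values in `[0, 1]` can be smoothed at scale `r` without increasing
the Lipschitz constant; the smoothing agrees with it wherever it is constant on a ball of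
radius `r`. -/
theorem LipschitzWith.exists_smoothing {n : ℕ} {θ : EuclideanSpace ℝ (Fin n) → ℝ} {K : NNReal}
    (hθ : LipschitzWith K θ) (h0 : ∀ x, 0 ≤ θ x) (h1 : ∀ x, θ x ≤ 1) {r : ℝ} (hr : 0 < r) :
    ∃ α : EuclideanSpace ℝ (Fin n) → ℝ, ContDiff ℝ ∞ α ∧ LipschitzWith K α ∧
      (∀ x, 0 ≤ α x) ∧ (∀ x, α x ≤ 1) ∧
      ∀ x, (∀ y ∈ Metric.ball x r, θ y = θ x) → α x = θ x := by
  let φ : ContDiffBump (0 : EuclideanSpace ℝ (Fin n)) := ⟨r / 2, r, by positivity, by linarith⟩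
  have hφc : Continuous (φ.normed volume) := φ.continuous_normed
  have hφi : Integrable (φ.normed volume) :=
    hφc.integrable_of_hasCompactSupport φ.hasCompactSupport_normed
  have hint : ∀ x, Integrable fun t => φ.normed volume t * θ (x - t) := fun x =>
    hφi.mul_bdd (c := 1)
      (hθ.continuous.comp (continuous_const.sub continuous_id)).aestronglyMeasurable
      (Eventually.of_forall fun t => by
        rw [Real.norm_of_nonneg (h0 _)]
        exact h1 _)
  have hα : ∀ x, (φ.normed volume ⋆[ContinuousLinearMap.lsmul ℝ ℝ, volume] θ) x =
      ∫ t, φ.normed volume t * θ (x - t) := fun x => rfl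
  refine ⟨φ.normed volume ⋆[ContinuousLinearMap.lsmul ℝ ℝ, volume] θ,
    φ.hasCompactSupport_normed.contDiff_convolution_left _ φ.contDiff_normed
      hθ.continuous.locallyIntegrable, ?_, fun x => ?_, fun x => ?_,
    fun x hx => φ.normed_convolution_eq_right hx⟩
  · refine LipschitzWith.of_dist_le_mul fun x y => ?_
    rw [dist_eq_norm, hα, hα, ← integral_sub (hint x) (hint y)]
    have h2 : ∫ t, φ.normed volume t * (K * dist x y) = K * dist x y := by
      rw [integral_mul_const, φ.integral_normed, one_mul]
    rw [← h2]
    refine norm_integral_le_of_norm_le (hφi.mul_const _) (Eventually.of_forall fun t => ?_)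
    rw [← mul_sub, norm_mul, Real.norm_of_nonneg (φ.nonneg_normed t), ← dist_eq_norm]
    refine mul_le_mul_of_nonneg_left ?_ (φ.nonneg_normed t)
    simpa using hθ.dist_le_mul (x - t) (y - t)
  · rw [hα]
    exact integral_nonneg fun t => mul_nonneg (φ.nonneg_normed t) (h0 _)
  · rw [hα, ← φ.integral_normed (μ := volume)]
    exact integral_mono (hint x) hφi fun t =>
      mul_le_of_le_one_right (φ.nonneg_normed t) (h1 _)

/-- The distance to the complement of `Ω`, truncated at `1`. -/
noncomputable def boundaryDist (Ω : Set (EuclideanSpace ℝ (Fin n)))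
    (x : EuclideanSpace ℝ (Fin n)) : ℝ :=
  (min (Metric.infEDist x Ωᶜ) 1).toReal

theorem boundaryDist_nonneg (x : EuclideanSpace ℝ (Fin n)) : 0 ≤ boundaryDist Ω x :=
  ENNReal.toReal_nonneg

theorem ofReal_boundaryDist (x : EuclideanSpace ℝ (Fin n)) :
    ENNReal.ofReal (boundaryDist Ω x) = min (Metric.infEDist x Ωᶜ) 1 :=
  ENNReal.ofReal_toReal (min_le_right _ _ |>.trans_lt ENNReal.one_lt_top).ne

theorem boundaryDist_le_one (x : EuclideanSpace ℝ (Fin n)) : boundaryDist Ω x ≤ 1 := by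
  rw [← ENNReal.ofReal_le_one, ofReal_boundaryDist]
  exact min_le_right _ _

theorem boundaryDist_pos (hΩ : IsOpen Ω) {x : EuclideanSpace ℝ (Fin n)} (hx : x ∈ Ω) :
    0 < boundaryDist Ω x := by
  rw [← ENNReal.ofReal_pos, ofReal_boundaryDist, lt_min_iff]
  refine ⟨pos_iff_ne_zero.2 fun h => ?_, one_pos⟩
  rw [← Metric.mem_closure_iff_infEDist_zero, hΩ.isClosed_compl.closure_eq] at h
  exact h hx

theorem mem_of_boundaryDist_pos {x : EuclideanSpace ℝ (Fin n)} (hx : 0 < boundaryDist Ω x) :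
    x ∈ Ω := by
  by_contra h
  have h0 : Metric.infEDist x Ωᶜ = 0 := Metric.infEDist_zero_of_mem h
  simp [boundaryDist, h0] at hx

theorem lipschitzWith_boundaryDist : LipschitzWith 1 (boundaryDist Ω) := by
  have h : ∀ x y, min (Metric.infEDist x Ωᶜ) 1 ≤ min (Metric.infEDist y Ωᶜ) 1 + edist x y := by
    intro x y
    rw [min_add]
    exact min_le_min Metric.infEDist_le_infEDist_add_edist le_self_add
  refine LipschitzWith.of_edist_le fun x y => ?_
  rw [edist_eq_enorm_sub]
  refine enorm_toReal_sub_le (min_le_right _ _ |>.trans_lt ENNReal.one_lt_top).ne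
    (min_le_right _ _ |>.trans_lt ENNReal.one_lt_top).ne (h x y) ?_
  rw [edist_comm]
  exact h y x

/-- With `d` the truncated boundary distance, `θ` is a ramp from `0` at `m d = 1` to `1` at `m d =
2`. Smoothing at scale `1 / (2 m)` sees changes of `m d` of at most `1 / 2`, so the plateaus survive
where `m d ≤ 1 / 2` and where `m d ≥ 3`. -/
theorem exists_boundary_cutoff {m : ℝ} (hm : 0 < m) :
    ∃ α : EuclideanSpace ℝ (Fin n) → ℝ, ContDiff ℝ ∞ α ∧ (∀ x, 0 ≤ α x) ∧ (∀ x, α x ≤ 1) ∧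
      (∀ x, ‖fderiv ℝ α x‖ ≤ m) ∧ (∀ x, 3 ≤ m * boundaryDist Ω x → α x = 1) ∧
      ∀ x, m * boundaryDist Ω x ≤ 1 / 2 → α x = 0 := by
  let θ : EuclideanSpace ℝ (Fin n) → ℝ := fun x => max 0 (min 1 (m * boundaryDist Ω x - 1))
  have hθL : LipschitzWith m.toNNReal θ := by
    have h1 : LipschitzWith m.toNNReal fun x => m * boundaryDist Ω x - 1 := by
      refine LipschitzWith.of_dist_le_mul fun x y => ?_
      have := (lipschitzWith_boundaryDist (Ω := Ω)).dist_le_mul x y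
      rw [NNReal.coe_one, one_mul] at this
      rw [Real.dist_eq, sub_sub_sub_cancel_right, ← mul_sub, abs_mul, abs_of_pos hm,
        Real.coe_toNNReal _ hm.le, ← Real.dist_eq]
      gcongr
    exact (h1.const_min 1).const_max 0
  have hd : ∀ x, ∀ y ∈ Metric.ball x (1 / (2 * m)),
      |m * boundaryDist Ω y - m * boundaryDist Ω x| ≤ 1 / 2 := by
    intro x y hy
    have := (lipschitzWith_boundaryDist (Ω := Ω)).dist_le_mul y x
    rw [NNReal.coe_one, one_mul, Real.dist_eq] at this
    rw [← mul_sub, abs_mul, abs_of_pos hm]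
    calc m * |boundaryDist Ω y - boundaryDist Ω x| ≤ m * (1 / (2 * m)) := by
          gcongr
          exact this.trans (Metric.mem_ball.1 hy).le
      _ = 1 / 2 := by field_simp
  obtain ⟨α, hα, hαL, h0, h1, heq⟩ := hθL.exists_smoothing (fun x => le_max_left _ _)
    (fun x => max_le zero_le_one (min_le_left _ _)) (r := 1 / (2 * m)) (by positivity)
  have hθ1 : ∀ x, 2 ≤ m * boundaryDist Ω x → θ x = 1 := fun x hx => by
    simp only [θ]
    rw [min_eq_left (by linarith), max_eq_right zero_le_one]
  have hθ0 : ∀ x, m * boundaryDist Ω x ≤ 1 → θ x = 0 := fun x hx =>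
    max_eq_left ((min_le_right _ _).trans (by linarith))
  refine ⟨α, hα, h0, h1, fun x => ?_, fun x hx => ?_, fun x hx => ?_⟩
  · have := norm_fderiv_le_of_lipschitz ℝ hαL (x₀ := x)
    rwa [Real.coe_toNNReal _ hm.le] at this
  · rw [heq x fun y hy => ?_, hθ1 x (by linarith)]
    rw [hθ1 x (by linarith), hθ1 y]
    linarith [(abs_le.1 (hd x y hy)).1]
  · rw [heq x fun y hy => ?_, hθ0 x (by linarith)]
    rw [hθ0 x (by linarith), hθ0 y]
    linarith [(abs_le.1 (hd x y hy)).2]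

/-- The cutoff is `α β`, with `α` at the boundary and `β` a dilated bump at infinity. The gradient
of `α` is at most `m` and vanishes where `m d > 3`, so `d |∇α| ≤ 3` uniformly in `m`; `d |∇β| ≤ L`
because `d ≤ 1` and dilation by `m ≥ 1` does not increase the Lipschitz constant. -/
theorem exists_test_cutoff : ∃ C : ℝ, 0 ≤ C ∧ ∀ m : ℝ, 1 ≤ m →
    ∃ χ : EuclideanSpace ℝ (Fin n) → ℝ, IsTestFunction Ω χ ∧ (∀ x, ‖χ x‖ ≤ 1) ∧
      (∀ x, 3 < m * boundaryDist Ω x → ‖x‖ < m → χ =ᶠ[𝓝 x] fun _ => 1) ∧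
      ∀ x, boundaryDist Ω x * ‖gradient χ x‖ ≤ C := by
  let b : ContDiffBump (0 : EuclideanSpace ℝ (Fin n)) := ⟨1, 2, one_pos, one_lt_two⟩
  obtain ⟨L, hL⟩ := (b.contDiff (n := 1)).lipschitzWith_of_hasCompactSupport
    b.hasCompactSupport (by simp)
  refine ⟨3 + L, by positivity, fun m hm => ?_⟩
  have hm0 : 0 < m := by linarith
  obtain ⟨α, hα, hα0, hα1, hαd, hαone, hαzero⟩ := exists_boundary_cutoff (Ω := Ω) hm0
  let β : EuclideanSpace ℝ (Fin n) → ℝ := fun x => b (m⁻¹ • x)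
  have hβ : ContDiff ℝ ∞ β := b.contDiff.comp (contDiff_const_smul _)
  have hβ0 : ∀ x, 0 ≤ β x := fun x => b.nonneg
  have hβ1 : ∀ x, β x ≤ 1 := fun x => b.le_one
  have hβd : ∀ x, ‖fderiv ℝ β x‖ ≤ L := by
    intro x
    refine norm_fderiv_le_of_lipschitz ℝ (LipschitzWith.of_dist_le_mul fun y z => ?_)
    refine (hL.dist_le_mul _ _).trans ?_
    gcongr
    rw [dist_smul₀, norm_inv, Real.norm_of_nonneg hm0.le]
    exact mul_le_of_le_one_left dist_nonneg (inv_le_one_of_one_le₀ hm)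
  have hβone : ∀ x, ‖x‖ ≤ m → β x = 1 := fun x hx => by
    refine b.one_of_mem_closedBall ?_
    rw [mem_closedBall_zero_iff, norm_smul, norm_inv, Real.norm_of_nonneg hm0.le]
    change _ ≤ (1 : ℝ)
    rw [inv_mul_le_iff₀ hm0]
    linarith
  have hβzero : ∀ x, 2 * m < ‖x‖ → β x = 0 := fun x hx => by
    refine b.zero_of_le_dist ?_
    rw [dist_zero_right, norm_smul, norm_inv, Real.norm_of_nonneg hm0.le]
    change (2 : ℝ) ≤ _
    rw [le_inv_mul_iff₀ hm0]
    linarith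
  have hdc : Continuous fun x => m * boundaryDist Ω x :=
    continuous_const.mul lipschitzWith_boundaryDist.continuous
  have hsupp : tsupport (fun x => α x * β x) ⊆
      Metric.closedBall 0 (2 * m) ∩ {x | 1 / 2 ≤ m * boundaryDist Ω x} := by
    refine closure_minimal (fun x hx => ?_)
      (Metric.isClosed_closedBall.inter (isClosed_le continuous_const hdc))
    rw [Function.mem_support] at hx
    constructor
    · by_contra hc
      rw [mem_closedBall_zero_iff, not_le] at hc
      exact hx (by rw [hβzero x hc, mul_zero])
    · by_contra hc
      exact hx (by rw [hαzero x (not_le.1 hc).le, zero_mul])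
  refine ⟨fun x => α x * β x, ⟨hα.mul hβ, ?_, fun x hx => ?_⟩, fun x => ?_, fun x hx hxm => ?_,
    fun x => ?_⟩
  · exact (isCompact_closedBall (0 : EuclideanSpace ℝ (Fin n)) (2 * m)).of_isClosed_subset
      (isClosed_tsupport _) (hsupp.trans inter_subset_left)
  · have h2 : 1 / 2 ≤ m * boundaryDist Ω x := (hsupp hx).2
    exact mem_of_boundaryDist_pos (pos_of_mul_pos_right (by linarith) hm0.le)
  · rw [Real.norm_of_nonneg (mul_nonneg (hα0 x) (hβ0 x))]
    exact mul_le_one₀ (hα1 x) (hβ0 x) (hβ1 x)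
  · filter_upwards [(isOpen_lt continuous_const hdc).mem_nhds hx,
      (isOpen_lt continuous_norm continuous_const).mem_nhds hxm] with y hy hym
    rw [hαone y (le_of_lt hy), hβone y (le_of_lt hym), mul_one]
  · have hαdd : boundaryDist Ω x * ‖fderiv ℝ α x‖ ≤ 3 := by
      rcases le_or_gt (m * boundaryDist Ω x) 3 with h | h
      · calc boundaryDist Ω x * ‖fderiv ℝ α x‖ ≤ boundaryDist Ω x * m :=
              mul_le_mul_of_nonneg_left (hαd x) (boundaryDist_nonneg x)
          _ ≤ 3 := by rwa [mul_comm]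
      · have : α =ᶠ[𝓝 x] fun _ => 1 := by
          filter_upwards [(isOpen_lt continuous_const hdc).mem_nhds h] with y hy
          exact hαone y (le_of_lt hy)
        rw [this.fderiv_eq]
        simp
    rw [norm_gradient, fderiv_fun_mul (hα.differentiable (by simp) x)
      (hβ.differentiable (by simp) x)]
    have h1 : ‖α x • fderiv ℝ β x‖ ≤ L := by
      rw [norm_smul, Real.norm_of_nonneg (hα0 x)]
      exact (mul_le_of_le_one_left (norm_nonneg _) (hα1 x)).trans (hβd x)
    have h2 : ‖β x • fderiv ℝ α x‖ ≤ ‖fderiv ℝ α x‖ := by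
      rw [norm_smul, Real.norm_of_nonneg (hβ0 x)]
      exact mul_le_of_le_one_left (norm_nonneg _) (hβ1 x)
    have h3 := mul_le_mul_of_nonneg_left ((norm_add_le _ _).trans (add_le_add h1 h2))
      (boundaryDist_nonneg (Ω := Ω) x)
    have h4 : boundaryDist Ω x * L ≤ L :=
      mul_le_of_le_one_left L.2 (boundaryDist_le_one x)
    rw [mul_add] at h3
    linarith

end Cutoffs

/-! ### Preservation of `W_0^{1,p}`. -/

section ZeroBoundary

variable {n : ℕ} {γ : ℝ} {Ω : Set (EuclideanSpace ℝ (Fin n))}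

/-- Dominated convergence in `L^p`. -/
theorem tendsto_eLpNorm_zero_of_dominated {α F : Type*} [MeasurableSpace α] {μ : Measure α}
    [NormedAddCommGroup F] {p : ℝ≥0∞} (hp0 : p ≠ 0) (hp : p ≠ ⊤) {f : ℕ → α → F} {H : α → ℝ}
    (hf : ∀ k, AEStronglyMeasurable (f k) μ) (hH : MemLp H p μ)
    (hb : ∀ k, ∀ᵐ x ∂μ, ‖f k x‖ ≤ H x)
    (hlim : ∀ᵐ x ∂μ, Tendsto (fun k => f k x) atTop (𝓝 0)) :
    Tendsto (fun k => eLpNorm (f k) p μ) atTop (𝓝 0) := by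
  have hp' : 0 < p.toReal := ENNReal.toReal_pos hp0 hp
  have key : Tendsto (fun k => ∫⁻ x, ‖f k x‖ₑ ^ p.toReal ∂μ) atTop (𝓝 (∫⁻ _, 0 ∂μ)) := by
    refine tendsto_lintegral_of_dominated_convergence' (fun x => ‖H x‖ₑ ^ p.toReal)
      (fun k => (hf k).enorm.pow_const _) (fun k => ?_)
      (lintegral_rpow_enorm_lt_top_of_eLpNorm_lt_top hp0 hp hH.2).ne ?_
    · filter_upwards [hb k] with x hx
      gcongr
      exact enorm_le_iff_norm_le.2 (hx.trans (Real.le_norm_self _))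
    · filter_upwards [hlim] with x hx
      have := (hx.enorm).ennrpow_const p.toReal
      simpa [ENNReal.zero_rpow_of_pos hp'] using this
  have h2 := key.ennrpow_const (1 / p.toReal)
  simp only [lintegral_zero] at h2
  rw [ENNReal.zero_rpow_of_pos (by positivity)] at h2
  simpa only [eLpNorm_eq_lintegral_rpow_enorm_toReal hp0 hp] using h2

/-- A function in `W^{1,p}` that is dominated by the distance to the boundary times an `L^p`
function is in `W_0^{1,p}`. -/
theorem HasWeakGradient.memSobolevZero_of_le {p : ℝ≥0∞} (hΩ : IsOpen Ω) (hp1 : 1 ≤ p)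
    (hp : p ≠ ⊤) {w : EuclideanSpace ℝ (Fin n) → ℝ}
    {g : EuclideanSpace ℝ (Fin n) → EuclideanSpace ℝ (Fin n)} (h : HasWeakGradient Ω w g)
    (hw : MemLp w p (volume.restrict Ω)) (hg : MemLp g p (volume.restrict Ω))
    {G : EuclideanSpace ℝ (Fin n) → ℝ} (hG : MemLp G p (volume.restrict Ω))
    (hwG : ∀ᵐ x ∂volume.restrict Ω, ‖w x‖ ≤ boundaryDist Ω x * G x) : MemSobolevZero p Ω w := by
  refine ⟨h.memSobolev hΩ hw hg, fun ε hε => ?_⟩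
  obtain ⟨δ, hδ, hδε⟩ := exists_between hε
  -- Four errors: cutting off and mollifying, each for the function and for its gradient.
  have hη : 0 < δ / 4 := ENNReal.div_pos hδ.ne' (by simp)
  have hp0 : p ≠ 0 := (zero_lt_one.trans_le hp1).ne'
  obtain ⟨C, hC, hcut⟩ := exists_test_cutoff (n := n) (Ω := Ω)
  choose χ hχ hχ1 hχone hχd using fun k : ℕ => hcut (k + 1) (by simp)
  have hev : ∀ x ∈ Ω, ∀ᶠ k in atTop, χ k =ᶠ[𝓝 x] fun _ => 1 := by
    intro x hx
    have hm : Tendsto (fun k : ℕ => (k : ℝ) + 1) atTop atTop :=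
      tendsto_atTop_add_const_right _ _ tendsto_natCast_atTop_atTop
    filter_upwards [(hm.atTop_mul_const (boundaryDist_pos hΩ hx)).eventually_gt_atTop 3,
      hm.eventually_gt_atTop ‖x‖] with k h1 h2
    exact hχone k x h1 h2
  have mA : ∀ k, AEStronglyMeasurable (fun x => χ k x * w x) (volume.restrict Ω) := fun k =>
    (hχ k).1.continuous.aestronglyMeasurable.mul hw.1
  have mB : ∀ k, AEStronglyMeasurable (fun x => χ k x • g x + w x • gradient (χ k) x)
      (volume.restrict Ω) := fun k =>
    ((hχ k).1.continuous.aestronglyMeasurable.smul hg.1).add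
      (hw.1.smul (continuous_gradient (hχ k).1).aestronglyMeasurable)
  have hA : Tendsto (fun k => eLpNorm (fun x => χ k x * w x - w x) p (volume.restrict Ω)) atTop
      (𝓝 0) := by
    refine tendsto_eLpNorm_zero_of_dominated hp0 hp (fun k => (mA k).sub hw.1)
      (hw.norm.const_mul 2) (fun k => Eventually.of_forall fun x => ?_) ?_
    · refine (norm_sub_le _ _).trans ?_
      rw [norm_mul, two_mul]
      gcongr
      exact mul_le_of_le_one_left (norm_nonneg _) (hχ1 k x)
    · filter_upwards [ae_restrict_mem hΩ.measurableSet] with x hx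
      refine tendsto_const_nhds.congr' ?_
      filter_upwards [hev x hx] with k hk
      rw [hk.eq_of_nhds, one_mul, sub_self]
  -- The dangerous term is dominated through the hypothesis on `w`: `|w ∇χ_k| ≤ d |G| |∇χ_k| ≤ C
  -- |G|`. It tends to `0` pointwise, since each point of `Ω` eventually has a neighbourhood where
  -- `χ_k = 1`.
  have hB : Tendsto (fun k => eLpNorm (fun x => χ k x • g x + w x • gradient (χ k) x - g x) p
      (volume.restrict Ω)) atTop (𝓝 0) := by
    refine tendsto_eLpNorm_zero_of_dominated hp0 hp (fun k => (mB k).sub hg.1)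
      ((hg.norm.const_mul 2).add (hG.norm.const_mul C)) (fun k => ?_) ?_
    · filter_upwards [hwG] with x hx
      have h1 : ‖χ k x • g x‖ ≤ ‖g x‖ := by
        rw [norm_smul]
        exact mul_le_of_le_one_left (norm_nonneg _) (hχ1 k x)
      have h2 : ‖w x • gradient (χ k) x‖ ≤ C * ‖G x‖ := by
        rw [norm_smul]
        calc ‖w x‖ * ‖gradient (χ k) x‖
            ≤ (boundaryDist Ω x * ‖G x‖) * ‖gradient (χ k) x‖ := by
              gcongr
              refine hx.trans ?_
              gcongr
              · exact boundaryDist_nonneg x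
              · exact Real.le_norm_self _
          _ = (boundaryDist Ω x * ‖gradient (χ k) x‖) * ‖G x‖ := by ring
          _ ≤ C * ‖G x‖ := by
              gcongr
              exact hχd k x
      refine (norm_sub_le _ _).trans ((add_le_add (norm_add_le _ _) le_rfl).trans ?_)
      simp only [Pi.add_apply]
      linarith
    · filter_upwards [ae_restrict_mem hΩ.measurableSet] with x hx
      refine tendsto_const_nhds.congr' ?_
      filter_upwards [hev x hx] with k hk
      have : gradient (χ k) x = 0 := by
        rw [← norm_eq_zero, norm_gradient, hk.fderiv_eq]
        simp
      rw [hk.eq_of_nhds, this, one_smul, smul_zero, add_zero, sub_self]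
  obtain ⟨k, hkA, hkB⟩ :=
    ((hA.eventually_le_const hη).and (hB.eventually_le_const hη)).exists
  obtain ⟨ψ, hψ, hψ1, hψ2⟩ := h.exists_test_approx hΩ hp1 hp hw hg (hχ k) hη
  refine ⟨ψ, hψ, lt_of_le_of_lt ?_ hδε⟩
  have hψg := hasWeakGradient_gradient (Ω := Ω) hψ.1
  rw [(h.sub hψg).sobolevNorm_eq hΩ]
  have e1 : eLpNorm (fun x => w x - ψ x) p (volume.restrict Ω) ≤ δ / 4 + δ / 4 := by
    have := eLpNorm_add_le (p := p)
      ((hψ.1.continuous.aestronglyMeasurable (μ := volume.restrict Ω)).sub (mA k))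
      ((mA k).sub hw.1) hp1
    have e : (fun x => w x - ψ x) = -(((ψ - fun x => χ k x * w x)) +
        ((fun x => χ k x * w x) - w)) := by
      ext x
      simp
    rw [e, eLpNorm_neg]
    exact this.trans (add_le_add
      ((eLpNorm_mono_measure _ Measure.restrict_le_self).trans hψ1) hkA)
  have e2 : eLpNorm (fun x => g x - gradient ψ x) p (volume.restrict Ω) ≤ δ / 4 + δ / 4 := by
    have := eLpNorm_add_le (p := p)
      (((continuous_gradient hψ.1).aestronglyMeasurable (μ := volume.restrict Ω)).sub (mB k))
      ((mB k).sub hg.1) hp1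
    have e : (fun x => g x - gradient ψ x) =
        -(((gradient ψ - fun x => χ k x • g x + w x • gradient (χ k) x)) +
        ((fun x => χ k x • g x + w x • gradient (χ k) x) - g)) := by
      ext1 x
      simp
    rw [e, eLpNorm_neg]
    exact this.trans (add_le_add
      ((eLpNorm_mono_measure _ Measure.restrict_le_self).trans hψ2) hkB)
  calc _ ≤ (δ / 4 + δ / 4) + (δ / 4 + δ / 4) := add_le_add e1 e2
    _ = 4 * (δ / 4) := by ring
    _ = δ := ENNReal.mul_div_cancel (by simp) (by simp)

theorem localNewMaximal_le_add (hγ : 0 ≤ γ) {u v ψ : EuclideanSpace ℝ (Fin n) → ℝ}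
    (hψ : Continuous ψ) (h : ∀ y, ‖u y‖ₑ ≤ ‖v y‖ₑ + ‖ψ y‖ₑ) (x : EuclideanSpace ℝ (Fin n)) :
    localNewMaximal γ Ω u x ≤ localNewMaximal γ Ω v x + localNewMaximal γ Ω ψ x := by
  refine localNewMaximal_le hγ fun r hr hx => ?_
  rw [mul_add]
  calc unitBallIntegral (‖u ·‖ₑ) x r
      ≤ ∫⁻ z in Metric.ball 0 1, (‖v (x + r • z)‖ₑ + ‖ψ (x + r • z)‖ₑ) :=
        lintegral_mono fun z => h _
    _ = unitBallIntegral (‖v ·‖ₑ) x r + unitBallIntegral (‖ψ ·‖ₑ) x r :=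
        lintegral_add_right _
          ((hψ.comp (continuous_const.add (continuous_const_smul r))).measurable.enorm)
    _ ≤ _ := add_le_add (unitBallIntegral_le_maximalWeight_mul hγ v hr hx)
        (unitBallIntegral_le_maximalWeight_mul hγ ψ hr hx)

/-- The maximal function of a test function is dominated by the distance to the boundary. -/
theorem IsTestFunction.exists_localNewMaximalReal_le (hn : 1 ≤ n) (hγ : 0 ≤ γ) (hΩ : IsOpen Ω)
    {p : ℝ≥0∞} (hp1 : 1 < p) (hp : p < ⊤) {ψ : EuclideanSpace ℝ (Fin n) → ℝ}
    (hψ : IsTestFunction Ω ψ) :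
    ∃ G : EuclideanSpace ℝ (Fin n) → ℝ, MemLp G p (volume.restrict Ω) ∧
      ∀ᵐ x ∂volume.restrict Ω, localNewMaximalReal γ Ω ψ x ≤ boundaryDist Ω x * G x := by
  obtain ⟨C, -, hC⟩ := exists_localNewMaximal_bound hn hγ hΩ.measurableSet hp1 hp
  have hψp : MemLp ψ p (volume.restrict Ω) :=
    (hψ.1.continuous.memLp_of_hasCompactSupport hψ.2.1).restrict Ω
  have hgp : MemLp (gradient ψ) p (volume.restrict Ω) :=
    ((continuous_gradient hψ.1).memLp_of_hasCompactSupport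
      (hψ.2.1.of_isClosed_subset (isClosed_tsupport _) (tsupport_gradient_subset ψ))).restrict Ω
  obtain ⟨hUt, hU, -⟩ := hC ψ hψp
  obtain ⟨hNt, hN, -⟩ := hC _ hgp.norm
  obtain ⟨δ, hδ, hδK⟩ := exists_le_infEDist_of_isCompact hΩ hψ.2.1.isCompact hψ.2.2
  set c := min δ 1 with hc
  have hc0 : 0 < c := lt_min hδ one_pos
  -- The second summand serves the points at truncated distance at least `c` from the boundary; the
  -- first serves the points closer to it, which lie off the support of `ψ`.
  refine ⟨fun x => localNewMaximalReal γ Ω (fun y => ‖gradient ψ y‖) x +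
    c⁻¹ * localNewMaximalReal γ Ω ψ x, hN.add (hU.const_mul c⁻¹), ?_⟩
  filter_upwards [ae_restrict_of_ae hNt] with x hNx
  have hN0 : 0 ≤ localNewMaximalReal γ Ω (fun y => ‖gradient ψ y‖) x := ENNReal.toReal_nonneg
  have hU0 : 0 ≤ localNewMaximalReal γ Ω ψ x := ENNReal.toReal_nonneg
  have hd0 := boundaryDist_nonneg (Ω := Ω) x
  by_cases hcx : c ≤ boundaryDist Ω x
  · calc localNewMaximalReal γ Ω ψ x = c * (0 + c⁻¹ * localNewMaximalReal γ Ω ψ x) := by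
          field_simp
          simp
      _ ≤ _ := by gcongr
  · rw [not_le] at hcx
    have hdx : Metric.infEDist x Ωᶜ = ENNReal.ofReal (boundaryDist Ω x) := by
      rw [ofReal_boundaryDist, eq_comm, min_eq_left_iff]
      by_contra hlt
      have h1 : ENNReal.ofReal (boundaryDist Ω x) = 1 := by
        rw [ofReal_boundaryDist, min_eq_right (not_le.1 hlt).le]
      rw [ENNReal.ofReal_eq_one] at h1
      exact absurd (h1 ▸ hcx) (not_lt.2 (min_le_right _ _))
    have hxψ : x ∉ tsupport ψ := fun hx => by
      have := hδK x hx
      rw [hdx, ENNReal.ofReal_le_ofReal_iff hd0] at this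
      exact absurd ((min_le_left δ 1).trans this) (not_le.2 hcx)
    have key := localNewMaximal_le_infEDist_mul hγ hΩ hp1.le hp.ne
      (hasWeakGradient_gradient hψ.1) hψp hgp (notMem_tsupport_iff_eventuallyEq.1 hxψ)
    rw [hdx] at key
    have := ENNReal.toReal_mono (ENNReal.mul_ne_top ENNReal.ofReal_ne_top hNx.ne) key
    rw [ENNReal.toReal_mul, ENNReal.toReal_ofReal hd0] at this
    refine this.trans ?_
    gcongr
    exact le_add_of_nonneg_right (by positivity)

theorem MemSobolevZero.localNewMaximalReal (hn : 1 ≤ n) (hγ : 0 ≤ γ) (hΩ : IsOpen Ω)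
    {p : ℝ≥0∞} (hp1 : 1 < p) (hp : p < ⊤) {f : EuclideanSpace ℝ (Fin n) → ℝ}
    (hf : MemSobolevZero p Ω f) : MemSobolevZero p Ω (localNewMaximalReal γ Ω f) := by
  obtain ⟨C, hC0, hC⟩ := exists_sobolev_bound hn hγ hΩ hp1 hp
  obtain ⟨_, -, hfin⟩ := exists_localNewMaximal_bound hn hγ hΩ.measurableSet hp1 hp
  obtain ⟨hMf, -⟩ := hC f hf.1
  refine ⟨hMf, fun ε hε => ?_⟩
  have hε2 : 0 < ε / 2 := ENNReal.half_pos hε.ne'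
  -- The tolerance is chosen so that boundedness makes the norm of the maximal function of `f - ψ`
  -- at most `ε / 2`.
  obtain ⟨ψ, hψ, hfψ⟩ := hf.2 (ε / 2 / ENNReal.ofReal C)
    (ENNReal.div_pos hε2.ne' ENNReal.ofReal_ne_top)
  have hψp : MemLp ψ p (volume.restrict Ω) :=
    (hψ.1.continuous.memLp_of_hasCompactSupport hψ.2.1).restrict Ω
  have hgp : MemLp (gradient ψ) p (volume.restrict Ω) :=
    ((continuous_gradient hψ.1).memLp_of_hasCompactSupport
      (hψ.2.1.of_isClosed_subset (isClosed_tsupport _) (tsupport_gradient_subset ψ))).restrict Ω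
  have hv : MemSobolev p Ω (fun x => f x - ψ x) :=
    ((hasWeakGradient_weakGradient hf.1.2.1).sub (hasWeakGradient_gradient hψ.1)).memSobolev hΩ
      (hf.1.1.sub hψp) (hf.1.2.2.sub hgp)
  obtain ⟨hMv, hMvle⟩ := hC _ hv
  set u := _root_.localNewMaximalReal γ Ω f with hu
  set v := _root_.localNewMaximalReal γ Ω (fun x => f x - ψ x) with hvdef
  have ha := hasWeakGradient_weakGradient hMf.2.1
  have hb := hasWeakGradient_weakGradient hMv.2.1
  obtain ⟨G, hG, hGle⟩ := hψ.exists_localNewMaximalReal_le hn hγ hΩ hp1 hp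
  -- By sublinearity `|u - v|` is at most the maximal function of `ψ`, which the boundary distance
  -- controls.
  have hw : MemSobolevZero p Ω (fun x => u x - v x) := by
    refine (ha.sub hb).memSobolevZero_of_le hΩ hp1.le hp.ne (hMf.1.sub hMv.1)
      (hMf.2.2.sub hMv.2.2) hG ?_
    filter_upwards [hGle, ae_restrict_of_ae (hfin f hf.1.1).1, ae_restrict_of_ae (hfin _ hv.1).1,
      ae_restrict_of_ae (hfin ψ hψp).1] with x hx h1 h2 h3
    refine le_trans ?_ hx
    have := enorm_toReal_sub_le h1.ne h2.ne
      (localNewMaximal_le_add (Ω := Ω) hγ hψ.1.continuous (fun y => ?_) x)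
      (localNewMaximal_le_add (Ω := Ω) hγ hψ.1.continuous (fun y => enorm_sub_le) x)
    · rw [← toReal_enorm]
      exact ENNReal.toReal_mono h3.ne this
    · calc ‖f y‖ₑ = ‖(f y - ψ y) + ψ y‖ₑ := by rw [sub_add_cancel]
        _ ≤ _ := enorm_add_le _ _
  obtain ⟨η, hη, hηw⟩ := hw.2 (ε / 2) hε2
  have hη' := hasWeakGradient_gradient (Ω := Ω) hη.1
  refine ⟨η, hη, ?_⟩
  have hvle : sobolevNorm p Ω v ≤ ε / 2 :=
    hMvle.trans ((mul_le_mul_right hfψ.le _).trans ENNReal.mul_div_le)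
  have mη := hη.1.continuous.aestronglyMeasurable (μ := volume.restrict Ω)
  have mη' := (continuous_gradient hη.1).aestronglyMeasurable (μ := volume.restrict Ω)
  have tri : sobolevNorm p Ω (fun x => u x - η x) ≤
      sobolevNorm p Ω (fun x => u x - v x - η x) + sobolevNorm p Ω v := by
    rw [(ha.sub hη').sobolevNorm_eq hΩ, ((ha.sub hb).sub hη').sobolevNorm_eq hΩ, sobolevNorm,
      add_add_add_comm]
    refine add_le_add ?_ ?_
    · refine le_of_eq_of_le ?_ (eLpNorm_add_le ((hMf.1.1.sub hMv.1.1).sub mη) hMv.1.1 hp1.le)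
      congr 1
      ext x
      simp only [Pi.add_apply]
      ring
    · refine le_of_eq_of_le ?_
        (eLpNorm_add_le ((hMf.2.2.1.sub hMv.2.2.1).sub mη') hMv.2.2.1 hp1.le)
      congr 1
      ext1 x
      simp only [Pi.add_apply]
      abel
  have hvt : sobolevNorm p Ω v ≠ ⊤ := (ENNReal.add_lt_top.2 ⟨hMv.1.2, hMv.2.2.2⟩).ne
  calc _ ≤ _ := tri
    _ < ε / 2 + ε / 2 := ENNReal.add_lt_add_of_lt_of_le hvt hηw hvle
    _ = ε := ENNReal.add_halves ε

end ZeroBoundary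

theorem corollary1p7 (n : ℕ) (hn : 1 ≤ n) (γ : ℝ) (hγ : 0 ≤ γ)
    (Ω : Set (EuclideanSpace ℝ (Fin n))) (hΩ : IsOpen Ω) (hΩc : IsConnected Ω)
    (p : ℝ≥0∞) (hp1 : 1 < p) (hp : p < ⊤) :
    (∀ f : EuclideanSpace ℝ (Fin n) → ℝ, MemSobolev p Ω f →
      (∀ᵐ x ∂volume.restrict Ω, localNewMaximal γ Ω f x < ⊤) ∧
      MemSobolev p Ω (localNewMaximalReal γ Ω f) ∧
      (∀ᵐ x ∂volume.restrict Ω,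
        localNewMaximal γ Ω (fun y => ‖weakGradient Ω f y‖) x < ⊤ ∧
        ‖weakGradient Ω (localNewMaximalReal γ Ω f) x‖ₑ ≤
          ENNReal.ofReal (γ * n) * localNewMaximal γ Ω f x +
            2 * localNewMaximal γ Ω (fun y => ‖weakGradient Ω f y‖) x)) ∧
    (∃ C : ℝ, 0 < C ∧ ∀ f : EuclideanSpace ℝ (Fin n) → ℝ, MemSobolev p Ω f →
      sobolevNorm p Ω (localNewMaximalReal γ Ω f) ≤ ENNReal.ofReal C * sobolevNorm p Ω f) ∧
    (∀ f : EuclideanSpace ℝ (Fin n) → ℝ, MemSobolevZero p Ω f →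
      MemSobolevZero p Ω (localNewMaximalReal γ Ω f)) := by
  refine ⟨fun f hf => ?_, ?_, fun f hf => hf.localNewMaximalReal hn hγ hΩ hp1 hp⟩
  · obtain ⟨C, -, hC⟩ := exists_localNewMaximal_bound hn hγ hΩ.measurableSet hp1 hp
    obtain ⟨D, -, hD⟩ := exists_sobolev_bound hn hγ hΩ hp1 hp
    have hg := hasWeakGradient_weakGradient hf.2.1
    obtain ⟨hNt, -, -⟩ := hC _ hf.2.2.norm
    refine ⟨ae_restrict_of_ae (hC f hf.1).1, (hD f hf).1, ?_⟩
    obtain ⟨G, hG, hGle⟩ :=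
      exists_hasWeakGradient_localNewMaximalReal hn hγ hΩ hp1 hp hg hf.1 hf.2.2
    filter_upwards [ae_restrict_of_ae hNt, hGle, hG.weakGradient_ae_eq hΩ] with x hx hGx hGe
    refine ⟨hx, ?_⟩
    rw [hGe]
    -- The nonnegative term with `γ n` is discarded: the second term alone dominates the gradient.
    refine le_add_left ?_
    rw [← ofReal_norm]
    refine (ENNReal.ofReal_le_ofReal hGx).trans_eq ?_
    rw [ENNReal.ofReal_mul zero_le_two, localNewMaximalReal, ENNReal.ofReal_toReal hx.ne,
      ENNReal.ofReal_ofNat]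
  · obtain ⟨C, hC0, hC⟩ := exists_sobolev_bound hn hγ hΩ hp1 hp
    exact ⟨C, hC0, fun f hf => (hC f hf).2⟩
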